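/- Conventions. A weight on $\mathbb R_+=(0,\infty)$ is a non-negative function that is integrable on $(0,r)$ for every $r>0$; a weight $v$ belongs to $B_p$ if there is $C>0$ with $r^p\int_r^\infty v(x)x^{-p}\,dx\le C\int_0^r v(x)\,dx$ for all $r>0$. For a measurable $g$ on $\mathbb R$ with values in $\mathbb R$ or in $[0,\infty]$, let $g^*(t)=\inf\{\sigma\ge 0:|\{x:|g(x)|>\sigma\}|\le t\}$, $t>0$, and $\|g\|_{\Lambda^p(v)}=\big(\int_0^\infty g^*(t)^pv(t)\,dt\big)^{1/p}$. For a measurable $f:\mathbb R^2\to\mathbb R$, let $f_y^*(x,t)=(f(x,\cdot))^*(t)$, $f_{yx}^*(s,t)=(f_y^*(\cdot,t))^*(s)$, and let $$S^2h(s,t)=\frac1{st}\int_0^s\!\int_0^t h(\sigma,\tau)\,d\tau\,d\sigma,\qquad f^{**}=S^2f_{yx}^*,\qquad f_{yx}^{**}(s,t)=\frac1s\int_0^s\Big(\frac1t\int_0^t f_y^*(\cdot,\tau)\,d\tau\Big)^*(\sigma)\,d\sigma .$$ For $h\ge 0$ on $\mathbb R_+^2$ put $\|h\|_{L^p(uv)}=\big(\iint_{\mathbb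 R_+^2}h(s,t)^pu(s)v(t)\,ds\,dt\big)^{1/p}$; let $L^p_{\rm dec}(\mathbb R_+^2,uv)$ be the cone of non-negative $h\in L^p(\mathbb R_+^2,uv)$ that are non-increasing in each variable separately (where $h_{yx}^{**}$ is needed, $h$ is extended by zero to $\mathbb R^2$). The space $\Lambda_2^p(uv)$ consists of the measurable $f$ on $\mathbb R^2$, up to equality almost everywhere, with $\|f\|_{\Lambda_2^p(uv)}:=\|f_{yx}^*\|_{L^p(uv)}<\infty$, and $\Lambda^p(u)[\Lambda^p(v)]$ of those with $\big\|\,x\mapsto\|f(x,\cdot)\|_{\Lambda^p(v)}\big\|_{\Lambda^p(u)}<\infty$. Two functionals $\rho,N$ are equivalent on $E$ if $A\rho\le N\le B\rho$ on $E$ for some constants $A,B>0$. A space $\{f:\rho(f)<\infty\}$ is normable if it is a vector space that carries a norm equivalent to $\rho$. Theorem. Let $p>1$ and let $u,v$ be weights on $\mathbb R_+$, neither of which vanishes almost everywhere. The following conditions are equivalent: (1) $\Lambda_2^p(uv)$ is normable. (2) $u\in B_p$ and $v\in B_p$. (3) $\Lambda^p(u)[\Lambda^p(v)]$ is normable. (4)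 $\Lambda_2^p(uv)$ is a vector space and $\|f\|^*_{\Lambda_2^p(uv)}:=\|f_{yx}^{**}\|_{L^p(uv)}$ is a norm on it, equivalent to $\|\cdot\|_{\Lambda_2^p(uv)}$. (5) $S^2:L^p_{\rm dec}(\mathbb R_+^2,uv)\to L^p(\mathbb R_+^2,uv)$ is bounded, that is, $\|S^2h\|_{L^p(uv)}\le C\|h\|_{L^p(uv)}$ for some $C$ and all $h\in L^p_{\rm dec}(\mathbb R_+^2,uv)$. (6) $h\mapsto h_{yx}^{**}$ is bounded from $L^p_{\rm dec}(\mathbb R_+^2,uv)$ to $L^p(\mathbb R_+^2,uv)$ in the same sense. (7) The functional $\|f\|^{(2)}_{\Lambda_2^p(uv)}:=\|S^2f_{yx}^*\|_{L^p(uv)}=\|f^{**}\|_{L^p(uv)}$ is equivalent to $\|f\|_{\Lambda_2^p(uv)}$ on $\Lambda_2^p(uv)$. -/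

import Mathlib

open Set MeasureTheory
open scoped ENNReal NNReal

noncomputable section

namespace MixedLorentz

/-- A weight on `ℝ₊ = (0, ∞)`: non-negative and locally integrable on `[0, ∞)`, i.e. integrable
on every interval `(0, r)`. Only the values on `(0, ∞)` matter. -/
structure IsWeight (v : ℝ → ℝ) : Prop where
  nonneg : ∀ t, 0 < t → 0 ≤ v t
  locInt : ∀ r, 0 < r → IntegrableOn v (Ioo 0 r)

/-- The condition `B_p`: for some constant `C` and all `r > 0`,
`r ^ p * ∫_r^∞ v(x) / x ^ p dx ≤ C * ∫_0^r v(x) dx`. -/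
def IsBp (p : ℝ) (v : ℝ → ℝ) : Prop :=
  ∃ C : ℝ≥0, ∀ r : ℝ, 0 < r →
    ENNReal.ofReal (r ^ p) * ∫⁻ x in Ioi r, ENNReal.ofReal (v x / x ^ p)
      ≤ C * ∫⁻ x in Ioo 0 r, ENNReal.ofReal (v x)

/-- The decreasing rearrangement `g^*(t) = inf {σ : |{x : g(x) > σ}| ≤ t}` on `(0, ∞)` of a function
`g : ℝ → [0, ∞]`; the rearrangement of a real function `f` is that of `|f|`. -/
def rearr (g : ℝ → ℝ≥0∞) (t : ℝ) : ℝ≥0∞ :=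
  sInf {σ : ℝ≥0∞ | volume {x : ℝ | σ < g x} ≤ ENNReal.ofReal t}

/-- `f_y^*(x, t)`: rearrangement in the second variable, for fixed `x`. -/
def rearrY (f : ℝ → ℝ → ℝ≥0∞) (x t : ℝ) : ℝ≥0∞ := rearr (f x) t

/-- `f_{yx}^*(s, t) = (f_y^*(·, t))_x^*(s)`. -/
def rearrYX (f : ℝ → ℝ → ℝ≥0∞) (s t : ℝ) : ℝ≥0∞ := rearr (fun x => rearrY f x t) s

/-- The averaging operator `t ↦ (1 / t) ∫_0^t g(τ) dτ`. -/
def hardy (g : ℝ → ℝ≥0∞) (t : ℝ) : ℝ≥0∞ :=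
  (∫⁻ τ in Ioo 0 t, g τ) / ENNReal.ofReal t

/-- The two-dimensional Hardy operator
`S²h(s, t) = (1 / (s t)) ∫_0^s ∫_0^t h(σ, τ) dτ dσ`. -/
def hardy2 (h : ℝ → ℝ → ℝ≥0∞) (s t : ℝ) : ℝ≥0∞ :=
  (∫⁻ σ in Ioo 0 s, ∫⁻ τ in Ioo 0 t, h σ τ) / ENNReal.ofReal (s * t)

/-- `f^{**} = S² f_{yx}^*`. -/
def starStar (f : ℝ → ℝ → ℝ≥0∞) : ℝ → ℝ → ℝ≥0∞ := hardy2 (rearrYX f)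

/-- `f_{yx}^{**}(s, t) = S_{2,1} f(s, t)
= (1 / s) ∫_0^s ( (1 / t) ∫_0^t f_y^*(·, τ) dτ )_x^* (σ) dσ`. -/
def starStarYX (f : ℝ → ℝ → ℝ≥0∞) (s t : ℝ) : ℝ≥0∞ :=
  hardy (rearr fun x => hardy (rearrY f x) t) s

/-- The functional of the space `L^p(ℝ₊², uv)`,
`h ↦ (∫_0^∞ ∫_0^∞ h(s, t) ^ p u(s) v(t) dt ds) ^ (1 / p)`. It is only used for functions `h` that
are decreasing in each variable on `ℝ₊²`; these are Lebesgue measurable, so that the iterated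
integral is the integral over `ℝ₊²`. -/
def lpNorm2 (p : ℝ) (u v : ℝ → ℝ) (h : ℝ → ℝ → ℝ≥0∞) : ℝ≥0∞ :=
  (∫⁻ s in Ioi (0 : ℝ), ∫⁻ t in Ioi (0 : ℝ),
    h s t ^ p * ENNReal.ofReal (u s) * ENNReal.ofReal (v t)) ^ (1 / p)

/-- The functional of the classical Lorentz space `Λ^p(v)` on `ℝ`,
`g ↦ (∫_0^∞ g^*(t) ^ p v(t) dt) ^ (1 / p)`. -/
def lorentzNorm (p : ℝ) (v : ℝ → ℝ) (g : ℝ → ℝ≥0∞) : ℝ≥0∞ :=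
  (∫⁻ t in Ioi (0 : ℝ), rearr g t ^ p * ENNReal.ofReal (v t)) ^ (1 / p)

/-- Classes of real Lebesgue measurable functions on `ℝ²`, modulo equality almost everywhere. -/
abbrev L0 : Type := (ℝ × ℝ) →ₘ[(volume : Measure (ℝ × ℝ))] ℝ

/-- `|f|` as a function of the two variables. All functionals below are unchanged when `f` is
modified on a null set of `ℝ²`, so it does not matter which representative is taken. -/
def absVal (f : L0) (x y : ℝ) : ℝ≥0∞ := ‖f (x, y)‖ₑ

/-- The functional `‖f‖_{Λ₂^p(uv)} = ‖f_{yx}^*‖_{L^p(uv)}`. -/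
def norm2 (p : ℝ) (u v : ℝ → ℝ) (f : L0) : ℝ≥0∞ :=
  lpNorm2 p u v (rearrYX (absVal f))

/-- The functional `‖f‖^*_{Λ₂^p(uv)} = ‖f_{yx}^{**}‖_{L^p(uv)}`. -/
def norm2Star (p : ℝ) (u v : ℝ → ℝ) (f : L0) : ℝ≥0∞ :=
  lpNorm2 p u v (starStarYX (absVal f))

/-- The functional `‖f‖^{(2)}_{Λ₂^p(uv)} = ‖f^{**}‖_{L^p(uv)}`. -/
def norm2Two (p : ℝ) (u v : ℝ → ℝ) (f : L0) : ℝ≥0∞ :=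
  lpNorm2 p u v (starStar (absVal f))

/-- The functional of the mixed norm Lorentz space `Λ^q(u)[Λ^p(v)]`: the `Λ^q(u)` functional of
`x ↦ ‖f(x, ·)‖_{Λ^p(v)}`. -/
def mixedNorm (q p : ℝ) (u v : ℝ → ℝ) (f : L0) : ℝ≥0∞ :=
  lorentzNorm q u fun x => lorentzNorm p v (absVal f x)

/-- The functionals `ρ` and `N` are equivalent on the space `{f : ρ f < ∞}`. -/
def IsEquivalent (ρ N : L0 → ℝ≥0∞) : Prop :=
  ∃ A B : ℝ≥0, 0 < A ∧ 0 < B ∧ ∀ f, ρ f < ∞ → A * ρ f ≤ N f ∧ N f ≤ B * ρ f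

/-- The space `{f : ρ f < ∞}` is a vector space, and `N` is a norm on it that is equivalent
to `ρ`. -/
structure IsEquivalentNorm (ρ N : L0 → ℝ≥0∞) : Prop where
  zero_mem : ρ 0 < ∞
  add_mem : ∀ f g, ρ f < ∞ → ρ g < ∞ → ρ (f + g) < ∞
  smul_mem : ∀ (c : ℝ) (f), ρ f < ∞ → ρ (c • f) < ∞
  finite : ∀ f, ρ f < ∞ → N f < ∞
  eq_zero_iff : ∀ f, ρ f < ∞ → (N f = 0 ↔ f = 0)
  smul_eq : ∀ (c : ℝ) (f), ρ f < ∞ → N (c • f) = ‖c‖ₑ * N f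
  add_le : ∀ f g, ρ f < ∞ → ρ g < ∞ → N (f + g) ≤ N f + N g
  equiv : IsEquivalent ρ N

/-- The space `{f : ρ f < ∞}` is normable: it is a vector space that carries a norm equivalent
to `ρ`. -/
def IsNormable (ρ : L0 → ℝ≥0∞) : Prop := ∃ N : L0 → ℝ≥0∞, IsEquivalentNorm ρ N

/-- `h` is decreasing (non-increasing) in each variable separately on `ℝ₊²`. -/
def IsDecreasing (h : ℝ → ℝ → ℝ≥0) : Prop :=
  (∀ s, 0 < s → AntitoneOn (h s) (Ioi 0)) ∧
    ∀ t, 0 < t → AntitoneOn (fun s => h s t) (Ioi 0)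

/-- A function on `ℝ₊²` as a function on `ℝ²`, extended by zero. -/
def zeroExt (h : ℝ → ℝ → ℝ≥0) (x y : ℝ) : ℝ≥0∞ :=
  open scoped Classical in if 0 < x ∧ 0 < y then (h x y : ℝ≥0∞) else 0

/-- The operator `T` is bounded from the cone `L^p_dec(ℝ₊², uv)` of the non-negative functions in
`L^p(ℝ₊², uv)` that are decreasing in each variable, to `L^p(ℝ₊², uv)`. -/
def BoundedOnDec (p : ℝ) (u v : ℝ → ℝ) (T : (ℝ → ℝ → ℝ≥0∞) → ℝ → ℝ → ℝ≥0∞) : Prop :=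
  ∃ C : ℝ≥0, ∀ h : ℝ → ℝ → ℝ≥0, IsDecreasing h → lpNorm2 p u v (zeroExt h) < ∞ →
    lpNorm2 p u v (T (zeroExt h)) ≤ C * lpNorm2 p u v (zeroExt h)

end MixedLorentz

end

open MixedLorentz

/-!
Throughout, `B_p` enters through the inequality of Ariño and Muckenhoupt: for a weight in `B_p`,
averaging over `(0, t)` is bounded on the non-increasing functions of `L^p`
(`lintegral_hardy_rpow_le`). With `G t = ∫_0^t g`, one has `G ^ p ≤ 2 ^ p ∫ g G ^ (p - 1)`; after
an exchange of integrals and Hölder's inequality the `L^p` norm of the averages is bounded by a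
product of the norm of `g` and a power of itself, both for the weight
`x ^ (p - 1) ∫_x^∞ t ^ (-p) v(t) dt`, and by `B_p` this weight is dominated by `v` on non-increasing
functions.

Sufficiency of `B_p`. The inequality, used in each variable, bounds the operator `S²` on functions
that are non-increasing in each variable (`exists_lpNorm2_hardy2_le`). The formula
`∫_0^s g^* = min over l of (l s + ∫ (g - l)_+)` (`lintegral_rearr_le`, `lintegral_rearr_eq`) shows
that the averages of `g^*` are subadditive in `g`, and more generally that they satisfy Minkowski's
integral inequality (`hardy_rearr_lintegral_le`). Hence `f_{yx}^{**}` is subadditive in `f` and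
`f_{yx}^* ≤ f_{yx}^{**} ≤ f^{**} = S² f_{yx}^*` (`starStarYX_le_starStar`), so that all functionals
built from averages are equivalent to those built from rearrangements, and those of
`f_{yx}^{**}` and of the mixed norm space with averages are norms.

Necessity of `B_p`. On products of indicators of intervals all the operators are products of
one-dimensional averages, and boundedness on them is `B_p` (`isBp_of_hardy_chi`). If a space is
normable, then its functional is subadditive up to a constant on finite families, and products with
a fixed factor transfer this to the one-dimensional Lorentz spaces (`isSumBounded_of_isNormable`).
There the cyclic shifts of a step function with values `1 / (j + 1)`, `j < 2 ^ n`, are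
equimeasurable and have a constant sum. Comparing the functional of this sum with that of the step
function shows that `V(r) = ∫_0^r v` satisfies `V(2 ^ n r) ≤ 2⁻¹ (2 ^ n) ^ p V(r)` for some `n` and
all `r` (`IsSumBounded.exists_decay`); here `p > 1` is used. Summing the tail of the integral in
`B_p` over the scales `2 ^ (n j)` gives `B_p` (`isBp_of_decay`).
-/

noncomputable section

namespace MixedLorentz

/-! ### Monotone functions and level sets -/

/-- The layer cake formula for functions with values in `[0, ∞]`. -/
theorem lintegral_eq_lintegral_meas_lt_ennreal {α : Type*} [MeasurableSpace α] {μ : Measure α}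
    [SFinite μ] {φ : α → ℝ≥0∞} (hφ : AEMeasurable φ μ) :
    ∫⁻ x, φ x ∂μ = ∫⁻ σ in Ioi (0 : ℝ), μ {x | ENNReal.ofReal σ < φ x} := by
  have key : ∀ a : ℝ≥0∞,
      ∫⁻ σ in Ioi (0 : ℝ), (if ENNReal.ofReal σ < a then 1 else 0 : ℝ≥0∞) = a := by
    intro a
    have h1 : (fun σ : ℝ => (if ENNReal.ofReal σ < a then 1 else 0 : ℝ≥0∞))
        = indicator {σ : ℝ | ENNReal.ofReal σ < a} 1 := by
      ext σ; simp [indicator]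
    have hm : MeasurableSet {σ : ℝ | ENNReal.ofReal σ < a} :=
      measurableSet_lt ENNReal.measurable_ofReal measurable_const
    rw [h1, lintegral_indicator_one hm, Measure.restrict_apply hm]
    rcases eq_or_ne a ∞ with rfl | ha
    · simp
    · have : {σ : ℝ | ENNReal.ofReal σ < a} ∩ Ioi 0 = Ioo 0 a.toReal := by
        ext σ
        simp only [mem_inter_iff, mem_ofPred, mem_Ioi, mem_Ioo]
        constructor
        · rintro ⟨h, h0⟩
          exact ⟨h0, (ENNReal.ofReal_lt_iff_lt_toReal h0.le ha).1 h⟩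
        · rintro ⟨h0, h⟩
          exact ⟨(ENNReal.ofReal_lt_iff_lt_toReal h0.le ha).2 h, h0⟩
      rw [this, Real.volume_Ioo, sub_zero, ENNReal.ofReal_toReal ha]
  have hae : ∫⁻ σ in Ioi (0 : ℝ), μ {x | ENNReal.ofReal σ < φ x}
      = ∫⁻ σ in Ioi (0 : ℝ), μ {x | ENNReal.ofReal σ < hφ.mk φ x} := by
    refine lintegral_congr fun σ => measure_congr ?_
    filter_upwards [hφ.ae_eq_mk] with x hx
    simp only [eq_iff_iff]
    change ENNReal.ofReal σ < φ x ↔ ENNReal.ofReal σ < hφ.mk φ x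
    rw [hx]
  rw [hae, lintegral_congr_ae hφ.ae_eq_mk]
  set ψ := hφ.mk φ with hψ
  have hψm : Measurable ψ := hφ.measurable_mk
  have hset : MeasurableSet {z : α × ℝ | ENNReal.ofReal z.2 < ψ z.1} :=
    measurableSet_lt (ENNReal.measurable_ofReal.comp measurable_snd) (hψm.comp measurable_fst)
  calc ∫⁻ x, ψ x ∂μ
      = ∫⁻ x, (∫⁻ σ in Ioi (0 : ℝ), (if ENNReal.ofReal σ < ψ x then 1 else 0 : ℝ≥0∞)) ∂μ := by
        simp_rw [key]
    _ = ∫⁻ σ in Ioi (0 : ℝ), (∫⁻ x, (if ENNReal.ofReal σ < ψ x then 1 else 0 : ℝ≥0∞) ∂μ) := by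
        refine lintegral_lintegral_swap ?_
        exact (Measurable.ite hset measurable_const measurable_const).aemeasurable
    _ = _ := by
        refine lintegral_congr fun σ => ?_
        have hm : MeasurableSet {x | ENNReal.ofReal σ < ψ x} :=
          measurableSet_lt measurable_const hψm
        rw [← lintegral_indicator_one hm]
        refine lintegral_congr fun x => ?_
        simp [indicator]

theorem aemeasurable_of_antitoneOn {μ : Measure ℝ} {φ : ℝ → ℝ≥0∞} (hφ : AntitoneOn φ (Ioi 0)) :
    AEMeasurable φ (μ.restrict (Ioi 0)) :=
  aemeasurable_restrict_of_antitoneOn measurableSet_Ioi hφ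

/-- A function on the open quadrant that is non-increasing in each variable separately. -/
structure AntitoneOnQuadrant (F : ℝ → ℝ → ℝ≥0∞) : Prop where
  right : ∀ s, 0 < s → AntitoneOn (F s) (Ioi 0)
  left : ∀ t, 0 < t → AntitoneOn (fun s => F s t) (Ioi 0)

theorem nullMeasurableSet_of_isLowerSet {s : Set (ℝ × ℝ)} (hs : IsLowerSet s) :
    NullMeasurableSet s := by
  have h1 : IsLowerSet ((MeasurableEquiv.finTwoArrow (α := ℝ)) ⁻¹' s) := by
    intro a b hab ha
    exact hs (show MeasurableEquiv.finTwoArrow b ≤ MeasurableEquiv.finTwoArrow a from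
      ⟨hab 0, hab 1⟩) ha
  have h2 := h1.ordConnected.nullMeasurableSet
  have h3 := h2.preimage (volume_preserving_finTwoArrow ℝ).symm.quasiMeasurePreserving
  have h4 : (MeasurableEquiv.finTwoArrow (α := ℝ)).symm ⁻¹'
      ((MeasurableEquiv.finTwoArrow (α := ℝ)) ⁻¹' s) = s := by
    ext z
    simp only [mem_preimage, MeasurableEquiv.apply_symm_apply]
  rw [← h4]
  exact h3

/-- A function that is non-increasing in each variable is measurable up to a null set: its
superlevel sets are traces of lower sets of the plane. -/
theorem AntitoneOnQuadrant.aemeasurable {F : ℝ → ℝ → ℝ≥0∞} (hF : AntitoneOnQuadrant F) :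
    AEMeasurable (Function.uncurry F)
      (((volume : Measure ℝ).restrict (Ioi 0)).prod ((volume : Measure ℝ).restrict (Ioi 0))) := by
  rw [Measure.prod_restrict, ← Measure.volume_eq_prod]
  refine NullMeasurable.aemeasurable ?_
  have hQ : MeasurableSet (Ioi (0 : ℝ) ×ˢ Ioi (0 : ℝ)) := measurableSet_Ioi.prod measurableSet_Ioi
  have key : ∀ a : ℝ≥0∞, NullMeasurableSet (Function.uncurry F ⁻¹' Ioi a)
      ((volume : Measure (ℝ × ℝ)).restrict (Ioi (0 : ℝ) ×ˢ Ioi (0 : ℝ))) := by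
    intro a
    set L : Set (ℝ × ℝ) := {z | ∃ w, z ≤ w ∧ 0 < w.1 ∧ 0 < w.2 ∧ a < F w.1 w.2} with hL
    have hlow : IsLowerSet L := by
      rintro z z' hz ⟨w, hw, h⟩
      exact ⟨w, hz.trans hw, h⟩
    have hLn := (nullMeasurableSet_of_isLowerSet hlow).mono_ac
      (Measure.restrict_le_self (s := Ioi (0 : ℝ) ×ˢ Ioi (0 : ℝ))).absolutelyContinuous
    refine hLn.congr ?_
    filter_upwards [ae_restrict_mem hQ] with z hz
    obtain ⟨hz1, hz2⟩ := hz
    rw [mem_Ioi] at hz1 hz2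
    refine propext ⟨?_, fun h => ⟨z, le_rfl, hz1, hz2, h⟩⟩
    rintro ⟨w, hzw, hw1, hw2, h⟩
    exact h.trans_le ((hF.right _ hw1 (mem_Ioi.2 hz2) hw2 hzw.2).trans
      (hF.left _ hz2 (mem_Ioi.2 hz1) hw1 hzw.1))
  exact @measurable_of_Ioi ℝ≥0∞ (NullMeasurableSpace (ℝ × ℝ) _) _ _ _ _ _ _ _ _ key

/-- Integrals of non-increasing functions are compared by comparing the masses of intervals
`(0, r)`. -/
theorem lintegral_le_of_antitoneOn {μ ν : Measure ℝ} [SFinite μ] [SFinite ν]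
    [NullSingletonClass μ] [NullSingletonClass ν] (hμ0 : μ (Iic 0) = 0) (hν0 : ν (Iic 0) = 0)
    {c : ℝ≥0∞} (h : ∀ r, 0 < r → μ (Ioo 0 r) ≤ c * ν (Ioo 0 r))
    {φ : ℝ → ℝ≥0∞} (hφ : AntitoneOn φ (Ioi 0)) :
    ∫⁻ x, φ x ∂μ ≤ c * ∫⁻ x, φ x ∂ν := by
  have hre : ∀ m : Measure ℝ, m (Iic 0) = 0 → m.restrict (Ioi 0) = m := by
    intro m hm
    refine Measure.restrict_eq_self_of_ae_mem ?_
    rw [ae_iff]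
    convert hm using 2
    ext x
    simp
  rw [← hre μ hμ0, ← hre ν hν0]
  rw [lintegral_eq_lintegral_meas_lt_ennreal (aemeasurable_of_antitoneOn hφ),
    lintegral_eq_lintegral_meas_lt_ennreal (aemeasurable_of_antitoneOn hφ)]
  have hlev : ∀ a : ℝ≥0∞, μ.restrict (Ioi 0) {x | a < φ x}
      ≤ c * ν.restrict (Ioi 0) {x | a < φ x} := by
    intro a
    rw [Measure.restrict_apply' measurableSet_Ioi, Measure.restrict_apply' measurableSet_Ioi]
    set E := {x | a < φ x} ∩ Ioi 0 with hE
    have hEpos : ∀ x ∈ E, 0 < x := fun x hx => hx.2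
    have hdown : ∀ x ∈ E, ∀ y, 0 < y → y ≤ x → y ∈ E := fun x hx y hy hyx =>
      ⟨lt_of_lt_of_le hx.1 (hφ hy hx.2 hyx), hy⟩
    by_cases hb : BddAbove E
    · rcases E.eq_empty_or_nonempty with h0 | hne
      · rw [h0]; simp
      · have hs : 0 < sSup E := by
          obtain ⟨x, hx⟩ := hne
          exact (hEpos x hx).trans_le (le_csSup hb hx)
        have h1 : Ioo 0 (sSup E) ⊆ E := by
          intro y hy
          obtain ⟨x, hx, hyx⟩ := exists_lt_of_lt_csSup hne hy.2
          exact hdown x hx y hy.1 hyx.le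
        have h2 : E ⊆ Ioc 0 (sSup E) := fun x hx => ⟨hEpos x hx, le_csSup hb hx⟩
        calc μ E ≤ μ (Ioc 0 (sSup E)) := measure_mono h2
          _ = μ (Ioo 0 (sSup E)) := measure_congr Ioo_ae_eq_Ioc.symm
          _ ≤ c * ν (Ioo 0 (sSup E)) := h _ hs
          _ ≤ c * ν E := by gcongr
    · have hall : E = Ioi 0 := by
        refine Subset.antisymm (fun x hx => hEpos x hx) fun y hy => ?_
        rw [not_bddAbove_iff] at hb
        obtain ⟨x, hx, hyx⟩ := hb y
        exact hdown x hx y hy hyx.le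
      have hU : Ioi (0 : ℝ) = ⋃ n : ℕ, Ioo 0 ((n : ℝ) + 1) := by
        ext x
        simp only [mem_Ioi, mem_iUnion, mem_Ioo]
        refine ⟨fun hx => ?_, fun ⟨n, hn⟩ => hn.1⟩
        obtain ⟨n, hn⟩ := exists_nat_gt x
        exact ⟨n, hx, by linarith⟩
      have hmono : Monotone fun n : ℕ => Ioo (0 : ℝ) ((n : ℝ) + 1) := by
        intro m n hmn
        have : (m : ℝ) ≤ n := by exact_mod_cast hmn
        exact Ioo_subset_Ioo le_rfl (by linarith)
      rw [hall]
      conv_lhs => rw [hU, hmono.measure_iUnion]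
      refine iSup_le fun n => (h _ (by positivity)).trans ?_
      gcongr
      exact fun x hx => hx.1
  calc _ ≤ ∫⁻ σ in Ioi (0 : ℝ), c * ν.restrict (Ioi 0) {x | ENNReal.ofReal σ < φ x} :=
        lintegral_mono fun σ => hlev _
    _ = _ := by
        refine lintegral_const_mul'' _ ?_
        refine Measurable.aemeasurable
          (Antitone.measurable fun σ σ' hσ => measure_mono fun x hx => ?_)
        exact lt_of_le_of_lt (ENNReal.ofReal_le_ofReal hσ) hx

/-! ### The decreasing rearrangement and its averages -/

/-- The infimum defining the rearrangement is attained. -/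
theorem rearr_le_iff {g : ℝ → ℝ≥0∞} {t : ℝ} {σ : ℝ≥0∞} :
    rearr g t ≤ σ ↔ volume {x : ℝ | σ < g x} ≤ ENNReal.ofReal t := by
  refine ⟨fun h => ?_, fun h => sInf_le h⟩
  rcases eq_or_ne σ ∞ with rfl | hσ
  · simp
  obtain ⟨w, hw, hlim⟩ := exists_seq_strictAnti_tendsto' (show σ < ∞ from hσ.lt_top)
  have hU : {x : ℝ | σ < g x} = ⋃ n, {x : ℝ | w n < g x} := by
    ext x
    simp only [mem_ofPred, mem_iUnion]
    refine ⟨fun hx => ?_, fun ⟨n, hn⟩ => (hlim.1 n).1.trans hn⟩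
    exact (hlim.2.eventually_lt_const hx).exists
  have hmono : Monotone fun n => {x : ℝ | w n < g x} := fun m n hmn x hx =>
    lt_of_le_of_lt (hw.antitone hmn) hx
  rw [hU, hmono.measure_iUnion]
  refine iSup_le fun n => ?_
  obtain ⟨ρ, hρ, hρw⟩ := sInf_lt_iff.1 (lt_of_le_of_lt h (hlim.1 n).1)
  exact (measure_mono fun x hx => hρw.trans hx).trans hρ

theorem lt_rearr_iff {g : ℝ → ℝ≥0∞} {t : ℝ} {σ : ℝ≥0∞} :
    σ < rearr g t ↔ ENNReal.ofReal t < volume {x : ℝ | σ < g x} := by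
  rw [← not_le, rearr_le_iff, not_le]

theorem rearr_antitone (g : ℝ → ℝ≥0∞) : Antitone (rearr g) := fun _ _ h =>
  rearr_le_iff.2 ((rearr_le_iff.1 le_rfl).trans (ENNReal.ofReal_le_ofReal h))

theorem rearr_mono_ae {g h : ℝ → ℝ≥0∞} (hgh : g ≤ᵐ[volume] h) (t : ℝ) :
    rearr g t ≤ rearr h t := by
  rw [rearr_le_iff]
  refine le_trans (measure_mono_ae ?_) (rearr_le_iff.1 (le_refl (rearr h t)))
  filter_upwards [hgh] with x hx hlt using lt_of_lt_of_le hlt hx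

theorem rearr_mono {g h : ℝ → ℝ≥0∞} (hgh : ∀ x, g x ≤ h x) (t : ℝ) : rearr g t ≤ rearr h t :=
  rearr_mono_ae (Filter.Eventually.of_forall hgh) t

theorem rearr_congr_ae {g h : ℝ → ℝ≥0∞} (hgh : g =ᵐ[volume] h) : rearr g = rearr h :=
  funext fun t => le_antisymm (rearr_mono_ae hgh.le t) (rearr_mono_ae hgh.symm.le t)

/-- Equal distribution functions give equal rearrangements. -/
theorem rearr_congr_of_meas {g h : ℝ → ℝ≥0∞}
    (hgh : ∀ σ, volume {x : ℝ | σ < g x} = volume {x : ℝ | σ < h x}) : rearr g = rearr h := by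
  funext t
  simp only [rearr, hgh]

theorem rearr_zero (t : ℝ) : rearr (fun _ => 0) t = 0 := by
  rw [← nonpos_iff_eq_zero, rearr_le_iff]
  simp

theorem rearr_const_mul (c : ℝ≥0∞) (hc : c ≠ ∞) (g : ℝ → ℝ≥0∞) (t : ℝ) :
    rearr (fun x => c * g x) t = c * rearr g t := by
  rcases eq_or_ne c 0 with rfl | h0
  · simp [rearr_zero]
  refine eq_of_forall_ge_iff fun σ => ?_
  rw [rearr_le_iff, mul_comm c, ← ENNReal.le_div_iff_mul_le (Or.inl h0) (Or.inl hc), rearr_le_iff]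
  simp only [mul_comm c, ENNReal.div_lt_iff (Or.inl h0) (Or.inl hc)]

/-- On the half-line, the rearrangement of a non-increasing function lies below the function. -/
theorem rearr_le_of_antitoneOn {g : ℝ → ℝ≥0∞} (hg : AntitoneOn g (Ioi 0))
    (h0 : ∀ x ≤ 0, g x = 0) {t : ℝ} (ht : 0 < t) : rearr g t ≤ g t := by
  rw [rearr_le_iff]
  have : {x : ℝ | g t < g x} ⊆ Ioo 0 t := by
    intro x hx
    have hx0 : 0 < x := by
      by_contra hneg
      rw [mem_ofPred, h0 x (not_lt.1 hneg)] at hx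
      exact not_lt_zero hx
    refine ⟨hx0, ?_⟩
    by_contra hlt
    exact (hg ht hx0 (not_lt.1 hlt)).not_gt hx
  calc _ ≤ volume (Ioo 0 t) := measure_mono this
    _ = _ := by simp

theorem volume_lt_rearr (g : ℝ → ℝ≥0∞) (σ : ℝ≥0∞) :
    volume.restrict (Ioi (0 : ℝ)) {t : ℝ | σ < rearr g t} = volume {x : ℝ | σ < g x} := by
  rw [Measure.restrict_apply' measurableSet_Ioi]
  simp only [lt_rearr_iff]
  rcases eq_or_ne (volume {x : ℝ | σ < g x}) ∞ with h | h
  · rw [h]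
    simp
  · have : {t : ℝ | ENNReal.ofReal t < volume {x : ℝ | σ < g x}} ∩ Ioi 0
        = Ioo 0 (volume {x : ℝ | σ < g x}).toReal := by
      ext t
      simp only [mem_inter_iff, mem_ofPred, mem_Ioi, mem_Ioo]
      constructor
      · rintro ⟨h1, h0⟩
        exact ⟨h0, (ENNReal.ofReal_lt_iff_lt_toReal h0.le h).1 h1⟩
      · rintro ⟨h0, h1⟩
        exact ⟨(ENNReal.ofReal_lt_iff_lt_toReal h0.le h).2 h1, h0⟩
    rw [this, Real.volume_Ioo, sub_zero, ENNReal.ofReal_toReal h]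

/-- A function and its rearrangement have the same integral above each level. -/
theorem lintegral_rearr_sub {g : ℝ → ℝ≥0∞} (hg : AEMeasurable g) (l : ℝ≥0∞) :
    ∫⁻ t in Ioi (0 : ℝ), (rearr g t - l) = ∫⁻ x, (g x - l) := by
  have h1 : AEMeasurable (fun t => rearr g t - l) (volume.restrict (Ioi (0 : ℝ))) :=
    ((rearr_antitone g).measurable.sub_const l).aemeasurable
  rw [lintegral_eq_lintegral_meas_lt_ennreal h1,
    lintegral_eq_lintegral_meas_lt_ennreal (hg.sub_const l)]
  refine lintegral_congr fun σ => ?_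
  simp only [lt_tsub_iff_right]
  exact volume_lt_rearr g _

theorem lintegral_rearr_le {g : ℝ → ℝ≥0∞} (hg : AEMeasurable g) (l : ℝ≥0∞) (s : ℝ) :
    ∫⁻ t in Ioo 0 s, rearr g t ≤ l * ENNReal.ofReal s + ∫⁻ x, (g x - l) := by
  calc ∫⁻ t in Ioo 0 s, rearr g t ≤ ∫⁻ t in Ioo 0 s, (l + (rearr g t - l)) :=
        lintegral_mono fun t => le_add_tsub
    _ = l * ENNReal.ofReal s + ∫⁻ t in Ioo 0 s, (rearr g t - l) := by
        rw [lintegral_add_left measurable_const]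
        simp
    _ ≤ l * ENNReal.ofReal s + ∫⁻ t in Ioi 0, (rearr g t - l) := by
        gcongr
        exact fun x hx => hx.1
    _ = _ := by rw [lintegral_rearr_sub hg]

/-- At the level `rearr g s` the bound of `lintegral_rearr_le` is an equality. -/
theorem lintegral_rearr_eq {g : ℝ → ℝ≥0∞} (hg : AEMeasurable g) (s : ℝ) :
    ∫⁻ t in Ioo 0 s, rearr g t
      = rearr g s * ENNReal.ofReal s + ∫⁻ x, (g x - rearr g s) := by
  refine le_antisymm (lintegral_rearr_le hg _ s) ?_
  have h1 : ∫⁻ t in Ioi (0 : ℝ), (rearr g t - rearr g s)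
      ≤ ∫⁻ t in Ioo 0 s, (rearr g t - rearr g s) := by
    rw [← lintegral_indicator measurableSet_Ioi, ← lintegral_indicator measurableSet_Ioo]
    refine lintegral_mono fun t => ?_
    by_cases ht : t ∈ Ioi (0 : ℝ)
    · rw [indicator_of_mem ht]
      by_cases hts : t < s
      · rw [indicator_of_mem (show t ∈ Ioo 0 s from ⟨ht, hts⟩)]
      · rw [tsub_eq_zero_of_le (rearr_antitone g (not_lt.1 hts))]
        exact zero_le
    · rw [indicator_of_notMem ht]
      exact zero_le
  rw [← lintegral_rearr_sub hg]
  calc _ ≤ rearr g s * ENNReal.ofReal s + ∫⁻ t in Ioo 0 s, (rearr g t - rearr g s) := by gcongr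
    _ = ∫⁻ t in Ioo 0 s, (rearr g s + (rearr g t - rearr g s)) := by
        rw [lintegral_add_left measurable_const]
        simp
    _ ≤ _ := by
        refine setLIntegral_mono (rearr_antitone g).measurable fun t ht => ?_
        exact (add_tsub_cancel_of_le (rearr_antitone g ht.2.le)).le

theorem hardy_mono {g h : ℝ → ℝ≥0∞} {t : ℝ} (hgh : ∀ x, 0 < x → x < t → g x ≤ h x) :
    hardy g t ≤ hardy h t := by
  unfold hardy
  gcongr ?_ / _
  exact setLIntegral_mono' measurableSet_Ioo fun x hx => hgh x hx.1 hx.2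

theorem hardy_const_mul (c : ℝ≥0∞) (hc : c ≠ ∞) (g : ℝ → ℝ≥0∞) (t : ℝ) :
    hardy (fun x => c * g x) t = c * hardy g t := by
  unfold hardy
  rw [lintegral_const_mul' _ _ hc, mul_div_assoc]

theorem le_hardy {g : ℝ → ℝ≥0∞} (hg : AntitoneOn g (Ioi 0)) {t : ℝ} (ht : 0 < t) :
    g t ≤ hardy g t := by
  unfold hardy
  rw [ENNReal.le_div_iff_mul_le (Or.inl (by simpa using ht)) (Or.inl ENNReal.ofReal_ne_top)]
  calc g t * ENNReal.ofReal t = ∫⁻ _ in Ioo 0 t, g t := by simp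
    _ ≤ _ := setLIntegral_mono' measurableSet_Ioo fun x hx => hg hx.1 ht hx.2.le

/-- The averages of a non-increasing function as an integral over `(0, 1)`. -/
theorem hardy_eq_lintegral (g : ℝ → ℝ≥0∞) {t : ℝ} (ht : 0 < t) :
    hardy g t = ∫⁻ x in Ioo (0 : ℝ) 1, g (t * x) := by
  unfold hardy
  rw [ENNReal.div_eq_inv_mul]
  have hemb : MeasurableEmbedding fun x : ℝ => t * x :=
    (Homeomorph.mulLeft₀ t ht.ne').measurableEmbedding
  have h1 : ∫⁻ x in Ioo (0 : ℝ) 1, g (t * x)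
      = ∫⁻ y in Ioo 0 t, g y ∂(Measure.map (fun x => t * x) volume) := by
    have : Ioo (0 : ℝ) 1 = (fun x => t * x) ⁻¹' Ioo 0 t := by
      ext x
      simp only [mem_preimage, mem_Ioo]
      constructor
      · rintro ⟨h0, h1⟩
        exact ⟨mul_pos ht h0, by nlinarith⟩
      · rintro ⟨h0, h1⟩
        exact ⟨pos_of_mul_pos_right h0 ht.le, by nlinarith⟩
    rw [hemb.restrict_map, hemb.lintegral_map, ← this]
  rw [h1, Real.map_volume_mul_left ht.ne', Measure.restrict_smul, lintegral_smul_measure,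
    abs_of_pos (by positivity), ENNReal.ofReal_inv_of_pos ht, smul_eq_mul]

theorem hardy_antitoneOn {g : ℝ → ℝ≥0∞} (hg : AntitoneOn g (Ioi 0)) :
    AntitoneOn (hardy g) (Ioi 0) := by
  intro s hs t ht hst
  rw [mem_Ioi] at hs ht
  rw [hardy_eq_lintegral g hs, hardy_eq_lintegral g ht]
  refine setLIntegral_mono' measurableSet_Ioo fun x hx => hg ?_ ?_ ?_
  · exact mul_pos hs hx.1
  · exact mul_pos ht hx.1
  · exact mul_le_mul_of_nonneg_right hst hx.1.le

theorem hardy_rearr_mono_ae {g h : ℝ → ℝ≥0∞} (hgh : g ≤ᵐ[volume] h) (t : ℝ) :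
    hardy (rearr g) t ≤ hardy (rearr h) t :=
  hardy_mono fun x _ _ => rearr_mono_ae hgh x

theorem hardy_rearr_add_le {f g : ℝ → ℝ≥0∞} (hf : AEMeasurable f) (hg : AEMeasurable g) (t : ℝ) :
    hardy (rearr fun x => f x + g x) t ≤ hardy (rearr f) t + hardy (rearr g) t := by
  unfold hardy
  rw [← ENNReal.add_div]
  gcongr ?_ / _
  rw [lintegral_rearr_eq hf, lintegral_rearr_eq hg]
  set a := rearr f t
  set b := rearr g t
  calc _ ≤ (a + b) * ENNReal.ofReal t + ∫⁻ x, (f x + g x - (a + b)) :=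
        lintegral_rearr_le (hf.add hg) _ _
    _ ≤ (a + b) * ENNReal.ofReal t + ∫⁻ x, ((f x - a) + (g x - b)) := by
        gcongr with x
        exact add_tsub_add_le_tsub_add_tsub
    _ = _ := by
        rw [lintegral_add_left' (hf.sub_const a)]
        ring

/-- Minkowski's integral inequality for the averages of the rearrangement. -/
theorem hardy_rearr_lintegral_le {ν : Measure ℝ} [SFinite ν] {F : ℝ → ℝ → ℝ≥0∞}
    (hF : Measurable (Function.uncurry F)) {s : ℝ} (hs : 0 < s)
    (hr : AEMeasurable (fun τ => rearr (fun x => F x τ) s) ν) :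
    hardy (rearr fun x => ∫⁻ τ, F x τ ∂ν) s ≤ ∫⁻ τ, hardy (rearr fun x => F x τ) s ∂ν := by
  unfold hardy
  have hs' : ENNReal.ofReal s ≠ 0 := by simpa using hs
  simp only [div_eq_mul_inv]
  rw [lintegral_mul_const' _ _ (ENNReal.inv_ne_top.2 hs')]
  refine mul_le_mul_left ?_ _
  set l : ℝ → ℝ≥0∞ := fun τ => rearr (fun x => F x τ) s with hl
  have hFx : Measurable fun x => ∫⁻ τ, F x τ ∂ν := hF.lintegral_prod_right'
  calc _ ≤ (∫⁻ τ, l τ ∂ν) * ENNReal.ofReal s + ∫⁻ x, (∫⁻ τ, F x τ ∂ν - ∫⁻ τ, l τ ∂ν) :=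
        lintegral_rearr_le hFx.aemeasurable _ _
    _ ≤ (∫⁻ τ, l τ * ENNReal.ofReal s ∂ν) + ∫⁻ x, (∫⁻ τ, (F x τ - l τ) ∂ν) := by
        rw [lintegral_mul_const' _ _ ENNReal.ofReal_ne_top]
        gcongr with x
        exact lintegral_sub_le' _ _ hr
    _ = (∫⁻ τ, l τ * ENNReal.ofReal s ∂ν) + ∫⁻ τ, (∫⁻ x, (F x τ - l τ)) ∂ν := by
        congr 1
        refine lintegral_lintegral_swap ?_
        exact hF.aemeasurable.sub hr.comp_snd
    _ ≤ ∫⁻ τ, (l τ * ENNReal.ofReal s + ∫⁻ x, (F x τ - l τ)) ∂ν := le_lintegral_add _ _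
    _ = ∫⁻ τ, (∫⁻ σ in Ioo 0 s, rearr (fun x => F x τ) σ) ∂ν := by
        refine lintegral_congr fun τ => ?_
        exact (lintegral_rearr_eq (hF.comp measurable_prodMk_right).aemeasurable s).symm

theorem ae_eq_zero_of_hardy_rearr_eq_zero {g : ℝ → ℝ≥0∞} (hg : AEMeasurable g) {t : ℝ}
    (ht : 0 < t) (h : hardy (rearr g) t = 0) : g =ᵐ[volume] 0 := by
  unfold hardy at h
  rw [ENNReal.div_eq_zero_iff, lintegral_rearr_eq hg] at h
  have h1 := (h.resolve_right ENNReal.ofReal_ne_top)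
  rw [add_eq_zero, mul_eq_zero] at h1
  have h2 : rearr g t = 0 := h1.1.resolve_right (by simpa using ht)
  rw [h2] at h1
  simpa only [tsub_zero, lintegral_eq_zero_iff' hg] using h1.2

/-! ### Hardy's inequality for non-increasing functions -/

theorem lintegral_Ioo_le_mul {g : ℝ → ℝ≥0∞} {M : ℝ≥0} (hM : ∀ x, g x ≤ M) (t : ℝ) :
    ∫⁻ x in Ioo 0 t, g x ≤ M * ENNReal.ofReal t := by
  calc _ ≤ ∫⁻ _ in Ioo 0 t, (M : ℝ≥0∞) := lintegral_mono fun x => hM x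
    _ = _ := by simp

theorem continuous_lintegral_Ioo {g : ℝ → ℝ≥0∞} {M : ℝ≥0} (hM : ∀ x, g x ≤ M) :
    Continuous fun t : ℝ => ∫⁻ x in Ioo 0 t, g x := by
  have hfin : ∀ t : ℝ, ∫⁻ x in Ioo 0 t, g x ≠ ∞ := fun t =>
    ne_top_of_le_ne_top (ENNReal.mul_ne_top ENNReal.coe_ne_top ENNReal.ofReal_ne_top)
      (lintegral_Ioo_le_mul hM t)
  have hlip : LipschitzWith M fun t : ℝ => (∫⁻ x in Ioo 0 t, g x).toReal := by
    refine LipschitzWith.of_le_add_mul M fun s t => ?_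
    have hsub : Ioo 0 s ⊆ Ioo 0 t ∪ Icc t s := by
      intro x hx
      by_cases h : x < t
      · exact Or.inl ⟨hx.1, h⟩
      · exact Or.inr ⟨not_lt.1 h, hx.2.le⟩
    have h1 : ∫⁻ x in Ioo 0 s, g x ≤ (∫⁻ x in Ioo 0 t, g x) + M * ENNReal.ofReal (dist s t) := by
      calc _ ≤ ∫⁻ x in Ioo 0 t ∪ Icc t s, g x := lintegral_mono_set hsub
        _ ≤ (∫⁻ x in Ioo 0 t, g x) + ∫⁻ x in Icc t s, g x := lintegral_union_le _ _ _
        _ ≤ (∫⁻ x in Ioo 0 t, g x) + ∫⁻ _ in Icc t s, (M : ℝ≥0∞) := by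
            gcongr with x
            exact hM x
        _ ≤ _ := by
            simp only [lintegral_const, MeasurableSet.univ, Measure.restrict_apply, univ_inter,
              Real.volume_Icc]
            gcongr
            exact le_abs_self _
    have h2 := ENNReal.toReal_mono (ENNReal.add_ne_top.2 ⟨hfin t,
      ENNReal.mul_ne_top ENNReal.coe_ne_top ENNReal.ofReal_ne_top⟩) h1
    rwa [ENNReal.toReal_add (hfin t) (ENNReal.mul_ne_top ENNReal.coe_ne_top ENNReal.ofReal_ne_top),
      ENNReal.toReal_mul, ENNReal.toReal_ofReal dist_nonneg, ENNReal.coe_toReal] at h2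
  have := ENNReal.continuous_ofReal.comp hlip.continuous
  refine this.congr fun t => ?_
  simp only [Function.comp_apply]
  exact ENNReal.ofReal_toReal (hfin t)

/-- A substitute, with the constant `2 ^ p`, for the identity
`G ^ p = p ∫ g G ^ (p - 1)` satisfied by the primitive `G` of `g`: half of the mass of `g` on
`(0, t)` sits where `G` is at least half of `G t`. -/
theorem lintegral_rpow_le_mul_lintegral {g : ℝ → ℝ≥0∞} {M : ℝ≥0} (hM : ∀ x, g x ≤ M) {p : ℝ}
    (hp : 1 < p) {t : ℝ} (ht : 0 < t) :
    (∫⁻ x in Ioo 0 t, g x) ^ p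
      ≤ 2 ^ p * ∫⁻ x in Ioo 0 t, g x * (∫⁻ y in Ioo 0 x, g y) ^ (p - 1) := by
  set G : ℝ → ℝ≥0∞ := fun x => ∫⁻ y in Ioo 0 x, g y with hG
  have hGmono : Monotone G := fun a b hab => lintegral_mono_set (Ioo_subset_Ioo le_rfl hab)
  have hGt : G t ≠ ∞ := ne_top_of_le_ne_top
    (ENNReal.mul_ne_top ENNReal.coe_ne_top ENNReal.ofReal_ne_top) (lintegral_Ioo_le_mul hM t)
  have hmem : G t / 2 ∈ Icc (G 0) (G t) := by
    refine ⟨?_, ENNReal.half_le_self⟩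
    simp [hG]
  obtain ⟨m, hm, hGm⟩ :=
    intermediate_value_Icc ht.le (continuous_lintegral_Ioo hM).continuousOn hmem
  change G m = G t / 2 at hGm
  set S := Ioo 0 t ∩ Ici m with hS
  have hSm : MeasurableSet S := measurableSet_Ioo.inter measurableSet_Ici
  have hhalf : G t / 2 ≤ ∫⁻ x in S, g x := by
    have h1 : G t ≤ G m + ∫⁻ x in S, g x := by
      refine le_trans (lintegral_mono_set ?_) (lintegral_union_le _ (Ioo 0 m) S)
      intro x hx
      by_cases h : x < m
      · exact Or.inl ⟨hx.1, h⟩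
      · exact Or.inr ⟨hx, not_lt.1 h⟩
    rw [hGm] at h1
    nth_rewrite 1 [← ENNReal.add_halves (G t)] at h1
    exact (ENNReal.add_le_add_iff_left (ENNReal.div_ne_top hGt two_ne_zero)).1 h1
  have hlow : (G t / 2) ^ p ≤ ∫⁻ x in Ioo 0 t, g x * G x ^ (p - 1) := by
    rcases eq_or_ne (G t) 0 with h0 | h0
    · rw [h0, ENNReal.zero_div, ENNReal.zero_rpow_of_pos (by linarith)]
      exact zero_le
    calc (G t / 2) ^ p = (G t / 2) * (G t / 2) ^ (p - 1) := by
          nth_rewrite 2 [← ENNReal.rpow_one (G t / 2)]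
          rw [← ENNReal.rpow_add _ _ (by simpa using h0) (ENNReal.div_ne_top hGt two_ne_zero)]
          ring_nf
      _ ≤ (∫⁻ x in S, g x) * (G t / 2) ^ (p - 1) := by gcongr
      _ = ∫⁻ x in S, g x * (G t / 2) ^ (p - 1) := by
          rw [lintegral_mul_const' _ _ (ENNReal.rpow_ne_top_of_nonneg (by linarith)
            (ENNReal.div_ne_top hGt two_ne_zero))]
      _ ≤ ∫⁻ x in S, g x * G x ^ (p - 1) := by
          refine setLIntegral_mono' hSm fun x hx => ?_
          have : G t / 2 ≤ G x := hGm ▸ hGmono hx.2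
          gcongr
      _ ≤ _ := lintegral_mono_set inter_subset_left
  calc G t ^ p = 2 ^ p * (G t / 2) ^ p := by
        rw [← ENNReal.mul_rpow_of_nonneg _ _ (by linarith),
          ENNReal.mul_div_cancel two_ne_zero ENNReal.ofNat_ne_top]
    _ ≤ _ := by gcongr

/-- The measures on the half-line coming from weights in `B_p`, with constant `C`. -/
structure IsBpMeasure (p : ℝ) (C : ℝ≥0) (ν : Measure ℝ) : Prop where
  Iic_zero : ν (Iic 0) = 0
  finite : ∀ r, 0 < r → ν (Ioo 0 r) ≠ ∞
  bound : ∀ r, 0 < r →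
    ENNReal.ofReal r ^ p * ∫⁻ x in Ioi r, (ENNReal.ofReal x ^ p)⁻¹ ∂ν ≤ C * ν (Ioo 0 r)

/-- The density `x ^ (p - 1) ∫_x^∞ t ^ (-p) dν(t)`. -/
def tailDensity (p : ℝ) (ν : Measure ℝ) (x : ℝ) : ℝ≥0∞ :=
  ENNReal.ofReal x ^ (p - 1) * ∫⁻ t in Ioi x, (ENNReal.ofReal t ^ p)⁻¹ ∂ν

/-- The measure on the half-line with density `tailDensity`. For non-increasing functions,
integration against it is dominated by integration against `ν`. -/
def tailMeasure (p : ℝ) (ν : Measure ℝ) : Measure ℝ :=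
  (volume.restrict (Ioi 0)).withDensity (tailDensity p ν)

theorem measurable_tail (p : ℝ) (ν : Measure ℝ) :
    Measurable fun x => ∫⁻ t in Ioi x, (ENNReal.ofReal t ^ p)⁻¹ ∂ν :=
  Antitone.measurable fun _ _ h => lintegral_mono_set (Ioi_subset_Ioi h)

theorem measurable_tailDensity (p : ℝ) (ν : Measure ℝ) : Measurable (tailDensity p ν) :=
  (ENNReal.measurable_ofReal.pow_const _).mul (measurable_tail p ν)

theorem hardy_rpow {p : ℝ} (g : ℝ → ℝ≥0∞) (hp : 0 ≤ p) (t : ℝ) :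
    hardy g t ^ p = (ENNReal.ofReal t ^ p)⁻¹ * (∫⁻ x in Ioo 0 t, g x) ^ p := by
  rw [hardy, ENNReal.div_rpow_of_nonneg _ _ hp, ENNReal.div_eq_inv_mul]

theorem rpow_one_div_le_of_le_mul {p : ℝ} {I J D : ℝ≥0∞} (hp : 1 < p) (hI : I ≠ ∞)
    (h : I ≤ D * (J ^ (1 / p) * I ^ (1 - 1 / p))) : I ^ (1 / p) ≤ D * J ^ (1 / p) := by
  rcases eq_or_ne I 0 with rfl | h0
  · rw [ENNReal.zero_rpow_of_pos (by positivity)]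
    exact zero_le
  have h1 : I ^ (1 / p) * I ^ (1 - 1 / p) = I := by
    rw [← ENNReal.rpow_add _ _ h0 hI]
    simp
  have hne : I ^ (1 - 1 / p) ≠ 0 := by
    simp [ENNReal.rpow_eq_zero_iff, h0, hI]
  have hnt : I ^ (1 - 1 / p) ≠ ∞ := by
    simp [ENNReal.rpow_eq_top_iff, h0, hI]
  rw [← ENNReal.mul_le_mul_iff_left hne hnt, h1]
  calc I ≤ _ := h
    _ = _ := by ring

section
variable {p : ℝ} {C : ℝ≥0} {ν : Measure ℝ}

theorem IsBpMeasure.restrict_Ioi (h : IsBpMeasure p C ν) : ν.restrict (Ioi 0) = ν := by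
  refine Measure.restrict_eq_self_of_ae_mem ?_
  rw [ae_iff]
  convert h.Iic_zero using 2
  ext x
  simp

variable [SFinite ν] [NullSingletonClass ν]

/-- After an exchange of integrals the left-hand side is at most
`∫ (min r t / t) ^ p dν(t) = ν (0, r] + r ^ p ∫_r^∞ t ^ (-p) dν(t)`, which `B_p` controls. -/
theorem tailMeasure_Ioo_le (hp : 1 < p) (h : IsBpMeasure p C ν) {r : ℝ} (hr : 0 < r) :
    tailMeasure p ν (Ioo 0 r) ≤ (1 + C) * ν (Ioo 0 r) := by
  have hker : Measurable fun z : ℝ × ℝ => ENNReal.ofReal z.1 ^ (p - 1)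
      * (if z.1 < z.2 then (ENNReal.ofReal z.2 ^ p)⁻¹ else 0) := by
    refine Measurable.mul (by fun_prop) (Measurable.ite ?_ (by fun_prop) measurable_const)
    exact measurableSet_lt measurable_fst measurable_snd
  have hinner : ∀ t, 0 < t → (∫⁻ x in Ioo 0 r, ENNReal.ofReal x ^ (p - 1)
      * (if x < t then (ENNReal.ofReal t ^ p)⁻¹ else 0))
        ≤ ENNReal.ofReal (min r t) ^ p * (ENNReal.ofReal t ^ p)⁻¹ := by
    intro t ht
    have hm : 0 < min r t := lt_min hr ht
    calc (∫⁻ x in Ioo 0 r, ENNReal.ofReal x ^ (p - 1)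
      * (if x < t then (ENNReal.ofReal t ^ p)⁻¹ else 0))
        ≤ ∫⁻ x in Ioo 0 r, (Ioo 0 (min r t)).indicator
          (fun _ => ENNReal.ofReal (min r t) ^ (p - 1) * (ENNReal.ofReal t ^ p)⁻¹) x := by
          refine setLIntegral_mono' measurableSet_Ioo fun x hx => ?_
          by_cases hxt : x < t
          · rw [indicator_of_mem (show x ∈ Ioo 0 (min r t) from ⟨hx.1, lt_min hx.2 hxt⟩),
              if_pos hxt]
            gcongr
            exact (lt_min hx.2 hxt).le
          · rw [if_neg hxt, mul_zero]
            exact zero_le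
      _ ≤ ENNReal.ofReal (min r t) ^ (p - 1) * (ENNReal.ofReal t ^ p)⁻¹
            * ENNReal.ofReal (min r t) := by
          refine (setLIntegral_le_lintegral _ _).trans ?_
          rw [lintegral_indicator_const measurableSet_Ioo]
          simp
      _ = _ := by
          have h1 : ENNReal.ofReal (min r t) ^ p
              = ENNReal.ofReal (min r t) ^ (p - 1) * ENNReal.ofReal (min r t) := by
            nth_rewrite 3 [← ENNReal.rpow_one (ENNReal.ofReal (min r t))]
            rw [← ENNReal.rpow_add _ _ (by simpa using ⟨hr, ht⟩) ENNReal.ofReal_ne_top]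
            ring_nf
          rw [h1]
          ring
  have hIoc : ν (Ioc 0 r) = ν (Ioo 0 r) := measure_congr Ioo_ae_eq_Ioc.symm
  calc tailMeasure p ν (Ioo 0 r)
      = ∫⁻ x in Ioo 0 r, tailDensity p ν x := by
        rw [tailMeasure, withDensity_apply _ measurableSet_Ioo,
          Measure.restrict_restrict measurableSet_Ioo,
          inter_eq_self_of_subset_left (fun x hx => hx.1)]
    _ = ∫⁻ x in Ioo 0 r, (∫⁻ t, ENNReal.ofReal x ^ (p - 1)
          * (if x < t then (ENNReal.ofReal t ^ p)⁻¹ else 0) ∂ν) := by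
        refine lintegral_congr fun x => ?_
        rw [lintegral_const_mul' _ _ (ENNReal.rpow_ne_top_of_nonneg (by linarith)
          ENNReal.ofReal_ne_top), tailDensity, ← lintegral_indicator measurableSet_Ioi]
        rfl
    _ = ∫⁻ t, (∫⁻ x in Ioo 0 r, ENNReal.ofReal x ^ (p - 1)
          * (if x < t then (ENNReal.ofReal t ^ p)⁻¹ else 0)) ∂ν :=
        lintegral_lintegral_swap hker.aemeasurable
    _ = ∫⁻ t in Ioi 0, (∫⁻ x in Ioo 0 r, ENNReal.ofReal x ^ (p - 1)
          * (if x < t then (ENNReal.ofReal t ^ p)⁻¹ else 0)) ∂ν := by rw [h.restrict_Ioi]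
    _ ≤ ∫⁻ t in Ioi 0, ENNReal.ofReal (min r t) ^ p * (ENNReal.ofReal t ^ p)⁻¹ ∂ν :=
        setLIntegral_mono' measurableSet_Ioi hinner
    _ ≤ ∫⁻ t in Ioc 0 r ∪ Ioi r, ENNReal.ofReal (min r t) ^ p * (ENNReal.ofReal t ^ p)⁻¹ ∂ν := by
        rw [Ioc_union_Ioi_eq_Ioi hr.le]
    _ ≤ (∫⁻ t in Ioc 0 r, ENNReal.ofReal (min r t) ^ p * (ENNReal.ofReal t ^ p)⁻¹ ∂ν)
        + ∫⁻ t in Ioi r, ENNReal.ofReal (min r t) ^ p * (ENNReal.ofReal t ^ p)⁻¹ ∂ν :=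
        lintegral_union_le _ _ _
    _ ≤ (∫⁻ _ in Ioc 0 r, 1 ∂ν)
        + ∫⁻ t in Ioi r, ENNReal.ofReal r ^ p * (ENNReal.ofReal t ^ p)⁻¹ ∂ν := by
        refine add_le_add (setLIntegral_mono' measurableSet_Ioc fun t ht => ?_)
          (setLIntegral_mono' measurableSet_Ioi fun t ht => ?_)
        · rw [min_eq_right ht.2]
          exact ENNReal.mul_inv_le_one _
        · rw [min_eq_left (le_of_lt ht)]
    _ ≤ ν (Ioo 0 r) + C * ν (Ioo 0 r) := by
        rw [lintegral_const_mul' _ _ (ENNReal.rpow_ne_top_of_nonneg (by linarith)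
          ENNReal.ofReal_ne_top)]
        refine add_le_add ?_ (h.bound r hr)
        simp [hIoc]
    _ = _ := by ring

theorem lintegral_tailMeasure_le (hp : 1 < p) (h : IsBpMeasure p C ν) {φ : ℝ → ℝ≥0∞}
    (hφ : AntitoneOn φ (Ioi 0)) :
    ∫⁻ x, φ x ∂(tailMeasure p ν) ≤ (1 + C) * ∫⁻ x, φ x ∂ν := by
  have hac : tailMeasure p ν ≪ volume.restrict (Ioi 0) := withDensity_absolutelyContinuous _ _
  have : NullSingletonClass (tailMeasure p ν) := ⟨fun x => hac (measure_singleton x)⟩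
  have : SFinite (tailMeasure p ν) := by unfold tailMeasure; infer_instance
  have h0 : (volume : Measure ℝ).restrict (Ioi 0) (Iic 0) = 0 := by
    rw [Measure.restrict_apply measurableSet_Iic, Iic_inter_Ioi, Ioc_self, measure_empty]
  exact lintegral_le_of_antitoneOn (hac h0) h.Iic_zero (fun r hr => tailMeasure_Ioo_le hp h hr) hφ

/-- The inequality of Ariño and Muckenhoupt for bounded functions with finite left-hand side:
Tonelli's theorem moves the weight to `tailMeasure`, and Hölder's inequality, followed by
`lintegral_tailMeasure_le` for both factors, gives a bound in terms of the left-hand side itself. -/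
theorem hardy_le_of_bounded (hp : 1 < p) (h : IsBpMeasure p C ν) {g : ℝ → ℝ≥0∞}
    (hg : AntitoneOn g (Ioi 0)) {M : ℝ≥0} (hM : ∀ x, g x ≤ M)
    (hfin : ∫⁻ t, hardy g t ^ p ∂ν ≠ ∞) :
    (∫⁻ t, hardy g t ^ p ∂ν) ^ (1 / p) ≤ 2 ^ p * (1 + C) * (∫⁻ t, g t ^ p ∂ν) ^ (1 / p) := by
  have hp0 : 0 < p := by linarith
  refine rpow_one_div_le_of_le_mul hp hfin ?_
  set G : ℝ → ℝ≥0∞ := fun x => ∫⁻ y in Ioo 0 x, g y with hG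
  have hGm : Measurable G :=
    Monotone.measurable fun a b hab => lintegral_mono_set (Ioo_subset_Ioo le_rfl hab)
  have hgm : AEMeasurable g (volume.restrict (Ioi 0)) := aemeasurable_of_antitoneOn hg
  have hHm : AEMeasurable (hardy g) (volume.restrict (Ioi 0)) :=
    aemeasurable_of_antitoneOn (hardy_antitoneOn hg)
  have hac : tailMeasure p ν ≪ volume.restrict (Ioi 0) := withDensity_absolutelyContinuous _ _
  have hker : AEMeasurable (fun z : ℝ × ℝ => (if z.2 < z.1 then (ENNReal.ofReal z.1 ^ p)⁻¹ else 0)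
      * (g z.2 * G z.2 ^ (p - 1))) (ν.prod (volume.restrict (Ioi 0))) := by
    refine AEMeasurable.mul (Measurable.aemeasurable ?_)
      ((hgm.mul (hGm.pow_const _).aemeasurable).comp_snd)
    exact Measurable.ite (measurableSet_lt measurable_snd measurable_fst) (by fun_prop)
      measurable_const
  have hfinG : ∀ x, G x ≠ ∞ := fun x => ne_top_of_le_ne_top
    (ENNReal.mul_ne_top ENNReal.coe_ne_top ENNReal.ofReal_ne_top) (lintegral_Ioo_le_mul hM x)
  calc ∫⁻ t, hardy g t ^ p ∂ν
      = ∫⁻ t in Ioi 0, hardy g t ^ p ∂ν := by rw [h.restrict_Ioi]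
    _ ≤ ∫⁻ t in Ioi 0, 2 ^ p * (∫⁻ x in Ioi 0,
        (if x < t then (ENNReal.ofReal t ^ p)⁻¹ else 0) * (g x * G x ^ (p - 1))) ∂ν := by
        refine setLIntegral_mono' measurableSet_Ioi fun t ht => ?_
        have ht' : ENNReal.ofReal t ≠ 0 := by simpa using ht
        have hinv : (ENNReal.ofReal t ^ p)⁻¹ ≠ ∞ := by
          rw [ENNReal.inv_ne_top]
          simp [ENNReal.rpow_eq_zero_iff, ht']
        rw [hardy_rpow _ hp0.le]
        calc _ ≤ (ENNReal.ofReal t ^ p)⁻¹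
              * (2 ^ p * ∫⁻ x in Ioo 0 t, g x * G x ^ (p - 1)) := by
              gcongr
              exact lintegral_rpow_le_mul_lintegral hM hp ht
          _ = 2 ^ p * ∫⁻ x in Ioo 0 t, (ENNReal.ofReal t ^ p)⁻¹ * (g x * G x ^ (p - 1)) := by
              rw [lintegral_const_mul' _ _ hinv]
              ring
          _ = 2 ^ p * ∫⁻ x in Ioo 0 t, (if x < t then (ENNReal.ofReal t ^ p)⁻¹ else 0)
                * (g x * G x ^ (p - 1)) := by
              congr 1
              refine setLIntegral_congr_fun measurableSet_Ioo fun x hx => ?_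
              simp only [if_pos hx.2]
          _ ≤ _ := by
              gcongr
              exact fun x hx => hx.1
    _ = 2 ^ p * ∫⁻ t, (∫⁻ x in Ioi 0,
        (if x < t then (ENNReal.ofReal t ^ p)⁻¹ else 0) * (g x * G x ^ (p - 1))) ∂ν := by
        rw [h.restrict_Ioi, lintegral_const_mul' _ _ (ENNReal.rpow_ne_top_of_nonneg hp0.le
          ENNReal.ofNat_ne_top)]
    _ = 2 ^ p * ∫⁻ x in Ioi 0, (∫⁻ t,
        (if x < t then (ENNReal.ofReal t ^ p)⁻¹ else 0) * (g x * G x ^ (p - 1)) ∂ν) := by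
        rw [lintegral_lintegral_swap hker]
    _ = 2 ^ p * ∫⁻ x in Ioi 0, tailDensity p ν x * (g x * hardy g x ^ (p - 1)) := by
        congr 1
        refine setLIntegral_congr_fun measurableSet_Ioi fun x hx => ?_
        have hx' : ENNReal.ofReal x ≠ 0 := by simpa using hx
        have hc : g x * G x ^ (p - 1) ≠ ∞ :=
          ENNReal.mul_ne_top (ne_top_of_le_ne_top ENNReal.coe_ne_top (hM x))
            (ENNReal.rpow_ne_top_of_nonneg (by linarith) (hfinG x))
        have hA : (∫⁻ t, (if x < t then (ENNReal.ofReal t ^ p)⁻¹ else 0) ∂ν)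
            = ∫⁻ t in Ioi x, (ENNReal.ofReal t ^ p)⁻¹ ∂ν := by
          rw [← lintegral_indicator measurableSet_Ioi]
          rfl
        have hB : ENNReal.ofReal x ^ (p - 1) * (ENNReal.ofReal x ^ (p - 1))⁻¹ = 1 := by
          refine ENNReal.mul_inv_cancel ?_ ?_
          · simp only [ne_eq, ENNReal.rpow_eq_zero_iff, hx', false_and, false_or, not_and]
            intro h'
            exact absurd h' ENNReal.ofReal_ne_top
          · exact ENNReal.rpow_ne_top_of_nonneg (by linarith) ENNReal.ofReal_ne_top
        rw [lintegral_mul_const' _ _ hc, hA, tailDensity, hardy_rpow _ (by linarith)]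
        set T := ∫⁻ t in Ioi x, (ENNReal.ofReal t ^ p)⁻¹ ∂ν
        calc T * (g x * G x ^ (p - 1))
            = (ENNReal.ofReal x ^ (p - 1) * (ENNReal.ofReal x ^ (p - 1))⁻¹)
              * (T * (g x * G x ^ (p - 1))) := by rw [hB, one_mul]
          _ = _ := by ring
    _ = 2 ^ p * ∫⁻ x, (g * fun x => hardy g x ^ (p - 1)) x ∂(tailMeasure p ν) := by
        congr 1
        rw [tailMeasure, lintegral_withDensity_eq_lintegral_mul₀
          (measurable_tailDensity p ν).aemeasurable (hgm.mul (hHm.pow_const _))]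
        rfl
    _ ≤ 2 ^ p * ((∫⁻ x, g x ^ p ∂(tailMeasure p ν)) ^ (1 / p)
        * (∫⁻ x, (hardy g x ^ (p - 1)) ^ (p / (p - 1)) ∂(tailMeasure p ν))
            ^ (1 / (p / (p - 1)))) := by
        gcongr
        exact ENNReal.lintegral_mul_le_Lp_mul_Lq _ (Real.HolderConjugate.conjExponent hp)
          (hgm.mono_ac hac) ((hHm.pow_const _).mono_ac hac)
    _ = 2 ^ p * ((∫⁻ x, g x ^ p ∂(tailMeasure p ν)) ^ (1 / p)
        * (∫⁻ x, hardy g x ^ p ∂(tailMeasure p ν)) ^ (1 - 1 / p)) := by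
        have hne : p - 1 ≠ 0 := by linarith
        have e1 : (p - 1) * (p / (p - 1)) = p := by field_simp
        have e2 : 1 / (p / (p - 1)) = 1 - 1 / p := by field_simp
        simp_rw [← ENNReal.rpow_mul, e1, e2]
    _ ≤ 2 ^ p * (((1 + C) * ∫⁻ x, g x ^ p ∂ν) ^ (1 / p)
        * ((1 + C) * ∫⁻ x, hardy g x ^ p ∂ν) ^ (1 - 1 / p)) := by
        have he : 0 ≤ 1 - 1 / p := by
          rw [sub_nonneg, div_le_one hp0]
          exact hp.le
        gcongr
        · exact lintegral_tailMeasure_le hp h fun a ha b hb hab =>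
            ENNReal.rpow_le_rpow (hg ha hb hab) hp0.le
        · exact lintegral_tailMeasure_le hp h fun a ha b hb hab =>
            ENNReal.rpow_le_rpow (hardy_antitoneOn hg ha hb hab) hp0.le
    _ = _ := by
        have he : 0 ≤ 1 - 1 / p := by
          rw [sub_nonneg, div_le_one hp0]
          exact hp.le
        have hC1 : (1 + (C : ℝ≥0∞)) ^ (1 / p) * (1 + (C : ℝ≥0∞)) ^ (1 - 1 / p) = 1 + C := by
          rw [← ENNReal.rpow_add _ _ (by simp) (by simp)]
          simp
        rw [ENNReal.mul_rpow_of_nonneg _ _ (by positivity), ENNReal.mul_rpow_of_nonneg _ _ he]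
        set a := (1 + (C : ℝ≥0∞)) ^ (1 / p)
        set b := (1 + (C : ℝ≥0∞)) ^ (1 - 1 / p)
        rw [← hC1]
        ring

end

/-- The inequality of Ariño and Muckenhoupt: Hardy's operator is bounded on the non-increasing
functions of `L^p(ν)`. -/
theorem lintegral_hardy_rpow_le {p : ℝ} (hp : 1 < p) {C : ℝ≥0} {ν : Measure ℝ} [SFinite ν]
    [NullSingletonClass ν] (h : IsBpMeasure p C ν) {g : ℝ → ℝ≥0∞} (hg : AntitoneOn g (Ioi 0)) :
    ∫⁻ t, hardy g t ^ p ∂ν ≤ (2 ^ p * (1 + C)) ^ p * ∫⁻ t, g t ^ p ∂ν := by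
  have hp0 : 0 < p := by linarith
  -- The truncations of `g` are bounded and vanish near infinity, so that the left-hand side is
  -- finite for them.
  set T : ℕ → ℝ → ℝ≥0∞ := fun n x => if x < (n + 1 : ℝ) then min (g x) (n + 1 : ℕ) else 0 with hT
  have hTanti : ∀ n, AntitoneOn (T n) (Ioi 0) := by
    intro n x hx y hy hxy
    simp only [hT]
    split_ifs with h1 h2 h2
    · exact min_le_min_right _ (hg hx hy hxy)
    · linarith
    · exact zero_le
    · exact le_rfl
  have hTb : ∀ n x, T n x ≤ ((n + 1 : ℕ) : ℝ≥0) := by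
    intro n x
    simp only [hT]
    split_ifs
    · exact_mod_cast min_le_right _ _
    · exact zero_le
  have hTmono : ∀ x, Monotone fun n => T n x := by
    intro x m n hmn
    have hmn' : (m : ℝ) ≤ n := by exact_mod_cast hmn
    simp only [hT]
    split_ifs with h1 h2 h2
    · refine min_le_min_left _ ?_
      exact_mod_cast Nat.succ_le_succ hmn
    · linarith
    · exact zero_le
    · exact le_rfl
  have hTle : ∀ n x, T n x ≤ g x := by
    intro n x
    simp only [hT]
    split_ifs
    · exact min_le_left _ _
    · exact zero_le
  have hTsup : ∀ x, ⨆ n, T n x = g x := by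
    intro x
    refine le_antisymm (iSup_le fun n => hTle n x) ?_
    refine le_of_forall_lt fun a ha => ?_
    obtain ⟨N, hN⟩ := ENNReal.exists_nat_gt (ne_top_of_lt ha)
    obtain ⟨N', hN'⟩ := exists_nat_gt x
    refine lt_iSup_iff.2 ⟨max N N', ?_⟩
    have h1 : x < ((max N N' : ℕ) : ℝ) + 1 := by
      have : (N' : ℝ) ≤ ((max N N' : ℕ) : ℝ) := by exact_mod_cast le_max_right _ _
      linarith
    simp only [hT, if_pos h1, lt_min_iff]
    refine ⟨ha, hN.trans_le ?_⟩
    exact_mod_cast (le_max_left N N').trans (Nat.le_succ _)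
  have hfin : ∀ n, ∫⁻ t, hardy (T n) t ^ p ∂ν ≠ ∞ := by
    intro n
    set M : ℝ≥0 := ((n + 1 : ℕ) : ℝ≥0) with hM
    set r : ℝ := n + 1 with hr
    have hr0 : 0 < r := by positivity
    have hle1 : ∀ t ∈ Ioc 0 r, hardy (T n) t ^ p ≤ (M : ℝ≥0∞) ^ p := by
      intro t ht
      refine ENNReal.rpow_le_rpow ?_ hp0.le
      exact ENNReal.div_le_of_le_mul (lintegral_Ioo_le_mul (hTb n) t)
    have hle2 : ∀ t ∈ Ioi r, hardy (T n) t ^ p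
        ≤ (M * ENNReal.ofReal r) ^ p * (ENNReal.ofReal t ^ p)⁻¹ := by
      intro t ht
      rw [hardy_rpow _ hp0.le, mul_comm]
      gcongr
      calc ∫⁻ x in Ioo 0 t, T n x
          ≤ ∫⁻ x in Ioo 0 t, (Ioo 0 r).indicator (fun _ => (M : ℝ≥0∞)) x := by
            refine setLIntegral_mono' measurableSet_Ioo fun x hx => ?_
            by_cases hxr : x < r
            · rw [indicator_of_mem (show x ∈ Ioo 0 r from ⟨hx.1, hxr⟩)]
              exact hTb n x
            · rw [show T n x = 0 from if_neg hxr]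
              exact zero_le
        _ ≤ ∫⁻ x, (Ioo 0 r).indicator (fun _ => (M : ℝ≥0∞)) x := setLIntegral_le_lintegral _ _
        _ = _ := by
            rw [lintegral_indicator_const measurableSet_Ioo]
            simp
    have hIoc : ν (Ioc 0 r) = ν (Ioo 0 r) := measure_congr Ioo_ae_eq_Ioc.symm
    have hMr : ((M : ℝ≥0∞) * ENNReal.ofReal r) ^ p ≠ ∞ := ENNReal.rpow_ne_top_of_nonneg hp0.le
      (ENNReal.mul_ne_top ENNReal.coe_ne_top ENNReal.ofReal_ne_top)
    have htail : ∫⁻ x in Ioi r, (ENNReal.ofReal x ^ p)⁻¹ ∂ν ≠ ∞ := by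
      intro htop
      have h1 := h.bound r hr0
      have h2 : ENNReal.ofReal r ^ p ≠ 0 := by
        simp [ENNReal.rpow_eq_zero_iff, hr0]
      rw [htop, ENNReal.mul_top h2, top_le_iff] at h1
      exact ENNReal.mul_ne_top ENNReal.coe_ne_top (h.finite r hr0) h1
    rw [← h.restrict_Ioi, ← Ioc_union_Ioi_eq_Ioi hr0.le]
    refine ne_top_of_le_ne_top ?_ (lintegral_union_le _ _ _)
    refine ENNReal.add_ne_top.2 ⟨?_, ?_⟩
    · refine ne_top_of_le_ne_top ?_ (setLIntegral_mono' measurableSet_Ioc hle1)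
      rw [setLIntegral_const, hIoc]
      exact ENNReal.mul_ne_top (ENNReal.rpow_ne_top_of_nonneg hp0.le ENNReal.coe_ne_top)
        (h.finite r hr0)
    · refine ne_top_of_le_ne_top ?_ (setLIntegral_mono' measurableSet_Ioi hle2)
      rw [lintegral_const_mul' _ _ hMr]
      exact ENNReal.mul_ne_top hMr htail
  have hTbound : ∀ n, ∫⁻ t, hardy (T n) t ^ p ∂ν
      ≤ (2 ^ p * (1 + C)) ^ p * ∫⁻ t, g t ^ p ∂ν := by
    intro n
    have h1 := ENNReal.rpow_le_rpow (hardy_le_of_bounded hp h (hTanti n) (hTb n) (hfin n)) hp0.le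
    rw [ENNReal.mul_rpow_of_nonneg _ _ hp0.le, ← ENNReal.rpow_mul, ← ENNReal.rpow_mul,
      one_div_mul_cancel hp0.ne', ENNReal.rpow_one, ENNReal.rpow_one] at h1
    refine h1.trans ?_
    gcongr with t
    exact hTle n t
  have hHmono : ∀ t, Monotone fun n => hardy (T n) t := fun t m n hmn =>
    hardy_mono fun x _ _ => hTmono x hmn
  have hHsup : ∀ t, ⨆ n, hardy (T n) t ^ p = hardy g t ^ p := by
    intro t
    have h1 : ∫⁻ x in Ioo 0 t, g x = ⨆ n, ∫⁻ x in Ioo 0 t, T n x := by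
      rw [← lintegral_iSup' (fun n => ?_) (Filter.Eventually.of_forall hTmono)]
      · simp_rw [hTsup]
      · exact (aemeasurable_of_antitoneOn (hTanti n)).mono_set fun x hx => hx.1
    have h2 : hardy g t = ⨆ n, hardy (T n) t := by
      simp only [hardy, h1, ENNReal.iSup_div]
    rw [h2]
    exact ((ENNReal.orderIsoRpow p hp0).map_iSup _).symm
  calc ∫⁻ t, hardy g t ^ p ∂ν = ∫⁻ t, ⨆ n, hardy (T n) t ^ p ∂ν := by simp_rw [hHsup]
    _ = ⨆ n, ∫⁻ t, hardy (T n) t ^ p ∂ν := by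
        refine lintegral_iSup' (fun n => ?_) (Filter.Eventually.of_forall fun t m n hmn =>
          ENNReal.rpow_le_rpow (hHmono t hmn) hp0.le)
        rw [← h.restrict_Ioi]
        exact (aemeasurable_of_antitoneOn (hardy_antitoneOn (hTanti n))).pow_const _
    _ ≤ _ := iSup_le hTbound

/-! ### Weights as measures -/

/-- The measure `v(t) dt` on the half-line. -/
def weightMeasure (v : ℝ → ℝ) : Measure ℝ :=
  (volume.restrict (Ioi 0)).withDensity fun t => ENNReal.ofReal (v t)

instance (v : ℝ → ℝ) : SFinite (weightMeasure v) := by unfold weightMeasure; infer_instance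

theorem weightMeasure_ac (v : ℝ → ℝ) : weightMeasure v ≪ volume.restrict (Ioi 0) :=
  withDensity_absolutelyContinuous _ _

instance (v : ℝ → ℝ) : NullSingletonClass (weightMeasure v) :=
  ⟨fun x => weightMeasure_ac v (measure_singleton x)⟩

theorem ae_pos_weightMeasure (v : ℝ → ℝ) : ∀ᵐ t ∂(weightMeasure v), 0 < t :=
  weightMeasure_ac v (ae_restrict_mem measurableSet_Ioi)

theorem aemeasurable_weightMeasure {v : ℝ → ℝ} {φ : ℝ → ℝ≥0∞} (hφ : AntitoneOn φ (Ioi 0)) :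
    AEMeasurable φ (weightMeasure v) :=
  (aemeasurable_of_antitoneOn hφ).mono_ac (weightMeasure_ac v)

theorem IsWeight.aemeasurable {v : ℝ → ℝ} (hv : IsWeight v) :
    AEMeasurable v (volume.restrict (Ioi 0)) := by
  have hU : Ioi (0 : ℝ) = ⋃ n : ℕ, Ioo 0 ((n : ℝ) + 1) := by
    ext x
    simp only [mem_Ioi, mem_iUnion, mem_Ioo]
    refine ⟨fun hx => ?_, fun ⟨n, hn⟩ => hn.1⟩
    obtain ⟨n, hn⟩ := exists_nat_gt x
    exact ⟨n, hx, by linarith⟩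
  rw [hU, aemeasurable_iUnion_iff]
  exact fun n => (hv.locInt _ (by positivity)).1.aemeasurable

theorem lintegral_weightMeasure {v : ℝ → ℝ} (hv : IsWeight v) {φ : ℝ → ℝ≥0∞}
    (hφ : AEMeasurable φ (volume.restrict (Ioi 0))) :
    ∫⁻ t, φ t ∂(weightMeasure v) = ∫⁻ t in Ioi 0, φ t * ENNReal.ofReal (v t) := by
  rw [weightMeasure, lintegral_withDensity_eq_lintegral_mul₀ hv.aemeasurable.ennreal_ofReal hφ]
  exact lintegral_congr fun t => mul_comm _ _

theorem weightMeasure_Ioo (v : ℝ → ℝ) (r : ℝ) :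
    weightMeasure v (Ioo 0 r) = ∫⁻ x in Ioo 0 r, ENNReal.ofReal (v x) := by
  rw [weightMeasure, withDensity_apply _ measurableSet_Ioo,
    Measure.restrict_restrict measurableSet_Ioo, inter_eq_self_of_subset_left (fun x hx => hx.1)]

theorem IsWeight.measure_Ioo_ne_top {v : ℝ → ℝ} (hv : IsWeight v) {r : ℝ} (hr : 0 < r) :
    weightMeasure v (Ioo 0 r) ≠ ∞ := by
  rw [weightMeasure_Ioo]
  exact ((hv.locInt r hr).lintegral_lt_top).ne

theorem weightMeasure_tail {v : ℝ → ℝ} (hv : IsWeight v) (p : ℝ) {r : ℝ} (hr : 0 < r) :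
    ∫⁻ x in Ioi r, (ENNReal.ofReal x ^ p)⁻¹ ∂(weightMeasure v)
      = ∫⁻ x in Ioi r, ENNReal.ofReal (v x / x ^ p) := by
  have hsub : Ioi r ⊆ Ioi 0 := Ioi_subset_Ioi hr.le
  rw [weightMeasure, restrict_withDensity measurableSet_Ioi,
    Measure.restrict_restrict measurableSet_Ioi, inter_eq_self_of_subset_left hsub,
    lintegral_withDensity_eq_lintegral_mul₀
      (hv.aemeasurable.ennreal_ofReal.mono_measure (Measure.restrict_mono hsub le_rfl))
      (by fun_prop)]
  refine setLIntegral_congr_fun measurableSet_Ioi fun x hx => ?_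
  have hx0 : 0 < x := hr.trans hx
  rw [Pi.mul_apply, ENNReal.ofReal_div_of_pos (Real.rpow_pos_of_pos hx0 p),
    ENNReal.ofReal_rpow_of_pos hx0, div_eq_mul_inv]

theorem isBp_iff {v : ℝ → ℝ} (hv : IsWeight v) {p : ℝ} :
    IsBp p v ↔ ∃ C : ℝ≥0, IsBpMeasure p C (weightMeasure v) := by
  have key : ∀ r : ℝ, 0 < r → ∀ C : ℝ≥0,
      (ENNReal.ofReal (r ^ p) * ∫⁻ x in Ioi r, ENNReal.ofReal (v x / x ^ p)
        ≤ C * ∫⁻ x in Ioo 0 r, ENNReal.ofReal (v x)) ↔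
      (ENNReal.ofReal r ^ p * ∫⁻ x in Ioi r, (ENNReal.ofReal x ^ p)⁻¹ ∂(weightMeasure v)
        ≤ C * weightMeasure v (Ioo 0 r)) := by
    intro r hr C
    rw [weightMeasure_tail hv p hr, weightMeasure_Ioo, ENNReal.ofReal_rpow_of_pos hr]
  constructor
  · rintro ⟨C, hC⟩
    refine ⟨C, ?_, fun r hr => hv.measure_Ioo_ne_top hr, fun r hr => (key r hr C).1 (hC r hr)⟩
    refine weightMeasure_ac v ?_
    rw [Measure.restrict_apply measurableSet_Iic, Iic_inter_Ioi, Ioc_self, measure_empty]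
  · rintro ⟨C, hC⟩
    exact ⟨C, fun r hr => (key r hr C).2 (hC.bound r hr)⟩

theorem IsWeight.weightMeasure_ne_zero {v : ℝ → ℝ} (hv : IsWeight v)
    (hv0 : ¬ v =ᵐ[volume.restrict (Ioi 0)] 0) : weightMeasure v ≠ 0 := by
  intro h0
  refine hv0 ?_
  have h1 := (withDensity_eq_zero_iff hv.aemeasurable.ennreal_ofReal).1 h0
  filter_upwards [h1, ae_restrict_mem measurableSet_Ioi] with x hx hx0
  exact le_antisymm (by simpa using hx) (hv.nonneg x hx0)

theorem exists_weightMeasure_Ioo_pos {v : ℝ → ℝ} (hv : weightMeasure v ≠ 0) :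
    ∃ R : ℝ, 0 < R ∧ weightMeasure v (Ioo 0 R) ≠ 0 := by
  by_contra! hcon
  refine hv (Measure.measure_univ_eq_zero.1 ?_)
  have h1 : weightMeasure v (Ioi 0)ᶜ = 0 := ae_pos_weightMeasure v
  have h2 : weightMeasure v (Ioi 0) = 0 := by
    have hU : Ioi (0 : ℝ) ⊆ ⋃ n : ℕ, Ioo 0 ((n : ℝ) + 1) := by
      intro x hx
      obtain ⟨n, hn⟩ := exists_nat_gt x
      exact mem_iUnion.2 ⟨n, hx, by linarith⟩
    exact measure_mono_null hU (measure_iUnion_null fun n => hcon _ (by positivity))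
  rw [← union_compl_self (Ioi (0 : ℝ))]
  exact measure_union_null h2 h1

theorem exists_pos_of_lintegral_eq_zero {v : ℝ → ℝ} (hv : weightMeasure v ≠ 0) {φ : ℝ → ℝ≥0∞}
    (hφ : AntitoneOn φ (Ioi 0)) (h : ∫⁻ t, φ t ∂(weightMeasure v) = 0) : ∃ t, 0 < t ∧ φ t = 0 := by
  rw [lintegral_eq_zero_iff' (aemeasurable_weightMeasure hφ)] at h
  have : (ae (weightMeasure v)).NeBot := ae_neBot.2 hv
  obtain ⟨t, ht⟩ := ((ae_pos_weightMeasure v).and h).exists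
  exact ⟨t, ht.1, ht.2⟩

/-! ### The functional of `L^p(uv)` on functions decreasing in each variable -/

theorem AntitoneOnQuadrant.lintegral_antitoneOn {F : ℝ → ℝ → ℝ≥0∞} (hF : AntitoneOnQuadrant F)
    {p : ℝ} (hp : 0 ≤ p) (v : ℝ → ℝ) :
    AntitoneOn (fun s => ∫⁻ t, F s t ^ p ∂(weightMeasure v)) (Ioi 0) := by
  intro s hs s' hs' hss
  refine lintegral_mono_ae ?_
  filter_upwards [ae_pos_weightMeasure v] with t ht
  exact ENNReal.rpow_le_rpow (hF.left t ht hs hs' hss) hp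

theorem lpNorm2_eq {p : ℝ} (hp : 0 ≤ p) {u v : ℝ → ℝ} (hu : IsWeight u) (hv : IsWeight v)
    {F : ℝ → ℝ → ℝ≥0∞} (hF : AntitoneOnQuadrant F) :
    lpNorm2 p u v F
      = (∫⁻ s, ∫⁻ t, F s t ^ p ∂(weightMeasure v) ∂(weightMeasure u)) ^ (1 / p) := by
  unfold lpNorm2
  congr 1
  rw [lintegral_weightMeasure hu (aemeasurable_of_antitoneOn (hF.lintegral_antitoneOn hp v))]
  refine setLIntegral_congr_fun measurableSet_Ioi fun s hs => ?_
  rw [lintegral_weightMeasure hv ((aemeasurable_of_antitoneOn (hF.right s hs)).pow_const p),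
    ← lintegral_mul_const' _ _ ENNReal.ofReal_ne_top]
  exact lintegral_congr fun t => by ring

theorem lpNorm2_mono {p : ℝ} (hp : 0 ≤ p) {u v : ℝ → ℝ} {F G : ℝ → ℝ → ℝ≥0∞}
    (h : ∀ s t, 0 < s → 0 < t → F s t ≤ G s t) : lpNorm2 p u v F ≤ lpNorm2 p u v G := by
  unfold lpNorm2
  refine ENNReal.rpow_le_rpow (setLIntegral_mono' measurableSet_Ioi fun s hs => ?_) (by positivity)
  refine setLIntegral_mono' measurableSet_Ioi fun t ht => ?_
  have := h s t hs ht
  gcongr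

theorem lpNorm2_const_mul {p : ℝ} (hp : 0 < p) {u v : ℝ → ℝ} (c : ℝ≥0∞) (hc : c ≠ ∞)
    (F : ℝ → ℝ → ℝ≥0∞) : lpNorm2 p u v (fun s t => c * F s t) = c * lpNorm2 p u v F := by
  have hcp : c ^ p ≠ ∞ := ENNReal.rpow_ne_top_of_nonneg hp.le hc
  unfold lpNorm2
  simp_rw [ENNReal.mul_rpow_of_nonneg _ _ hp.le, mul_assoc, lintegral_const_mul' _ _ hcp]
  rw [ENNReal.mul_rpow_of_nonneg _ _ (by positivity), ← ENNReal.rpow_mul,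
    mul_one_div_cancel hp.ne', ENNReal.rpow_one]

theorem lpNorm2_add_le {p : ℝ} (hp : 1 ≤ p) {u v : ℝ → ℝ} (hu : IsWeight u) (hv : IsWeight v)
    {F G : ℝ → ℝ → ℝ≥0∞} (hF : AntitoneOnQuadrant F) (hG : AntitoneOnQuadrant G) :
    lpNorm2 p u v (fun s t => F s t + G s t) ≤ lpNorm2 p u v F + lpNorm2 p u v G := by
  have hp0 : 0 < p := by linarith
  have hFG : AntitoneOnQuadrant fun s t => F s t + G s t :=
    ⟨fun s hs a ha b hb hab => add_le_add (hF.right s hs ha hb hab) (hG.right s hs ha hb hab),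
      fun t ht a ha b hb hab => add_le_add (hF.left t ht ha hb hab) (hG.left t ht ha hb hab)⟩
  rw [lpNorm2_eq hp0.le hu hv hF, lpNorm2_eq hp0.le hu hv hG, lpNorm2_eq hp0.le hu hv hFG]
  set A : (ℝ → ℝ → ℝ≥0∞) → ℝ → ℝ≥0∞ := fun F s => (∫⁻ t, F s t ^ p ∂(weightMeasure v)) ^ (1 / p)
    with hA
  have hAp : ∀ F s, A F s ^ p = ∫⁻ t, F s t ^ p ∂(weightMeasure v) := fun F s => by
    rw [hA, ← ENNReal.rpow_mul, one_div_mul_cancel hp0.ne', ENNReal.rpow_one]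
  have hAm : ∀ F, AntitoneOnQuadrant F → AEMeasurable (A F) (weightMeasure u) := fun F hF =>
    (aemeasurable_weightMeasure (hF.lintegral_antitoneOn hp0.le v)).pow_const _
  calc _ ≤ (∫⁻ s, (A F + A G) s ^ p ∂(weightMeasure u)) ^ (1 / p) := by
        refine ENNReal.rpow_le_rpow (lintegral_mono_ae ?_) (by positivity)
        filter_upwards [ae_pos_weightMeasure u] with s hs
        rw [← hAp (fun s t => F s t + G s t)]
        refine ENNReal.rpow_le_rpow ?_ hp0.le
        exact ENNReal.lintegral_Lp_add_le (aemeasurable_weightMeasure (hF.right s hs))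
          (aemeasurable_weightMeasure (hG.right s hs)) hp
    _ ≤ (∫⁻ s, A F s ^ p ∂(weightMeasure u)) ^ (1 / p)
        + (∫⁻ s, A G s ^ p ∂(weightMeasure u)) ^ (1 / p) :=
        ENNReal.lintegral_Lp_add_le (hAm F hF) (hAm G hG) hp
    _ = _ := by simp_rw [hAp]

theorem hardy2_eq (F : ℝ → ℝ → ℝ≥0∞) {s t : ℝ} (hs : 0 < s) (ht : 0 < t) :
    hardy2 F s t = hardy (fun σ => hardy (F σ) t) s := by
  have ht' : (ENNReal.ofReal t)⁻¹ ≠ ∞ := by simpa using ht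
  unfold hardy2 hardy
  simp only [div_eq_mul_inv]
  rw [lintegral_mul_const' _ _ ht', ENNReal.ofReal_mul hs.le,
    ENNReal.mul_inv (Or.inl (by simpa using hs)) (Or.inl ENNReal.ofReal_ne_top)]
  ring

theorem AntitoneOnQuadrant.hardy_right {F : ℝ → ℝ → ℝ≥0∞} (hF : AntitoneOnQuadrant F) :
    AntitoneOnQuadrant fun s t => hardy (F s) t :=
  ⟨fun s hs => hardy_antitoneOn (hF.right s hs), fun _ _ _ ha _ hb hab =>
    hardy_mono fun x hx _ => hF.left x hx ha hb hab⟩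

theorem AntitoneOnQuadrant.hardy_left {F : ℝ → ℝ → ℝ≥0∞} (hF : AntitoneOnQuadrant F) :
    AntitoneOnQuadrant fun s t => hardy (fun σ => F σ t) s :=
  ⟨fun _ _ _ ha _ hb hab => hardy_mono fun x hx _ => hF.right x hx ha hb hab,
    fun t ht => hardy_antitoneOn (hF.left t ht)⟩

theorem AntitoneOnQuadrant.congr {F G : ℝ → ℝ → ℝ≥0∞} (hF : AntitoneOnQuadrant F)
    (h : ∀ s t, 0 < s → 0 < t → F s t = G s t) : AntitoneOnQuadrant G :=
  ⟨fun s hs a ha b hb hab => by rw [← h s a hs ha, ← h s b hs hb]; exact hF.right s hs ha hb hab,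
    fun t ht a ha b hb hab => by
      simp only [← h a t ha ht, ← h b t hb ht]; exact hF.left t ht ha hb hab⟩

theorem AntitoneOnQuadrant.lintegral_swap {F : ℝ → ℝ → ℝ≥0∞} (hF : AntitoneOnQuadrant F) (p : ℝ)
    (u v : ℝ → ℝ) :
    ∫⁻ s, ∫⁻ t, F s t ^ p ∂(weightMeasure v) ∂(weightMeasure u)
      = ∫⁻ t, ∫⁻ s, F s t ^ p ∂(weightMeasure u) ∂(weightMeasure v) :=
  lintegral_lintegral_swap ((hF.aemeasurable.mono_ac
    ((weightMeasure_ac u).prod (weightMeasure_ac v))).pow_const p)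

/-- The two-dimensional Hardy operator is bounded on the functions of `L^p(uv)` that are
non-increasing in each variable: the one-dimensional inequality is applied in each variable. -/
theorem exists_lpNorm2_hardy2_le {p : ℝ} (hp : 1 < p) {u v : ℝ → ℝ} (hu : IsWeight u)
    (hv : IsWeight v) (hub : IsBp p u) (hvb : IsBp p v) :
    ∃ C : ℝ≥0, 0 < C ∧ ∀ F, AntitoneOnQuadrant F →
      lpNorm2 p u v (hardy2 F) ≤ C * lpNorm2 p u v F := by
  have hp0 : 0 < p := by linarith
  obtain ⟨C₁, h₁⟩ := (isBp_iff hu).1 hub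
  obtain ⟨C₂, h₂⟩ := (isBp_iff hv).1 hvb
  have hcoe : ∀ C : ℝ≥0, (2 ^ p * (1 + (C : ℝ≥0∞))) ^ p
      = (((2 ^ p * (1 + C)) ^ p : ℝ≥0) : ℝ≥0∞) := by
    intro C
    rw [ENNReal.coe_rpow_of_nonneg _ hp0.le, ENNReal.coe_mul, ENNReal.coe_rpow_of_nonneg _ hp0.le]
    simp
  set D₁ : ℝ≥0 := (2 ^ p * (1 + C₁)) ^ p
  set D₂ : ℝ≥0 := (2 ^ p * (1 + C₂)) ^ p
  refine ⟨(D₁ * D₂) ^ (1 / p), NNReal.rpow_pos (by positivity), fun F hF => ?_⟩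
  have hG : AntitoneOnQuadrant fun s t => hardy (fun σ => hardy (F σ) t) s :=
    hF.hardy_right.hardy_left
  rw [lpNorm2_eq hp0.le hu hv (hG.congr fun s t hs ht => (hardy2_eq F hs ht).symm),
    lpNorm2_eq hp0.le hu hv hF, ENNReal.coe_rpow_of_nonneg _ (by positivity),
    ← ENNReal.mul_rpow_of_nonneg _ _ (by positivity)]
  refine ENNReal.rpow_le_rpow ?_ (by positivity)
  calc ∫⁻ s, ∫⁻ t, hardy2 F s t ^ p ∂(weightMeasure v) ∂(weightMeasure u)
      = ∫⁻ s, ∫⁻ t, hardy (fun σ => hardy (F σ) t) s ^ p ∂(weightMeasure v) ∂(weightMeasure u) := by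
        refine lintegral_congr_ae ?_
        filter_upwards [ae_pos_weightMeasure u] with s hs
        refine lintegral_congr_ae ?_
        filter_upwards [ae_pos_weightMeasure v] with t ht
        rw [hardy2_eq F hs ht]
    _ = ∫⁻ t, ∫⁻ s, hardy (fun σ => hardy (F σ) t) s ^ p ∂(weightMeasure u) ∂(weightMeasure v) :=
        hG.lintegral_swap p u v
    _ ≤ ∫⁻ t, D₁ * ∫⁻ s, hardy (F s) t ^ p ∂(weightMeasure u) ∂(weightMeasure v) := by
        refine lintegral_mono_ae ?_
        filter_upwards [ae_pos_weightMeasure v] with t ht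
        rw [← hcoe]
        exact lintegral_hardy_rpow_le hp h₁ (hF.hardy_right.left t ht)
    _ = D₁ * ∫⁻ s, ∫⁻ t, hardy (F s) t ^ p ∂(weightMeasure v) ∂(weightMeasure u) := by
        rw [lintegral_const_mul' _ _ ENNReal.coe_ne_top, hF.hardy_right.lintegral_swap p u v]
    _ ≤ D₁ * ∫⁻ s, D₂ * ∫⁻ t, F s t ^ p ∂(weightMeasure v) ∂(weightMeasure u) := by
        refine mul_le_mul_right (lintegral_mono_ae ?_) _
        filter_upwards [ae_pos_weightMeasure u] with s hs
        rw [← hcoe]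
        exact lintegral_hardy_rpow_le hp h₂ (hF.right s hs)
    _ = _ := by
        rw [lintegral_const_mul' _ _ ENNReal.coe_ne_top, ENNReal.coe_mul, mul_assoc]

/-! ### Iterated rearrangements -/

theorem antitoneOnQuadrant_rearrYX (f : ℝ → ℝ → ℝ≥0∞) : AntitoneOnQuadrant (rearrYX f) :=
  ⟨fun _ _ _ _ _ _ hab => rearr_mono (fun x => rearr_antitone (f x) hab) _,
    fun _ _ _ _ _ _ hab => rearr_antitone _ hab⟩

theorem antitoneOnQuadrant_starStarYX (f : ℝ → ℝ → ℝ≥0∞) : AntitoneOnQuadrant (starStarYX f) :=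
  ⟨fun _ _ _ ha _ hb hab => hardy_mono fun _ _ _ =>
      rearr_mono (fun x => hardy_antitoneOn ((rearr_antitone (f x)).antitoneOn _) ha hb hab) _,
    fun _ _ => hardy_antitoneOn ((rearr_antitone _).antitoneOn _)⟩

theorem AntitoneOnQuadrant.hardy2 {F : ℝ → ℝ → ℝ≥0∞} (hF : AntitoneOnQuadrant F) :
    AntitoneOnQuadrant (hardy2 F) :=
  hF.hardy_right.hardy_left.congr fun _ _ hs ht => (hardy2_eq F hs ht).symm

theorem AntitoneOnQuadrant.le_hardy2 {F : ℝ → ℝ → ℝ≥0∞} (hF : AntitoneOnQuadrant F) {s t : ℝ}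
    (hs : 0 < s) (ht : 0 < t) : F s t ≤ MixedLorentz.hardy2 F s t := by
  rw [hardy2_eq F hs ht]
  exact (le_hardy (hF.right s hs) ht).trans (le_hardy (hF.hardy_right.left t ht) hs)

theorem AntitoneOnQuadrant.hardy2_eq_swap {F : ℝ → ℝ → ℝ≥0∞} (hF : AntitoneOnQuadrant F) {s t : ℝ}
    (hs : 0 < s) : MixedLorentz.hardy2 F s t
      = (ENNReal.ofReal t)⁻¹ * ∫⁻ τ in Ioo 0 t, hardy (fun σ => F σ τ) s := by
  have hs' : (ENNReal.ofReal s)⁻¹ ≠ ∞ := by simpa using hs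
  unfold MixedLorentz.hardy2 hardy
  simp only [div_eq_mul_inv]
  rw [lintegral_mul_const' _ _ hs', ENNReal.ofReal_mul hs.le,
    ENNReal.mul_inv (Or.inl (by simpa using hs)) (Or.inl ENNReal.ofReal_ne_top),
    lintegral_lintegral_swap]
  · ring
  · refine hF.aemeasurable.mono_measure ?_
    exact Measure.prod_mono (Measure.restrict_mono (fun x hx => hx.1) le_rfl)
      (Measure.restrict_mono (fun x hx => hx.1) le_rfl)

theorem rearrYX_congr {f g : ℝ → ℝ → ℝ≥0∞} (h : ∀ᵐ x, f x =ᵐ[volume] g x) :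
    rearrYX f = rearrYX g := by
  funext s t
  refine congrFun (rearr_congr_ae ?_) s
  filter_upwards [h] with x hx
  exact congrFun (rearr_congr_ae hx) t

theorem starStarYX_mono {f g : ℝ → ℝ → ℝ≥0∞} (h : ∀ᵐ x, f x ≤ᵐ[volume] g x) (s t : ℝ) :
    starStarYX f s t ≤ starStarYX g s t := by
  refine hardy_rearr_mono_ae ?_ s
  filter_upwards [h] with x hx
  exact hardy_rearr_mono_ae hx t

theorem starStarYX_congr {f g : ℝ → ℝ → ℝ≥0∞} (h : ∀ᵐ x, f x =ᵐ[volume] g x) :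
    starStarYX f = starStarYX g := by
  funext s t
  refine le_antisymm (starStarYX_mono ?_ s t) (starStarYX_mono ?_ s t)
  · filter_upwards [h] with x hx using hx.le
  · filter_upwards [h] with x hx using hx.symm.le

theorem measurable_rearrY {f : ℝ → ℝ → ℝ≥0∞} (hf : Measurable (Function.uncurry f)) :
    Measurable (Function.uncurry (rearrY f)) := by
  refine measurable_of_Ioi fun σ => ?_
  have h1 : Measurable fun x : ℝ => volume {y : ℝ | σ < f x y} :=
    measurable_measure_prodMk_left (measurableSet_lt measurable_const hf)
  have h2 : Function.uncurry (rearrY f) ⁻¹' Ioi σ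
      = {z : ℝ × ℝ | ENNReal.ofReal z.2 < volume {y : ℝ | σ < f z.1 y}} := by
    ext z
    exact lt_rearr_iff
  rw [h2]
  exact measurableSet_lt (ENNReal.measurable_ofReal.comp measurable_snd) (h1.comp measurable_fst)

theorem measurable_hardy_rearrY {f : ℝ → ℝ → ℝ≥0∞} (hf : Measurable (Function.uncurry f)) :
    Measurable fun z : ℝ × ℝ => hardy (rearrY f z.1) z.2 := by
  refine Measurable.div ?_ (ENNReal.measurable_ofReal.comp measurable_snd)
  have h1 : Measurable fun w : (ℝ × ℝ) × ℝ =>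
      if 0 < w.2 ∧ w.2 < w.1.2 then rearrY f w.1.1 w.2 else 0 := by
    refine Measurable.ite ?_ ((measurable_rearrY hf).comp
      ((measurable_fst.comp measurable_fst).prodMk measurable_snd)) measurable_const
    exact (measurableSet_lt measurable_const measurable_snd).inter
      (measurableSet_lt measurable_snd (measurable_snd.comp measurable_fst))
  have h2 := h1.lintegral_prod_right' (ν := (volume : Measure ℝ))
  have h3 : (fun z : ℝ × ℝ => ∫⁻ τ in Ioo 0 z.2, rearrY f z.1 τ)
      = fun z : ℝ × ℝ => ∫⁻ τ, if 0 < τ ∧ τ < z.2 then rearrY f z.1 τ else 0 := by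
    funext z
    rw [← lintegral_indicator measurableSet_Ioo]
    refine lintegral_congr fun τ => ?_
    simp only [indicator, mem_Ioo]
  rw [h3]
  exact h2

/-- Minkowski's integral inequality moves the rearrangement in `x` inside the average in `y`. -/
theorem starStarYX_le_starStar {f : ℝ → ℝ → ℝ≥0∞} (hf : Measurable (Function.uncurry f)) {s t : ℝ}
    (hs : 0 < s) (ht : 0 < t) : starStarYX f s t ≤ starStar f s t := by
  have ht' : (ENNReal.ofReal t)⁻¹ ≠ ∞ := by simpa using ht
  have h1 : starStarYX f s t
      = (ENNReal.ofReal t)⁻¹ * hardy (rearr fun x => ∫⁻ τ in Ioo 0 t, rearrY f x τ) s := by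
    rw [← hardy_const_mul _ ht']
    simp_rw [← rearr_const_mul _ ht', ← ENNReal.div_eq_inv_mul]
    rfl
  rw [h1, starStar, (antitoneOnQuadrant_rearrYX f).hardy2_eq_swap hs]
  refine mul_le_mul_right (hardy_rearr_lintegral_le (measurable_rearrY hf) hs ?_) _
  exact (Antitone.measurable fun a b hab => rearr_mono (fun x => rearr_antitone (f x) hab)
    s).aemeasurable

theorem rearrYX_le_starStarYX (f : ℝ → ℝ → ℝ≥0∞) {s t : ℝ} (hs : 0 < s) (ht : 0 < t) :
    rearrYX f s t ≤ starStarYX f s t :=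
  (rearr_mono (fun x => le_hardy ((rearr_antitone (f x)).antitoneOn _) ht) s).trans
    (le_hardy ((rearr_antitone _).antitoneOn _) hs)

theorem starStarYX_add_le {f g : ℝ → ℝ → ℝ≥0∞} (hf : Measurable (Function.uncurry f))
    (hg : Measurable (Function.uncurry g)) (s t : ℝ) :
    starStarYX (fun x y => f x y + g x y) s t ≤ starStarYX f s t + starStarYX g s t := by
  have hm : ∀ {f : ℝ → ℝ → ℝ≥0∞}, Measurable (Function.uncurry f) →
      AEMeasurable fun x => hardy (rearrY f x) t := fun hf =>
    ((measurable_hardy_rearrY hf).comp measurable_prodMk_right).aemeasurable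
  refine le_trans ?_ (hardy_rearr_add_le (hm hf) (hm hg) s)
  refine hardy_rearr_mono_ae (Filter.Eventually.of_forall fun x => ?_) s
  exact hardy_rearr_add_le hf.of_uncurry_left.aemeasurable hg.of_uncurry_left.aemeasurable t

theorem starStarYX_const_mul (c : ℝ≥0∞) (hc : c ≠ ∞) (f : ℝ → ℝ → ℝ≥0∞) (s t : ℝ) :
    starStarYX (fun x y => c * f x y) s t = c * starStarYX f s t := by
  unfold starStarYX
  rw [← hardy_const_mul _ hc]
  simp_rw [← rearr_const_mul _ hc, ← hardy_const_mul _ hc]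
  have h1 : ∀ x, rearrY (fun x y => c * f x y) x = fun τ => c * rearrY f x τ := fun x =>
    funext fun τ => rearr_const_mul c hc (f x) τ
  simp_rw [h1]

/-! ### Classes of measurable functions -/

theorem measurable_absVal (f : L0) : Measurable (Function.uncurry (absVal f)) :=
  f.stronglyMeasurable.measurable.enorm

theorem ae_ae_of_ae_volume {P : ℝ × ℝ → Prop} (h : ∀ᵐ z, P z) : ∀ᵐ x : ℝ, ∀ᵐ y : ℝ, P (x, y) := by
  rw [Measure.volume_eq_prod] at h
  exact Measure.ae_ae_of_ae_prod h

theorem absVal_add_le (f g : L0) :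
    ∀ᵐ x : ℝ, absVal (f + g) x ≤ᵐ[volume] fun y => absVal f x y + absVal g x y := by
  refine ae_ae_of_ae_volume (P := fun z => ‖(f + g) z‖ₑ ≤ ‖f z‖ₑ + ‖g z‖ₑ) ?_
  filter_upwards [AEEqFun.coeFn_add f g] with z hz
  rw [hz]
  exact enorm_add_le _ _

theorem absVal_smul (c : ℝ) (f : L0) :
    ∀ᵐ x : ℝ, absVal (c • f) x =ᵐ[volume] fun y => ‖c‖ₑ * absVal f x y := by
  refine ae_ae_of_ae_volume (P := fun z => ‖(c • f) z‖ₑ = ‖c‖ₑ * ‖f z‖ₑ) ?_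
  filter_upwards [AEEqFun.coeFn_smul c f] with z hz
  rw [hz, Pi.smul_apply, enorm_smul]

theorem eq_zero_of_absVal {f : L0} (h : ∀ᵐ x : ℝ, absVal f x =ᵐ[volume] 0) : f = 0 := by
  have h1 : ∫⁻ z, ‖f z‖ₑ ∂((volume : Measure ℝ).prod (volume : Measure ℝ)) = 0 := by
    have hm : Measurable fun z => ‖f z‖ₑ := measurable_absVal f
    rw [lintegral_prod _ hm.aemeasurable,
      lintegral_eq_zero_iff hm.lintegral_prod_right']
    filter_upwards [h] with x hx
    exact (lintegral_eq_zero_iff (measurable_absVal f).of_uncurry_left).2 hx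
  rw [lintegral_eq_zero_iff (f := fun z => ‖f z‖ₑ) (measurable_absVal f),
    ← Measure.volume_eq_prod] at h1
  refine AEEqFun.ext ?_
  filter_upwards [h1, AEEqFun.coeFn_zero (α := ℝ × ℝ) (μ := volume) (β := ℝ)] with z hz h0
  rw [h0]
  simpa using hz

/-- A criterion for `IsEquivalentNorm`: a subadditive, homogeneous and definite functional between
two multiples of `ρ`. -/
theorem isEquivalentNorm_of {ρ N : L0 → ℝ≥0∞} {B : ℝ≥0} (hB : 0 < B) (h1 : ∀ f, ρ f ≤ N f)
    (h2 : ∀ f, N f ≤ B * ρ f) (hadd : ∀ f g, N (f + g) ≤ N f + N g)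
    (hsmul : ∀ (c : ℝ) (f), N (c • f) = ‖c‖ₑ * N f) (hdef : ∀ f, N f = 0 → f = 0) :
    IsEquivalentNorm ρ N := by
  have hfin : ∀ f, ρ f < ∞ → N f < ∞ := fun f hf =>
    (h2 f).trans_lt (ENNReal.mul_lt_top ENNReal.coe_lt_top hf)
  have h0 : N 0 = 0 := by simpa using hsmul 0 0
  refine ⟨?_, ?_, ?_, hfin, fun f _ => ⟨hdef f, fun h => h ▸ h0⟩, fun c f _ => hsmul c f,
    fun f g _ _ => hadd f g, 1, B, one_pos, hB, fun f _ => ⟨?_, h2 f⟩⟩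
  · exact (h1 0).trans_lt (by rw [h0]; exact ENNReal.zero_lt_top)
  · exact fun f g hf hg => (h1 _).trans_lt ((hadd f g).trans_lt
      (ENNReal.add_lt_top.2 ⟨hfin f hf, hfin g hg⟩))
  · intro c f hf
    refine (h1 _).trans_lt ?_
    rw [hsmul]
    exact ENNReal.mul_lt_top enorm_lt_top (hfin f hf)
  · simpa using h1 f

section
variable {p : ℝ} {u v : ℝ → ℝ}

theorem eq_zero_of_norm2Star_eq_zero (hp : 0 < p) (hu : IsWeight u) (hv : IsWeight v)
    (hu0 : weightMeasure u ≠ 0) (hv0 : weightMeasure v ≠ 0) {f : L0}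
    (h : norm2Star p u v f = 0) : f = 0 := by
  have hF := antitoneOnQuadrant_starStarYX (absVal f)
  rw [norm2Star, lpNorm2_eq hp.le hu hv hF, ENNReal.rpow_eq_zero_iff_of_pos (by positivity)] at h
  obtain ⟨s, hs, h1⟩ := exists_pos_of_lintegral_eq_zero hu0 (hF.lintegral_antitoneOn hp.le v) h
  obtain ⟨t, ht, h2⟩ := exists_pos_of_lintegral_eq_zero hv0 (fun a ha b hb hab =>
    ENNReal.rpow_le_rpow (hF.right s hs ha hb hab) hp.le) h1
  rw [ENNReal.rpow_eq_zero_iff_of_pos hp] at h2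
  have hm : Measurable fun x => hardy (rearrY (absVal f) x) t :=
    (measurable_hardy_rearrY (measurable_absVal f)).comp measurable_prodMk_right
  refine eq_zero_of_absVal ?_
  filter_upwards [ae_eq_zero_of_hardy_rearr_eq_zero hm.aemeasurable hs h2] with x hx
  exact ae_eq_zero_of_hardy_rearr_eq_zero (measurable_absVal f).of_uncurry_left.aemeasurable ht hx

theorem isEquivalentNorm_norm2Star (hp : 1 < p) (hu : IsWeight u) (hv : IsWeight v)
    (hu0 : weightMeasure u ≠ 0) (hv0 : weightMeasure v ≠ 0) (hub : IsBp p u) (hvb : IsBp p v) :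
    IsEquivalentNorm (norm2 p u v) (norm2Star p u v) := by
  have hp0 : 0 < p := by linarith
  obtain ⟨C, hC, hCb⟩ := exists_lpNorm2_hardy2_le hp hu hv hub hvb
  refine isEquivalentNorm_of hC (fun f => ?_) (fun f => ?_) (fun f g => ?_) (fun c f => ?_)
    (fun f => eq_zero_of_norm2Star_eq_zero hp0 hu hv hu0 hv0)
  · exact lpNorm2_mono hp0.le fun s t hs ht => rearrYX_le_starStarYX _ hs ht
  · exact (lpNorm2_mono hp0.le fun s t hs ht =>
      starStarYX_le_starStar (measurable_absVal f) hs ht).trans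
      (hCb _ (antitoneOnQuadrant_rearrYX _))
  · refine le_trans (lpNorm2_mono hp0.le fun s t _ _ => ?_) (lpNorm2_add_le hp.le hu hv
      (antitoneOnQuadrant_starStarYX _) (antitoneOnQuadrant_starStarYX _))
    exact (starStarYX_mono (absVal_add_le f g) s t).trans
      (starStarYX_add_le (measurable_absVal f) (measurable_absVal g) s t)
  · unfold norm2Star
    rw [starStarYX_congr (absVal_smul c f), ← lpNorm2_const_mul hp0 _ enorm_ne_top]
    congr! 2
    funext t
    exact starStarYX_const_mul _ enorm_ne_top _ _ _

theorem isEquivalent_norm2Two (hp : 1 < p) (hu : IsWeight u) (hv : IsWeight v)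
    (hub : IsBp p u) (hvb : IsBp p v) : IsEquivalent (norm2 p u v) (norm2Two p u v) := by
  obtain ⟨C, hC, hCb⟩ := exists_lpNorm2_hardy2_le hp hu hv hub hvb
  refine ⟨1, C, one_pos, hC, fun f _ => ⟨?_, hCb _ (antitoneOnQuadrant_rearrYX _)⟩⟩
  rw [ENNReal.coe_one, one_mul]
  exact lpNorm2_mono (by linarith) fun s t hs ht => (antitoneOnQuadrant_rearrYX _).le_hardy2 hs ht

/-! ### Decreasing functions on the quadrant -/

theorem IsDecreasing.antitoneOnQuadrant {h : ℝ → ℝ → ℝ≥0} (hh : IsDecreasing h) :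
    AntitoneOnQuadrant (zeroExt h) := by
  constructor
  · intro s hs a ha b hb hab
    rw [mem_Ioi] at ha hb
    simp only [zeroExt, hs, ha, hb, and_self, if_true]
    exact_mod_cast hh.1 s hs ha hb hab
  · intro t ht a ha b hb hab
    rw [mem_Ioi] at ha hb
    simp only [zeroExt, ht, ha, hb, and_self, if_true]
    exact_mod_cast hh.2 t ht ha hb hab

theorem boundedOnDec_hardy2 (hp : 1 < p) (hu : IsWeight u) (hv : IsWeight v)
    (hub : IsBp p u) (hvb : IsBp p v) : BoundedOnDec p u v hardy2 := by
  obtain ⟨C, _, hCb⟩ := exists_lpNorm2_hardy2_le hp hu hv hub hvb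
  exact ⟨C, fun h hh _ => hCb _ hh.antitoneOnQuadrant⟩

/-- For a function that is already non-increasing on the quadrant each rearrangement lies below the
function, which makes Minkowski's inequality and joint measurability unnecessary. -/
theorem starStarYX_zeroExt_le {h : ℝ → ℝ → ℝ≥0} (hh : IsDecreasing h) {s t : ℝ} (hs : 0 < s)
    (ht : 0 < t) : starStarYX (zeroExt h) s t ≤ hardy2 (zeroExt h) s t := by
  have hF := hh.antitoneOnQuadrant
  rw [hardy2_eq _ hs ht]
  refine hardy_mono fun σ hσ _ => ?_
  refine (rearr_le_of_antitoneOn ?_ ?_ hσ).trans (hardy_mono fun τ hτ _ => ?_)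
  · intro a ha b hb hab
    refine hardy_mono fun τ hτ _ => rearr_mono (fun y => ?_) τ
    by_cases hy : 0 < y
    · exact hF.left y hy ha hb hab
    · simp [zeroExt, hy]
  · intro x hx
    have h0 : zeroExt h x = fun _ => 0 := by
      funext y
      simp [zeroExt, not_lt.2 hx]
    simp [hardy, rearrY, h0, rearr_zero]
  · refine rearr_le_of_antitoneOn (hF.right σ hσ) (fun y hy => ?_) hτ
    simp [zeroExt, not_lt.2 hy]

theorem boundedOnDec_starStarYX (hp : 1 < p) (hu : IsWeight u) (hv : IsWeight v)
    (hub : IsBp p u) (hvb : IsBp p v) : BoundedOnDec p u v starStarYX := by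
  obtain ⟨C, hC⟩ := boundedOnDec_hardy2 hp hu hv hub hvb
  exact ⟨C, fun h hh hfin => (lpNorm2_mono (by linarith) fun s t hs ht =>
    starStarYX_zeroExt_le hh hs ht).trans (hC h hh hfin)⟩

/-! ### Mixed norm spaces -/

/-- The functional obtained from that of `Λ^p(v)` when the rearrangement `g^*` is replaced by its
averages. -/
def gammaNorm (p : ℝ) (v : ℝ → ℝ) (g : ℝ → ℝ≥0∞) : ℝ≥0∞ :=
  (∫⁻ t, hardy (rearr g) t ^ p ∂(weightMeasure v)) ^ (1 / p)

theorem lorentzNorm_eq (hv : IsWeight v) (g : ℝ → ℝ≥0∞) :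
    lorentzNorm p v g = (∫⁻ t, rearr g t ^ p ∂(weightMeasure v)) ^ (1 / p) := by
  rw [lorentzNorm,
    lintegral_weightMeasure hv ((rearr_antitone g).measurable.pow_const p).aemeasurable]

theorem lorentzNorm_mono (hp : 0 < p) {g h : ℝ → ℝ≥0∞} (hgh : ∀ x, g x ≤ h x) :
    lorentzNorm p v g ≤ lorentzNorm p v h := by
  unfold lorentzNorm
  refine ENNReal.rpow_le_rpow (lintegral_mono fun t => ?_) (by positivity)
  have := rearr_mono hgh t
  gcongr

theorem gammaNorm_mono_ae (hp : 0 < p) {g h : ℝ → ℝ≥0∞} (hgh : g ≤ᵐ[volume] h) :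
    gammaNorm p v g ≤ gammaNorm p v h := by
  unfold gammaNorm
  refine ENNReal.rpow_le_rpow (lintegral_mono fun t => ?_) (by positivity)
  exact ENNReal.rpow_le_rpow (hardy_rearr_mono_ae hgh t) hp.le

theorem gammaNorm_const_mul (hp : 0 < p) (c : ℝ≥0∞) (hc : c ≠ ∞) (g : ℝ → ℝ≥0∞) :
    gammaNorm p v (fun x => c * g x) = c * gammaNorm p v g := by
  have hcp : c ^ p ≠ ∞ := ENNReal.rpow_ne_top_of_nonneg hp.le hc
  have h1 : rearr (fun x => c * g x) = fun t => c * rearr g t :=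
    funext fun t => rearr_const_mul c hc g t
  unfold gammaNorm
  simp_rw [h1, hardy_const_mul c hc, ENNReal.mul_rpow_of_nonneg _ _ hp.le]
  rw [lintegral_const_mul' _ _ hcp,
    ENNReal.mul_rpow_of_nonneg _ _ (by positivity), ← ENNReal.rpow_mul,
    mul_one_div_cancel hp.ne', ENNReal.rpow_one]

theorem antitoneOn_hardy_rearr (g : ℝ → ℝ≥0∞) : AntitoneOn (hardy (rearr g)) (Ioi 0) :=
  hardy_antitoneOn ((rearr_antitone g).antitoneOn _)

theorem gammaNorm_add_le (hp : 1 ≤ p) {f g : ℝ → ℝ≥0∞} (hf : AEMeasurable f)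
    (hg : AEMeasurable g) :
    gammaNorm p v (fun x => f x + g x) ≤ gammaNorm p v f + gammaNorm p v g := by
  unfold gammaNorm
  refine le_trans ?_ (ENNReal.lintegral_Lp_add_le
    (aemeasurable_weightMeasure (antitoneOn_hardy_rearr f))
    (aemeasurable_weightMeasure (antitoneOn_hardy_rearr g)) hp)
  refine ENNReal.rpow_le_rpow (lintegral_mono fun t => ?_) (by positivity)
  exact ENNReal.rpow_le_rpow (hardy_rearr_add_le hf hg t) (by linarith)

theorem ae_eq_zero_of_gammaNorm_eq_zero (hp : 0 < p) (hv0 : weightMeasure v ≠ 0) {g : ℝ → ℝ≥0∞}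
    (hg : AEMeasurable g) (h : gammaNorm p v g = 0) : g =ᵐ[volume] 0 := by
  rw [gammaNorm, ENNReal.rpow_eq_zero_iff_of_pos (by positivity)] at h
  obtain ⟨t, ht, h2⟩ := exists_pos_of_lintegral_eq_zero hv0 (fun a ha b hb hab =>
    ENNReal.rpow_le_rpow (antitoneOn_hardy_rearr g ha hb hab) hp.le) h
  rw [ENNReal.rpow_eq_zero_iff_of_pos hp] at h2
  exact ae_eq_zero_of_hardy_rearr_eq_zero hg ht h2

theorem lorentzNorm_le_gammaNorm (hp : 0 < p) (hv : IsWeight v) (g : ℝ → ℝ≥0∞) :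
    lorentzNorm p v g ≤ gammaNorm p v g := by
  rw [lorentzNorm_eq hv, gammaNorm]
  refine ENNReal.rpow_le_rpow (lintegral_mono_ae ?_) (by positivity)
  filter_upwards [ae_pos_weightMeasure v] with t ht
  exact ENNReal.rpow_le_rpow (le_hardy ((rearr_antitone g).antitoneOn _) ht) hp.le

theorem exists_gammaNorm_le (hp : 1 < p) (hv : IsWeight v) (hvb : IsBp p v) :
    ∃ C : ℝ≥0, 0 < C ∧ ∀ g, gammaNorm p v g ≤ C * lorentzNorm p v g := by
  have hp0 : 0 < p := by linarith
  obtain ⟨C, h⟩ := (isBp_iff hv).1 hvb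
  refine ⟨2 ^ p * (1 + C), by positivity, fun g => ?_⟩
  have hcoe : ((2 ^ p * (1 + C) : ℝ≥0) : ℝ≥0∞) = 2 ^ p * (1 + (C : ℝ≥0∞)) := by
    rw [ENNReal.coe_mul, ENNReal.coe_rpow_of_nonneg _ hp0.le]
    simp
  have h1 := ENNReal.rpow_le_rpow (lintegral_hardy_rpow_le hp h
    ((rearr_antitone g).antitoneOn _)) (show 0 ≤ 1 / p by positivity)
  rwa [ENNReal.mul_rpow_of_nonneg _ _ (by positivity), ← ENNReal.rpow_mul,
    mul_one_div_cancel hp0.ne', ENNReal.rpow_one, ← hcoe, ← lorentzNorm_eq hv] at h1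

/-- The counterpart of `mixedNorm` built from `gammaNorm`. -/
def mixedGammaNorm (p : ℝ) (u v : ℝ → ℝ) (f : L0) : ℝ≥0∞ :=
  gammaNorm p u fun x => gammaNorm p v (absVal f x)

theorem measurable_gammaNorm {f : ℝ → ℝ → ℝ≥0∞} (hf : Measurable (Function.uncurry f)) :
    Measurable fun x => gammaNorm p v (f x) :=
  (((measurable_hardy_rearrY hf).pow_const p).lintegral_prod_right').pow_const _

theorem isNormable_mixedNorm (hp : 1 < p) (hu : IsWeight u) (hv : IsWeight v)
    (hu0 : weightMeasure u ≠ 0) (hv0 : weightMeasure v ≠ 0) (hub : IsBp p u) (hvb : IsBp p v) :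
    IsNormable (mixedNorm p p u v) := by
  have hp0 : 0 < p := by linarith
  obtain ⟨C₁, hC₁, h₁⟩ := exists_gammaNorm_le hp hu hub
  obtain ⟨C₂, hC₂, h₂⟩ := exists_gammaNorm_le hp hv hvb
  have hm : ∀ f : L0, AEMeasurable fun x => gammaNorm p v (absVal f x) := fun f =>
    (measurable_gammaNorm (measurable_absVal f)).aemeasurable
  refine ⟨mixedGammaNorm p u v, isEquivalentNorm_of (B := C₂ * C₁) (by positivity) (fun f => ?_)
    (fun f => ?_) (fun f g => ?_) (fun c f => ?_) (fun f hf => ?_)⟩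
  · exact (lorentzNorm_mono hp0 fun x => lorentzNorm_le_gammaNorm hp0 hv _).trans
      (lorentzNorm_le_gammaNorm hp0 hu _)
  · calc mixedGammaNorm p u v f
        ≤ gammaNorm p u fun x => C₂ * lorentzNorm p v (absVal f x) :=
          gammaNorm_mono_ae hp0 (Filter.Eventually.of_forall fun x => h₂ _)
      _ = C₂ * gammaNorm p u fun x => lorentzNorm p v (absVal f x) :=
          gammaNorm_const_mul hp0 _ ENNReal.coe_ne_top _
      _ ≤ C₂ * (C₁ * mixedNorm p p u v f) := by
          gcongr
          exact h₁ _
      _ = _ := by rw [ENNReal.coe_mul, mul_assoc]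
  · refine le_trans (gammaNorm_mono_ae hp0 ?_) (gammaNorm_add_le hp.le (hm f) (hm g))
    filter_upwards [absVal_add_le f g] with x hx
    exact (gammaNorm_mono_ae hp0 hx).trans (gammaNorm_add_le hp.le
      (measurable_absVal f).of_uncurry_left.aemeasurable
      (measurable_absVal g).of_uncurry_left.aemeasurable)
  · have h1 : (fun x => gammaNorm p v (absVal (c • f) x))
        =ᵐ[volume] fun x => ‖c‖ₑ * gammaNorm p v (absVal f x) := by
      filter_upwards [absVal_smul c f] with x hx
      rw [← gammaNorm_const_mul hp0 _ enorm_ne_top]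
      exact le_antisymm (gammaNorm_mono_ae hp0 hx.le) (gammaNorm_mono_ae hp0 hx.symm.le)
    unfold mixedGammaNorm
    rw [← gammaNorm_const_mul hp0 _ enorm_ne_top]
    exact le_antisymm (gammaNorm_mono_ae hp0 h1.le) (gammaNorm_mono_ae hp0 h1.symm.le)
  · refine eq_zero_of_absVal ?_
    filter_upwards [ae_eq_zero_of_gammaNorm_eq_zero hp0 hu0 (hm f) hf] with x hx
    exact ae_eq_zero_of_gammaNorm_eq_zero hp0 hv0
      (measurable_absVal f).of_uncurry_left.aemeasurable hx

end

/-! ### Indicators of intervals and products -/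

/-- The indicator function of the interval `(0, r]`. -/
def chi (r : ℝ) : ℝ → ℝ≥0 := (Ioc 0 r).indicator 1

theorem chi_of_mem {r x : ℝ} (h : x ∈ Ioc 0 r) : chi r x = 1 := indicator_of_mem h _

theorem chi_of_notMem {r x : ℝ} (h : x ∉ Ioc 0 r) : chi r x = 0 := indicator_of_notMem h _

theorem measurable_chi (r : ℝ) : Measurable (chi r) := measurable_one.indicator measurableSet_Ioc

theorem chi_le_one (r x : ℝ) : chi r x ≤ 1 := by
  by_cases h : x ∈ Ioc 0 r
  · rw [chi_of_mem h]
  · rw [chi_of_notMem h]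
    exact zero_le

theorem antitoneOn_chi (r : ℝ) : AntitoneOn (chi r) (Ioi 0) := by
  intro a ha b hb hab
  by_cases h : b ∈ Ioc 0 r
  · rw [chi_of_mem h, chi_of_mem ⟨ha, hab.trans h.2⟩]
  · rw [chi_of_notMem h]
    exact zero_le

theorem antitoneOn_coe_chi (r : ℝ) : AntitoneOn (fun x => (chi r x : ℝ≥0∞)) (Ioi 0) :=
  fun _ ha _ hb hab => ENNReal.coe_le_coe.2 (antitoneOn_chi r ha hb hab)

theorem rearr_chi_le (r : ℝ) {t : ℝ} (ht : 0 < t) :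
    rearr (fun x => (chi r x : ℝ≥0∞)) t ≤ chi r t :=
  rearr_le_of_antitoneOn (antitoneOn_coe_chi r)
    (fun x hx => by rw [chi_of_notMem fun h => hx.not_gt h.1]; rfl) ht

theorem one_le_rearr_chi {r t : ℝ} (hr : 0 < r) (htr : t < r) :
    1 ≤ rearr (fun x => (chi r x : ℝ≥0∞)) t := by
  refine le_of_forall_lt fun σ hσ => ?_
  rw [lt_rearr_iff]
  calc ENNReal.ofReal t < ENNReal.ofReal r := (ENNReal.ofReal_lt_ofReal_iff hr).2 htr
    _ = volume (Ioc 0 r) := by simp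
    _ ≤ _ := measure_mono fun x hx => by
        rw [mem_ofPred, chi_of_mem hx]
        exact hσ

section
variable {p : ℝ} {u v : ℝ → ℝ}

theorem weightMeasure_Ioc (v : ℝ → ℝ) (r : ℝ) :
    weightMeasure v (Ioc 0 r) = weightMeasure v (Ioo 0 r) := measure_congr Ioo_ae_eq_Ioc.symm

theorem lintegral_chi_rpow (hp : 0 < p) (v : ℝ → ℝ) (r : ℝ) :
    ∫⁻ t, (chi r t : ℝ≥0∞) ^ p ∂(weightMeasure v) = weightMeasure v (Ioo 0 r) := by
  rw [← weightMeasure_Ioc, ← lintegral_indicator_one measurableSet_Ioc]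
  refine lintegral_congr fun t => ?_
  by_cases h : t ∈ Ioc 0 r
  · rw [chi_of_mem h, indicator_of_mem h]
    simp
  · rw [chi_of_notMem h, indicator_of_notMem h]
    simp [hp]

theorem lorentzNorm_chi (hp : 0 < p) (hv : IsWeight v) {r : ℝ} (hr : 0 < r) :
    lorentzNorm p v (fun x => (chi r x : ℝ≥0∞)) = weightMeasure v (Ioo 0 r) ^ (1 / p) := by
  rw [lorentzNorm_eq hv]
  congr 1
  refine le_antisymm ?_ ?_
  · rw [← lintegral_chi_rpow hp]
    refine lintegral_mono_ae ?_
    filter_upwards [ae_pos_weightMeasure v] with t ht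
    exact ENNReal.rpow_le_rpow (rearr_chi_le r ht) hp.le
  · calc weightMeasure v (Ioo 0 r) = ∫⁻ _ in Ioo 0 r, 1 ∂(weightMeasure v) := by simp
      _ ≤ ∫⁻ t in Ioo 0 r, rearr (fun x => (chi r x : ℝ≥0∞)) t ^ p ∂(weightMeasure v) :=
          setLIntegral_mono' measurableSet_Ioo fun t ht =>
            ENNReal.one_le_rpow (one_le_rearr_chi hr ht.2) hp
      _ ≤ _ := setLIntegral_le_lintegral _ _

theorem le_hardy_rearr_chi {r t : ℝ} (hr : 0 < r) (hrt : r < t) :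
    ENNReal.ofReal r / ENNReal.ofReal t ≤ hardy (rearr fun x => (chi r x : ℝ≥0∞)) t := by
  unfold hardy
  gcongr ?_ / _
  calc ENNReal.ofReal r = ∫⁻ _ in Ioo 0 r, 1 := by simp
    _ ≤ ∫⁻ τ in Ioo 0 r, rearr (fun x => (chi r x : ℝ≥0∞)) τ :=
        setLIntegral_mono' measurableSet_Ioo fun τ hτ => one_le_rearr_chi hr hτ.2
    _ ≤ _ := lintegral_mono_set (Ioo_subset_Ioo le_rfl hrt.le)

theorem hardy_rearr_chi_le_one (r : ℝ) {t : ℝ} :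
    hardy (rearr fun x => (chi r x : ℝ≥0∞)) t ≤ 1 := by
  unfold hardy
  refine ENNReal.div_le_of_le_mul ?_
  calc _ ≤ ∫⁻ _ in Ioo 0 t, 1 := setLIntegral_mono' measurableSet_Ioo fun τ hτ =>
        (rearr_chi_le r hτ.1).trans (by exact_mod_cast chi_le_one r τ)
    _ = _ := by simp

theorem tail_le_lintegral_hardy_chi (hp : 0 < p) (u : ℝ → ℝ) {r : ℝ} (hr : 0 < r) :
    ENNReal.ofReal r ^ p * ∫⁻ x in Ioi r, (ENNReal.ofReal x ^ p)⁻¹ ∂(weightMeasure u)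
      ≤ ∫⁻ t, hardy (rearr fun x => (chi r x : ℝ≥0∞)) t ^ p ∂(weightMeasure u) := by
  rw [← lintegral_const_mul' _ _ (ENNReal.rpow_ne_top_of_nonneg hp.le ENNReal.ofReal_ne_top)]
  refine le_trans (setLIntegral_mono' measurableSet_Ioi fun t ht => ?_)
    (setLIntegral_le_lintegral (Ioi r) _)
  rw [← ENNReal.div_eq_inv_mul.trans (mul_comm _ _), ← ENNReal.div_rpow_of_nonneg _ _ hp.le]
  exact ENNReal.rpow_le_rpow (le_hardy_rearr_chi hr ht) hp.le

theorem le_lintegral_hardy_chi (hp : 0 < p) (v : ℝ → ℝ) {r : ℝ} (hr : 0 < r) :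
    weightMeasure v (Ioo 0 r)
      ≤ ∫⁻ t, hardy (rearr fun x => (chi r x : ℝ≥0∞)) t ^ p ∂(weightMeasure v) := by
  calc weightMeasure v (Ioo 0 r) = ∫⁻ _ in Ioo 0 r, 1 ∂(weightMeasure v) := by simp
    _ ≤ ∫⁻ t in Ioo 0 r, hardy (rearr fun x => (chi r x : ℝ≥0∞)) t ^ p ∂(weightMeasure v) :=
        setLIntegral_mono' measurableSet_Ioo fun t ht =>
          ENNReal.one_le_rpow ((one_le_rearr_chi hr ht.2).trans
            (le_hardy ((rearr_antitone _).antitoneOn _) ht.1)) hp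
    _ ≤ _ := setLIntegral_le_lintegral _ _

theorem lpNorm2_mul (hp : 0 < p) (hu : IsWeight u) (hv : IsWeight v) {a b : ℝ → ℝ≥0∞}
    (ha : AntitoneOn a (Ioi 0)) (hb : AntitoneOn b (Ioi 0)) :
    lpNorm2 p u v (fun s t => a s * b t)
      = ((∫⁻ s, a s ^ p ∂(weightMeasure u)) * ∫⁻ t, b t ^ p ∂(weightMeasure v)) ^ (1 / p) := by
  have hab : AntitoneOnQuadrant fun s t => a s * b t :=
    ⟨fun s _ x hx y hy hxy => mul_le_mul_right (hb hx hy hxy) _,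
      fun t _ x hx y hy hxy => mul_le_mul_left (ha hx hy hxy) _⟩
  rw [lpNorm2_eq hp.le hu hv hab]
  congr 1
  simp_rw [ENNReal.mul_rpow_of_nonneg _ _ hp.le]
  simp_rw [lintegral_const_mul'' _ ((aemeasurable_weightMeasure hb).pow_const p)]
  rw [lintegral_mul_const'' _ ((aemeasurable_weightMeasure ha).pow_const p)]

/-- A bound for the averages of products of indicators forces the condition `B_p` on the first
weight: the factor in the second variable cancels. -/
theorem isBp_of_hardy_chi (hp : 0 < p) (hu : IsWeight u) (hv : IsWeight v)
    (hv0 : weightMeasure v ≠ 0) {C : ℝ≥0}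
    (h : ∀ r R : ℝ, 0 < r → 0 < R →
      (∫⁻ t, hardy (rearr fun x => (chi r x : ℝ≥0∞)) t ^ p ∂(weightMeasure u)) *
        (∫⁻ t, hardy (rearr fun x => (chi R x : ℝ≥0∞)) t ^ p ∂(weightMeasure v))
      ≤ C * (weightMeasure u (Ioo 0 r) * weightMeasure v (Ioo 0 R))) : IsBp p u := by
  obtain ⟨R, hR, hR0⟩ := exists_weightMeasure_Ioo_pos hv0
  refine (isBp_iff hu).2 ⟨C, ?_, fun r hr => hu.measure_Ioo_ne_top hr, fun r hr => ?_⟩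
  · refine weightMeasure_ac u ?_
    rw [Measure.restrict_apply measurableSet_Iic, Iic_inter_Ioi, Ioc_self, measure_empty]
  · refine (tail_le_lintegral_hardy_chi hp u hr).trans ?_
    rw [← ENNReal.mul_le_mul_iff_left hR0 (hv.measure_Ioo_ne_top hR), mul_assoc]
    exact (mul_le_mul_right (le_lintegral_hardy_chi hp v hR) _).trans (h r R hr hR)

theorem isBp_and_isBp_of_lpNorm2_hardy_chi (hp : 0 < p) (hu : IsWeight u) (hv : IsWeight v)
    (hu0 : weightMeasure u ≠ 0) (hv0 : weightMeasure v ≠ 0) {C : ℝ≥0}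
    (h : ∀ r R : ℝ, 0 < r → 0 < R →
      lpNorm2 p u v (fun s t => hardy (rearr fun x => (chi r x : ℝ≥0∞)) s
        * hardy (rearr fun x => (chi R x : ℝ≥0∞)) t)
      ≤ C * (weightMeasure u (Ioo 0 r) * weightMeasure v (Ioo 0 R)) ^ (1 / p)) :
    IsBp p u ∧ IsBp p v := by
  have key : ∀ r R : ℝ, 0 < r → 0 < R →
      (∫⁻ t, hardy (rearr fun x => (chi r x : ℝ≥0∞)) t ^ p ∂(weightMeasure u)) *
        (∫⁻ t, hardy (rearr fun x => (chi R x : ℝ≥0∞)) t ^ p ∂(weightMeasure v))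
      ≤ ((C ^ p : ℝ≥0) : ℝ≥0∞) * (weightMeasure u (Ioo 0 r) * weightMeasure v (Ioo 0 R)) := by
    intro r R hr hR
    have h1 := ENNReal.rpow_le_rpow (h r R hr hR) hp.le
    rwa [lpNorm2_mul hp hu hv (antitoneOn_hardy_rearr _) (antitoneOn_hardy_rearr _),
      ENNReal.mul_rpow_of_nonneg _ _ hp.le, ← ENNReal.rpow_mul, ← ENNReal.rpow_mul,
      one_div_mul_cancel hp.ne', ENNReal.rpow_one, ENNReal.rpow_one,
      ← ENNReal.coe_rpow_of_nonneg _ hp.le] at h1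
  refine ⟨isBp_of_hardy_chi hp hu hv hv0 key, isBp_of_hardy_chi hp hv hu hu0 (C := C ^ p)
    fun r R hr hR => ?_⟩
  rw [mul_comm, mul_comm (weightMeasure v _)]
  exact key R r hR hr

theorem hardy_congr {g h : ℝ → ℝ≥0∞} {t : ℝ} (hgh : ∀ x, 0 < x → x < t → g x = h x) :
    hardy g t = hardy h t :=
  le_antisymm (hardy_mono fun x h0 h1 => (hgh x h0 h1).le)
    (hardy_mono fun x h0 h1 => (hgh x h0 h1).ge)

theorem rearrY_mul {a : ℝ → ℝ≥0} (b : ℝ → ℝ≥0∞) (x : ℝ) :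
    rearrY (fun x y => (a x : ℝ≥0∞) * b y) x = fun t => a x * rearr b t :=
  funext fun t => rearr_const_mul _ ENNReal.coe_ne_top b t

theorem rearr_mul_const (a : ℝ → ℝ≥0∞) {k : ℝ≥0∞} (hk : k ≠ ∞) (s : ℝ) :
    rearr (fun x => a x * k) s = rearr a s * k := by
  simp_rw [mul_comm _ k]
  exact rearr_const_mul k hk a s

theorem rearrYX_mul (a : ℝ → ℝ≥0) {b : ℝ → ℝ≥0∞} {t : ℝ} (hb : rearr b t ≠ ∞) (s : ℝ) :
    rearrYX (fun x y => (a x : ℝ≥0∞) * b y) s t = rearr (fun x => (a x : ℝ≥0∞)) s * rearr b t := by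
  unfold rearrYX
  simp_rw [rearrY_mul]
  exact rearr_mul_const _ hb s

theorem starStarYX_mul (a : ℝ → ℝ≥0) {b : ℝ → ℝ≥0∞} {t : ℝ} (hb : hardy (rearr b) t ≠ ∞) (s : ℝ) :
    starStarYX (fun x y => (a x : ℝ≥0∞) * b y) s t
      = hardy (rearr fun x => (a x : ℝ≥0∞)) s * hardy (rearr b) t := by
  unfold starStarYX
  simp_rw [rearrY_mul, hardy_const_mul _ ENNReal.coe_ne_top, mul_comm _ (hardy (rearr b) t)]
  rw [← hardy_const_mul _ hb]
  exact hardy_congr fun x _ _ => rearr_const_mul _ hb _ _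

theorem hardy2_mul {a b : ℝ → ℝ≥0∞} {s t : ℝ} (hs : 0 < s) (ht : 0 < t)
    (ha : ∀ σ, 0 < σ → a σ ≠ ∞) (hb : hardy b t ≠ ∞) :
    hardy2 (fun x y => a x * b y) s t = hardy a s * hardy b t := by
  rw [hardy2_eq _ hs ht, mul_comm, ← hardy_const_mul _ hb]
  refine hardy_congr fun x hx _ => ?_
  rw [hardy_const_mul _ (ha x hx), mul_comm]

/-! ### Necessity of `B_p` for the boundedness of the averaging operators -/

/-- The indicator function of `(0, r] × (0, R]` as a function on the quadrant. -/
def chi2 (r R s t : ℝ) : ℝ≥0 := chi r s * chi R t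

theorem isDecreasing_chi2 (r R : ℝ) : IsDecreasing (chi2 r R) :=
  ⟨fun _ _ _ ha _ hb hab => mul_le_mul_right (antitoneOn_chi R ha hb hab) _,
    fun _ _ _ ha _ hb hab => mul_le_mul_left (antitoneOn_chi r ha hb hab) _⟩

theorem zeroExt_chi2 (r R : ℝ) :
    zeroExt (chi2 r R) = fun x y => (chi r x : ℝ≥0∞) * (chi R y : ℝ≥0∞) := by
  funext x y
  unfold zeroExt chi2
  split_ifs with h
  · exact ENNReal.coe_mul _ _
  · rw [not_and_or] at h
    rcases h with h | h
    · rw [chi_of_notMem fun h' => h h'.1]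
      simp
    · rw [chi_of_notMem (r := R) fun h' => h h'.1]
      simp

theorem lpNorm2_zeroExt_chi2 (hp : 0 < p) (hu : IsWeight u) (hv : IsWeight v) (r R : ℝ) :
    lpNorm2 p u v (zeroExt (chi2 r R))
      = (weightMeasure u (Ioo 0 r) * weightMeasure v (Ioo 0 R)) ^ (1 / p) := by
  rw [zeroExt_chi2, lpNorm2_mul hp hu hv (antitoneOn_coe_chi r) (antitoneOn_coe_chi R),
    lintegral_chi_rpow hp, lintegral_chi_rpow hp]

/-- An operator that dominates the product of averages on products of indicators can only be
bounded for weights in `B_p`. -/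
theorem isBp_of_boundedOnDec (hp : 0 < p) (hu : IsWeight u) (hv : IsWeight v)
    (hu0 : weightMeasure u ≠ 0) (hv0 : weightMeasure v ≠ 0) {T : (ℝ → ℝ → ℝ≥0∞) → ℝ → ℝ → ℝ≥0∞}
    (hT : ∀ r R s t : ℝ, 0 < s → 0 < t →
      hardy (rearr fun x => (chi r x : ℝ≥0∞)) s * hardy (rearr fun x => (chi R x : ℝ≥0∞)) t
        ≤ T (zeroExt (chi2 r R)) s t)
    (h : BoundedOnDec p u v T) : IsBp p u ∧ IsBp p v := by
  obtain ⟨C, hC⟩ := h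
  refine isBp_and_isBp_of_lpNorm2_hardy_chi hp hu hv hu0 hv0 (C := C) fun r R hr hR => ?_
  have h1 := hC (chi2 r R) (isDecreasing_chi2 r R)
  rw [lpNorm2_zeroExt_chi2 hp hu hv] at h1
  refine (lpNorm2_mono hp.le fun s t hs ht => hT r R s t hs ht).trans (h1 ?_)
  exact ENNReal.rpow_lt_top_of_nonneg (by positivity)
    (ENNReal.mul_ne_top (hu.measure_Ioo_ne_top hr) (hv.measure_Ioo_ne_top hR))

theorem hardy_chi_le_one (r : ℝ) {t : ℝ} : hardy (fun x => (chi r x : ℝ≥0∞)) t ≤ 1 := by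
  unfold hardy
  refine ENNReal.div_le_of_le_mul ?_
  calc _ ≤ ∫⁻ _ in Ioo 0 t, 1 := lintegral_mono fun τ => ENNReal.coe_le_one_iff.2 (chi_le_one r τ)
    _ = _ := by simp

theorem isBp_of_boundedOnDec_hardy2 (hp : 0 < p) (hu : IsWeight u) (hv : IsWeight v)
    (hu0 : weightMeasure u ≠ 0) (hv0 : weightMeasure v ≠ 0) (h : BoundedOnDec p u v hardy2) :
    IsBp p u ∧ IsBp p v := by
  refine isBp_of_boundedOnDec hp hu hv hu0 hv0 (fun r R s t hs ht => ?_) h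
  rw [zeroExt_chi2, hardy2_mul hs ht (fun _ _ => ENNReal.coe_ne_top)
    (ne_top_of_le_ne_top ENNReal.one_ne_top (hardy_chi_le_one R))]
  exact mul_le_mul' (hardy_mono fun x hx _ => rearr_chi_le r hx)
    (hardy_mono fun x hx _ => rearr_chi_le R hx)

theorem isBp_of_boundedOnDec_starStarYX (hp : 0 < p) (hu : IsWeight u) (hv : IsWeight v)
    (hu0 : weightMeasure u ≠ 0) (hv0 : weightMeasure v ≠ 0) (h : BoundedOnDec p u v starStarYX) :
    IsBp p u ∧ IsBp p v := by
  refine isBp_of_boundedOnDec hp hu hv hu0 hv0 (fun r R s t hs ht => ?_) h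
  rw [zeroExt_chi2, starStarYX_mul _
    (ne_top_of_le_ne_top ENNReal.one_ne_top (hardy_rearr_chi_le_one R))]

/-- The class of the function `(x, y) ↦ a(x) b(y)`. -/
def tensor (a b : ℝ → ℝ≥0) (ha : Measurable a) (hb : Measurable b) : L0 :=
  AEEqFun.mk (fun z : ℝ × ℝ => ((a z.1 * b z.2 : ℝ≥0) : ℝ))
    ((ha.comp measurable_fst).mul (hb.comp measurable_snd)).coe_nnreal_real.aestronglyMeasurable

theorem absVal_tensor {a b : ℝ → ℝ≥0} (ha : Measurable a) (hb : Measurable b) :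
    ∀ᵐ x : ℝ, absVal (tensor a b ha hb) x =ᵐ[volume] fun y => (a x : ℝ≥0∞) * (b y : ℝ≥0∞) := by
  refine ae_ae_of_ae_volume
    (P := fun z => ‖(tensor a b ha hb) z‖ₑ = (a z.1 : ℝ≥0∞) * (b z.2 : ℝ≥0∞)) ?_
  filter_upwards [AEEqFun.coeFn_mk (μ := (volume : Measure (ℝ × ℝ)))
    (fun z : ℝ × ℝ => ((a z.1 * b z.2 : ℝ≥0) : ℝ))
    ((ha.comp measurable_fst).mul (hb.comp measurable_snd)).coe_nnreal_real.aestronglyMeasurable]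
    with z hz
  unfold tensor
  rw [hz, Real.enorm_eq_ofReal (NNReal.coe_nonneg _), ENNReal.ofReal_coe_nnreal, ENNReal.coe_mul]

theorem rearr_le_of_le {g : ℝ → ℝ≥0∞} {M : ℝ≥0∞} (h : ∀ x, g x ≤ M) (t : ℝ) : rearr g t ≤ M := by
  rw [rearr_le_iff]
  simp [not_lt.2 (h _)]

theorem rearrYX_tensor {a b : ℝ → ℝ≥0} (ha : Measurable a) (hb : Measurable b) {M : ℝ≥0}
    (hM : ∀ y, b y ≤ M) : rearrYX (absVal (tensor a b ha hb))
      = fun s t => rearr (fun x => (a x : ℝ≥0∞)) s * rearr (fun y => (b y : ℝ≥0∞)) t := by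
  rw [rearrYX_congr (g := fun x y => (a x : ℝ≥0∞) * (b y : ℝ≥0∞)) (absVal_tensor ha hb)]
  funext s t
  exact rearrYX_mul a (ne_top_of_le_ne_top ENNReal.coe_ne_top
    (rearr_le_of_le (fun y => ENNReal.coe_le_coe.2 (hM y)) t)) s

theorem norm2_tensor (hp : 0 < p) (hu : IsWeight u) (hv : IsWeight v) {a b : ℝ → ℝ≥0}
    (ha : Measurable a) (hb : Measurable b) {M : ℝ≥0} (hM : ∀ y, b y ≤ M) :
    norm2 p u v (tensor a b ha hb)
      = lorentzNorm p u (fun x => (a x : ℝ≥0∞)) * lorentzNorm p v (fun y => (b y : ℝ≥0∞)) := by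
  rw [norm2, rearrYX_tensor ha hb hM, lpNorm2_mul hp hu hv ((rearr_antitone _).antitoneOn _)
    ((rearr_antitone _).antitoneOn _), ENNReal.mul_rpow_of_nonneg _ _ (by positivity),
    lorentzNorm_eq hu, lorentzNorm_eq hv]

theorem lorentzNorm_const_mul (hp : 0 < p) (c : ℝ≥0∞) (hc : c ≠ ∞) (g : ℝ → ℝ≥0∞) :
    lorentzNorm p v (fun x => c * g x) = c * lorentzNorm p v g := by
  have hcp : c ^ p ≠ ∞ := ENNReal.rpow_ne_top_of_nonneg hp.le hc
  unfold lorentzNorm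
  simp_rw [rearr_const_mul c hc, ENNReal.mul_rpow_of_nonneg _ _ hp.le, mul_assoc]
  rw [lintegral_const_mul' _ _ hcp,
    ENNReal.mul_rpow_of_nonneg _ _ (by positivity), ← ENNReal.rpow_mul,
    mul_one_div_cancel hp.ne', ENNReal.rpow_one]

theorem mixedNorm_tensor (hp : 0 < p) {a b : ℝ → ℝ≥0} (ha : Measurable a) (hb : Measurable b)
    (hfin : lorentzNorm p v (fun y => (b y : ℝ≥0∞)) ≠ ∞) :
    mixedNorm p p u v (tensor a b ha hb)
      = lorentzNorm p u (fun x => (a x : ℝ≥0∞)) * lorentzNorm p v (fun y => (b y : ℝ≥0∞)) := by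
  have h1 : (fun x => lorentzNorm p v (absVal (tensor a b ha hb) x))
      =ᵐ[volume] fun x => lorentzNorm p v (fun y => (b y : ℝ≥0∞)) * a x := by
    filter_upwards [absVal_tensor ha hb] with x hx
    rw [mul_comm, ← lorentzNorm_const_mul hp _ ENNReal.coe_ne_top]
    unfold lorentzNorm
    rw [rearr_congr_ae hx]
  rw [mul_comm, ← lorentzNorm_const_mul hp _ hfin]
  unfold mixedNorm
  conv_lhs => rw [lorentzNorm, rearr_congr_ae h1]
  rfl

theorem isBp_of_isEquivalent_norm2Two (hp : 0 < p) (hu : IsWeight u) (hv : IsWeight v)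
    (hu0 : weightMeasure u ≠ 0) (hv0 : weightMeasure v ≠ 0)
    (h : IsEquivalent (norm2 p u v) (norm2Two p u v)) : IsBp p u ∧ IsBp p v := by
  obtain ⟨A, B, -, -, hB⟩ := h
  refine isBp_and_isBp_of_lpNorm2_hardy_chi hp hu hv hu0 hv0 (C := B) fun r R hr hR => ?_
  have hn : norm2 p u v (tensor _ _ (measurable_chi r) (measurable_chi R))
      = (weightMeasure u (Ioo 0 r) * weightMeasure v (Ioo 0 R)) ^ (1 / p) := by
    rw [norm2_tensor hp hu hv _ _ (chi_le_one R), lorentzNorm_chi hp hu hr,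
      lorentzNorm_chi hp hv hR, ENNReal.mul_rpow_of_nonneg _ _ (by positivity)]
  have h1 := (hB (tensor _ _ (measurable_chi r) (measurable_chi R)) ?_).2
  · rw [hn] at h1
    refine le_trans (lpNorm2_mono hp.le fun s t hs ht => ?_) h1
    rw [starStar, rearrYX_tensor _ _ (chi_le_one R), hardy2_mul hs ht]
    · exact fun σ hσ => ne_top_of_le_ne_top ENNReal.coe_ne_top (rearr_chi_le r hσ)
    · exact ne_top_of_le_ne_top ENNReal.one_ne_top (hardy_rearr_chi_le_one R)
  · rw [hn]
    exact ENNReal.rpow_lt_top_of_nonneg (by positivity)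
      (ENNReal.mul_ne_top (hu.measure_Ioo_ne_top hr) (hv.measure_Ioo_ne_top hR))

end

/-! ### Necessity of `B_p` for normability -/

/-- Non-negative, bounded measurable functions supported in an interval `(0, N]`. -/
structure IsTest (g : ℝ → ℝ≥0) : Prop where
  measurable : Measurable g
  bound : ∃ (M : ℝ≥0) (N : ℝ), 0 < N ∧ ∀ x, g x ≤ M * chi N x

theorem chi_mono {r R : ℝ} (h : r ≤ R) (x : ℝ) : chi r x ≤ chi R x := by
  by_cases hx : x ∈ Ioc 0 r
  · rw [chi_of_mem hx, chi_of_mem ⟨hx.1, hx.2.trans h⟩]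
  · rw [chi_of_notMem hx]
    exact zero_le

theorem isTest_chi {r : ℝ} (hr : 0 < r) : IsTest (chi r) :=
  ⟨measurable_chi r, 1, r, hr, fun x => by rw [one_mul]⟩

theorem isTest_zero : IsTest fun _ => 0 := ⟨measurable_const, 0, 1, one_pos, fun _ => zero_le⟩

theorem IsTest.add {g h : ℝ → ℝ≥0} (hg : IsTest g) (hh : IsTest h) :
    IsTest fun x => g x + h x := by
  obtain ⟨M, N, hN, hM⟩ := hg.bound
  obtain ⟨M', N', -, hM'⟩ := hh.bound
  refine ⟨hg.measurable.add hh.measurable, M + M', max N N', lt_max_of_lt_left hN, fun x => ?_⟩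
  rw [add_mul]
  exact add_le_add ((hM x).trans (mul_le_mul_right (chi_mono (le_max_left _ _) x) _))
    ((hM' x).trans (mul_le_mul_right (chi_mono (le_max_right _ _) x) _))

theorem IsTest.sum {ι : Type*} (s : Finset ι) {g : ι → ℝ → ℝ≥0} (hg : ∀ i, IsTest (g i)) :
    IsTest fun x => ∑ i ∈ s, g i x := by
  classical
  induction s using Finset.induction_on with
  | empty => simpa using isTest_zero
  | insert i s hi ih =>
    simp_rw [Finset.sum_insert hi]
    exact (hg i).add ih

theorem IsTest.bounded {g : ℝ → ℝ≥0} (hg : IsTest g) : ∃ M : ℝ≥0, ∀ x, g x ≤ M := by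
  obtain ⟨M, N, -, hM⟩ := hg.bound
  exact ⟨M, fun x => (hM x).trans (mul_le_of_le_one_right zero_le (chi_le_one N x))⟩

theorem tensor_eq_zero {a b : ℝ → ℝ≥0} {ha : Measurable a} {hb : Measurable b}
    (h : ∀ x y, a x * b y = 0) : tensor a b ha hb = 0 := by
  unfold tensor
  rw [AEEqFun.zero_def, AEEqFun.mk_eq_mk]
  exact Filter.Eventually.of_forall fun z => by simp only [h z.1 z.2, NNReal.coe_zero]

theorem tensor_add_tensor {a a' b b' c d : ℝ → ℝ≥0} {ha : Measurable a} {hb : Measurable b}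
    {ha' : Measurable a'} {hb' : Measurable b'} {hc : Measurable c} {hd : Measurable d}
    (h : ∀ x y, a x * b y + a' x * b' y = c x * d y) :
    tensor a b ha hb + tensor a' b' ha' hb' = tensor c d hc hd := by
  unfold tensor
  rw [AEEqFun.mk_add_mk, AEEqFun.mk_eq_mk]
  refine Filter.Eventually.of_forall fun z => ?_
  simp only [Pi.add_apply]
  rw [← NNReal.coe_add, h]

theorem sum_tensor_left {ι : Type*} (s : Finset ι) {g : ι → ℝ → ℝ≥0} (hg : ∀ i, Measurable (g i))
    {b : ℝ → ℝ≥0} (hb : Measurable b) (hs : Measurable fun x => ∑ i ∈ s, g i x) :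
    ∑ i ∈ s, tensor (g i) b (hg i) hb = tensor (fun x => ∑ i ∈ s, g i x) b hs hb := by
  classical
  induction s using Finset.induction_on with
  | empty => exact (tensor_eq_zero fun x y => by simp).symm
  | insert i s hi ih =>
    rw [Finset.sum_insert hi, ih (Finset.measurable_fun_sum s fun i _ => hg i)]
    exact tensor_add_tensor fun x y => by rw [Finset.sum_insert hi, add_mul]

theorem sum_tensor_right {ι : Type*} (s : Finset ι) {g : ι → ℝ → ℝ≥0} (hg : ∀ i, Measurable (g i))
    {b : ℝ → ℝ≥0} (hb : Measurable b) (hs : Measurable fun x => ∑ i ∈ s, g i x) :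
    ∑ i ∈ s, tensor b (g i) hb (hg i) = tensor b (fun x => ∑ i ∈ s, g i x) hb hs := by
  classical
  induction s using Finset.induction_on with
  | empty => exact (tensor_eq_zero fun x y => by simp).symm
  | insert i s hi ih =>
    rw [Finset.sum_insert hi, ih (Finset.measurable_fun_sum s fun i _ => hg i)]
    exact tensor_add_tensor fun x y => by rw [Finset.sum_insert hi, mul_add]

theorem IsNormable.exists_sum_le {ρ : L0 → ℝ≥0∞} (h : IsNormable ρ) :
    ∃ K : ℝ≥0, ∀ (m : ℕ) (f : Fin m → L0), (∀ i, ρ (f i) < ∞) →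
      ρ (∑ i, f i) ≤ K * ∑ i, ρ (f i) := by
  obtain ⟨N, hN⟩ := h
  obtain ⟨A, B, hA, -, hAB⟩ := hN.equiv
  refine ⟨A⁻¹ * B, fun m f hf => ?_⟩
  have h1 : ∀ s : Finset (Fin m), ρ (∑ i ∈ s, f i) < ∞ ∧ N (∑ i ∈ s, f i) ≤ ∑ i ∈ s, N (f i) := by
    intro s
    induction s using Finset.induction_on with
    | empty =>
      simp only [Finset.sum_empty]
      exact ⟨hN.zero_mem, ((hN.eq_zero_iff 0 hN.zero_mem).2 rfl).le⟩
    | insert i s hi ih =>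
      rw [Finset.sum_insert hi, Finset.sum_insert hi]
      exact ⟨hN.add_mem _ _ (hf i) ih.1, (hN.add_le _ _ (hf i) ih.1).trans
        (add_le_add le_rfl ih.2)⟩
  obtain ⟨h2, h3⟩ := h1 Finset.univ
  have hA0 : (A : ℝ≥0∞) ≠ 0 := by simpa using hA.ne'
  rw [ENNReal.coe_mul, ENNReal.coe_inv hA.ne', mul_assoc, ← ENNReal.div_eq_inv_mul,
    ENNReal.le_div_iff_mul_le (Or.inl hA0) (Or.inl ENNReal.coe_ne_top), mul_comm]
  calc (A : ℝ≥0∞) * ρ (∑ i, f i) ≤ N (∑ i, f i) := (hAB _ h2).1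
    _ ≤ ∑ i, N (f i) := h3
    _ ≤ ∑ i, B * ρ (f i) := Finset.sum_le_sum fun i _ => (hAB _ (hf i)).2
    _ = _ := by rw [Finset.mul_sum]

/-- The functional of `Λ^p(u)` is subadditive up to a constant, on finite families of test
functions of any size. -/
def IsSumBounded (p : ℝ) (u : ℝ → ℝ) : Prop :=
  ∃ K : ℝ≥0, ∀ (m : ℕ) (g : Fin m → ℝ → ℝ≥0), (∀ i, IsTest (g i)) →
    lorentzNorm p u (fun x => ((∑ i, g i x : ℝ≥0) : ℝ≥0∞))
      ≤ K * ∑ i, lorentzNorm p u fun x => (g i x : ℝ≥0∞)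

section
variable {p : ℝ} {u v : ℝ → ℝ}

theorem IsTest.lorentzNorm_ne_top (hp : 0 < p) (hu : IsWeight u) {g : ℝ → ℝ≥0} (hg : IsTest g) :
    lorentzNorm p u (fun x => (g x : ℝ≥0∞)) ≠ ∞ := by
  obtain ⟨M, N, hN, hM⟩ := hg.bound
  refine ne_top_of_le_ne_top ?_ (lorentzNorm_mono (h := fun x => (M : ℝ≥0∞) * (chi N x : ℝ≥0∞)) hp
    fun x => by rw [← ENNReal.coe_mul]; exact ENNReal.coe_le_coe.2 (hM x))
  rw [lorentzNorm_const_mul hp _ ENNReal.coe_ne_top, lorentzNorm_chi hp hu hN]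
  exact ENNReal.mul_ne_top ENNReal.coe_ne_top
    (ENNReal.rpow_ne_top_of_nonneg (by positivity) (hu.measure_Ioo_ne_top hN))

/-- Normability of a space whose functional is multiplicative on products of test functions passes
to the two one-dimensional Lorentz spaces. -/
theorem isSumBounded_of_isNormable (hp : 0 < p) (hu : IsWeight u) (hv : IsWeight v)
    (hu0 : weightMeasure u ≠ 0) (hv0 : weightMeasure v ≠ 0) {ρ : L0 → ℝ≥0∞}
    (hρ : ∀ (a b : ℝ → ℝ≥0) (ha : IsTest a) (hb : IsTest b),
      ρ (tensor a b ha.measurable hb.measurable)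
        = lorentzNorm p u (fun x => (a x : ℝ≥0∞)) * lorentzNorm p v (fun y => (b y : ℝ≥0∞)))
    (h : IsNormable ρ) : IsSumBounded p u ∧ IsSumBounded p v := by
  obtain ⟨K, hK⟩ := h.exists_sum_le
  have hchi : ∀ {w : ℝ → ℝ}, IsWeight w → weightMeasure w ≠ 0 → ∃ R : ℝ, 0 < R ∧
      lorentzNorm p w (fun x => (chi R x : ℝ≥0∞)) ≠ 0 := by
    intro w hw hw0
    obtain ⟨R, hR, hR0⟩ := exists_weightMeasure_Ioo_pos hw0
    refine ⟨R, hR, ?_⟩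
    rw [lorentzNorm_chi hp hw hR, ne_eq, ENNReal.rpow_eq_zero_iff_of_pos (by positivity)]
    exact hR0
  have hlt : ∀ a b (ha : IsTest a) (hb : IsTest b),
      ρ (tensor a b ha.measurable hb.measurable) < ∞ := fun a b ha hb => by
    rw [hρ a b ha hb]
    exact ENNReal.mul_lt_top (ha.lorentzNorm_ne_top hp hu).lt_top
      (hb.lorentzNorm_ne_top hp hv).lt_top
  constructor
  · obtain ⟨R, hR, hR0⟩ := hchi hv hv0
    have hb := isTest_chi hR
    refine ⟨K, fun m g hg => ?_⟩
    have h1 := hK m (fun i => tensor (g i) _ (hg i).measurable hb.measurable)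
      fun i => hlt _ _ (hg i) hb
    rw [sum_tensor_left _ (fun i => (hg i).measurable) _
      (IsTest.sum Finset.univ hg).measurable, hρ _ _ (IsTest.sum Finset.univ hg) hb] at h1
    simp_rw [hρ _ _ (hg _) hb] at h1
    rw [← Finset.sum_mul, ← mul_assoc,
      ENNReal.mul_le_mul_iff_left hR0 (hb.lorentzNorm_ne_top hp hv)] at h1
    exact h1
  · obtain ⟨R, hR, hR0⟩ := hchi hu hu0
    have hb := isTest_chi hR
    refine ⟨K, fun m g hg => ?_⟩
    have h1 := hK m (fun i => tensor _ (g i) hb.measurable (hg i).measurable)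
      fun i => hlt _ _ hb (hg i)
    rw [sum_tensor_right _ (fun i => (hg i).measurable) _
      (IsTest.sum Finset.univ hg).measurable, hρ _ _ hb (IsTest.sum Finset.univ hg)] at h1
    simp_rw [hρ _ _ hb (hg _)] at h1
    rw [← Finset.mul_sum, mul_left_comm,
      ENNReal.mul_le_mul_iff_right hR0 (hb.lorentzNorm_ne_top hp hu)] at h1
    exact h1

/-- The step function with the value `c j` on `(j r, (j + 1) r]`. -/
def step {m : ℕ} (r : ℝ) (c : Fin m → ℝ≥0) (x : ℝ) : ℝ≥0 :=
  ∑ j : Fin m, (Ioc ((j : ℝ) * r) (((j : ℝ) + 1) * r)).indicator (fun _ => c j) x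

theorem step_disjoint {r : ℝ} (hr : 0 < r) {i j : ℕ} (hij : i ≠ j) :
    Disjoint (Ioc ((i : ℝ) * r) (((i : ℝ) + 1) * r)) (Ioc ((j : ℝ) * r) (((j : ℝ) + 1) * r)) := by
  rw [Set.disjoint_left]
  rintro x ⟨h1, h2⟩ ⟨h3, h4⟩
  refine hij ?_
  have h5 : (i : ℝ) < j + 1 := lt_of_mul_lt_mul_right (h1.trans_le h4) hr.le
  have h6 : (j : ℝ) < i + 1 := lt_of_mul_lt_mul_right (h3.trans_le h2) hr.le
  have h7 : i < j + 1 := by exact_mod_cast h5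
  have h8 : j < i + 1 := by exact_mod_cast h6
  omega

theorem step_eq {m : ℕ} {r : ℝ} (hr : 0 < r) (c : Fin m → ℝ≥0) (j : Fin m) {x : ℝ}
    (hx : x ∈ Ioc ((j : ℝ) * r) (((j : ℝ) + 1) * r)) : step r c x = c j := by
  unfold step
  rw [Finset.sum_eq_single j]
  · exact indicator_of_mem hx _
  · intro i _ hij
    refine indicator_of_notMem (fun hi => ?_) _
    exact Set.disjoint_left.1 (step_disjoint hr fun h => hij (Fin.ext h)) hi hx
  · intro h
    exact absurd (Finset.mem_univ j) h

theorem step_eq_zero {m : ℕ} {r : ℝ} (c : Fin m → ℝ≥0) {x : ℝ}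
    (hx : ∀ j : Fin m, x ∉ Ioc ((j : ℝ) * r) (((j : ℝ) + 1) * r)) : step r c x = 0 :=
  Finset.sum_eq_zero fun j _ => indicator_of_notMem (hx j) _

theorem exists_mem_of_mem_Ioc {m : ℕ} {r : ℝ} (hr : 0 < r) {x : ℝ} (hx : x ∈ Ioc 0 ((m : ℝ) * r)) :
    ∃ j : Fin m, x ∈ Ioc ((j : ℝ) * r) (((j : ℝ) + 1) * r) := by
  have h0 : 0 < x / r := div_pos hx.1 hr
  have hc : 0 < ⌈x / r⌉₊ := Nat.ceil_pos.2 h0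
  have hm : ⌈x / r⌉₊ ≤ m := Nat.ceil_le.2 ((div_le_iff₀ hr).2 hx.2)
  refine ⟨⟨⌈x / r⌉₊ - 1, by omega⟩, ?_, ?_⟩
  · rw [← lt_div_iff₀ hr]
    exact Nat.lt_ceil.1 (by simp only; omega)
  · rw [← div_le_iff₀ hr]
    have : ((⌈x / r⌉₊ - 1 : ℕ) : ℝ) + 1 = (⌈x / r⌉₊ : ℝ) := by
      rw [← Nat.cast_succ]
      congr 1
      omega
    simp only [this]
    exact Nat.le_ceil _

theorem isTest_step {m : ℕ} {r : ℝ} (hr : 0 < r) (c : Fin m → ℝ≥0) : IsTest (step r c) := by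
  refine IsTest.sum Finset.univ fun j => ⟨measurable_const.indicator measurableSet_Ioc, c j,
    ((j : ℝ) + 1) * r, by positivity, fun x => ?_⟩
  by_cases hx : x ∈ Ioc ((j : ℝ) * r) (((j : ℝ) + 1) * r)
  · have h0 : (0 : ℝ) ≤ (j : ℝ) * r := by positivity
    rw [indicator_of_mem hx, chi_of_mem ⟨h0.trans_lt hx.1, hx.2⟩, mul_one]
  · rw [indicator_of_notMem hx]
    exact zero_le

theorem volume_lt_step {m : ℕ} {r : ℝ} (hr : 0 < r) (c : Fin m → ℝ≥0) (σ : ℝ≥0∞) :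
    volume {x : ℝ | σ < (step r c x : ℝ≥0∞)}
      = ∑ j : Fin m, if σ < (c j : ℝ≥0∞) then ENNReal.ofReal r else 0 := by
  have h1 : {x : ℝ | σ < (step r c x : ℝ≥0∞)}
      = ⋃ j ∈ Finset.univ.filter fun j : Fin m => σ < (c j : ℝ≥0∞),
        Ioc ((j : ℝ) * r) (((j : ℝ) + 1) * r) := by
    ext x
    simp only [mem_ofPred, mem_iUnion, Finset.mem_filter, Finset.mem_univ, true_and, exists_prop]
    constructor
    · intro hx
      by_contra hcon
      push Not at hcon
      by_cases hex : ∃ j : Fin m, x ∈ Ioc ((j : ℝ) * r) (((j : ℝ) + 1) * r)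
      · obtain ⟨j, hj⟩ := hex
        rw [step_eq hr c j hj] at hx
        exact hcon j hx hj
      · push Not at hex
        rw [step_eq_zero c hex] at hx
        exact not_lt_zero hx
    · rintro ⟨j, hj, hx⟩
      rwa [step_eq hr c j hx]
  rw [h1, measure_biUnion_finset, Finset.sum_filter]
  · refine Finset.sum_congr rfl fun j _ => ?_
    rw [Real.volume_Ioc]
    ring_nf
  · intro i _ j _ hij
    exact step_disjoint hr fun h => hij (Fin.ext h)
  · exact fun _ _ => measurableSet_Ioc

/-- The rearrangement of a step function does not depend on the order of its values. -/
theorem lorentzNorm_step_comp {m : ℕ} {r : ℝ} (hr : 0 < r) (c : Fin m → ℝ≥0)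
    (e : Fin m ≃ Fin m) :
    lorentzNorm p u (fun x => (step r (fun j => c (e j)) x : ℝ≥0∞))
      = lorentzNorm p u fun x => (step r c x : ℝ≥0∞) := by
  unfold lorentzNorm
  rw [rearr_congr_of_meas fun σ => ?_]
  rw [volume_lt_step hr, volume_lt_step hr]
  exact Equiv.sum_comp e fun j => if σ < (c j : ℝ≥0∞) then ENNReal.ofReal r else 0

theorem mul_chi_le_sum_step {m : ℕ} [NeZero m] {r : ℝ} (hr : 0 < r) (c : Fin m → ℝ≥0) (x : ℝ) :
    (∑ j, c j) * chi ((m : ℝ) * r) x ≤ ∑ i : Fin m, step r (fun j => c (Equiv.addRight j i)) x := by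
  by_cases hx : x ∈ Ioc 0 ((m : ℝ) * r)
  · obtain ⟨j, hj⟩ := exists_mem_of_mem_Ioc hr hx
    rw [chi_of_mem hx, mul_one]
    simp_rw [step_eq hr _ j hj]
    exact (Equiv.sum_comp (Equiv.addRight j) c).ge
  · rw [chi_of_notMem hx, mul_zero]
    exact zero_le

/-- Averaging a step function over the cyclic shifts of its values. -/
theorem IsSumBounded.exists_step_le (hp : 0 < p) (hu : IsWeight u) (h : IsSumBounded p u) :
    ∃ K : ℝ≥0, ∀ (m : ℕ) [NeZero m] (r : ℝ), 0 < r → ∀ c : Fin m → ℝ≥0,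
      ((∑ j, c j : ℝ≥0) : ℝ≥0∞) * weightMeasure u (Ioo 0 ((m : ℝ) * r)) ^ (1 / p)
        ≤ K * (m * lorentzNorm p u fun x => (step r c x : ℝ≥0∞)) := by
  obtain ⟨K, hK⟩ := h
  refine ⟨K, fun m _ r hr c => ?_⟩
  have hm : (0 : ℝ) < m := by exact_mod_cast NeZero.pos m
  have h1 := hK m (fun i => step r fun j => c (Equiv.addLeft i j)) fun i => isTest_step hr _
  simp_rw [lorentzNorm_step_comp hr] at h1
  rw [Finset.sum_const, Finset.card_univ, Fintype.card_fin, nsmul_eq_mul] at h1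
  refine le_trans ?_ h1
  rw [← lorentzNorm_chi hp hu (by positivity), ← lorentzNorm_const_mul hp _ ENNReal.coe_ne_top]
  refine lorentzNorm_mono hp fun x => ?_
  rw [← ENNReal.coe_mul]
  exact ENNReal.coe_le_coe.2 (mul_chi_le_sum_step hr c x)

/-- The `Λ^p(u)` functional of a function with a decreasing majorant. -/
theorem lorentzNorm_le_of_le (hp : 0 < p) (hu : IsWeight u) {g φ : ℝ → ℝ≥0∞}
    (hφ : AntitoneOn φ (Ioi 0)) (h0 : ∀ x ≤ 0, φ x = 0) (hg : ∀ x, g x ^ p ≤ φ x) :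
    lorentzNorm p u g ≤ (∫⁻ t, φ t ∂(weightMeasure u)) ^ (1 / p) := by
  have hg' : ∀ x, g x ≤ φ x ^ (1 / p) := fun x => by
    have := ENNReal.rpow_le_rpow (hg x) (show 0 ≤ 1 / p by positivity)
    rwa [← ENNReal.rpow_mul, mul_one_div_cancel hp.ne', ENNReal.rpow_one] at this
  rw [lorentzNorm_eq hu]
  refine ENNReal.rpow_le_rpow (lintegral_mono_ae ?_) (by positivity)
  filter_upwards [ae_pos_weightMeasure u] with t ht
  have h1 : rearr g t ≤ φ t ^ (1 / p) := by
    refine (rearr_mono hg' t).trans (rearr_le_of_antitoneOn (g := fun x => φ x ^ (1 / p)) ?_ ?_ ht)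
    · exact fun a ha b hb hab => ENNReal.rpow_le_rpow (hφ ha hb hab) (by positivity)
    · intro x hx
      simp only [h0 x hx]
      exact ENNReal.zero_rpow_of_pos (by positivity)
  have h2 := ENNReal.rpow_le_rpow h1 hp.le
  rwa [← ENNReal.rpow_mul, one_div_mul_cancel hp.ne', ENNReal.rpow_one] at h2

end

section
variable {p : ℝ} {u v : ℝ → ℝ}

theorem rpow_one_div_mul_le (hp : 0 < p) {a b c d : ℝ≥0∞}
    (h : a * b ^ (1 / p) ≤ c * d ^ (1 / p)) : a ^ p * b ≤ c ^ p * d := by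
  have h1 := ENNReal.rpow_le_rpow h hp.le
  rwa [ENNReal.mul_rpow_of_nonneg _ _ hp.le, ENNReal.mul_rpow_of_nonneg _ _ hp.le,
    ← ENNReal.rpow_mul, ← ENNReal.rpow_mul, one_div_mul_cancel hp.ne', ENNReal.rpow_one,
    ENNReal.rpow_one] at h1

theorem lorentzNorm_step_single_le (hp : 0 < p) (hu : IsWeight u) {m : ℕ} [NeZero m] {r : ℝ}
    (hr : 0 < r) : lorentzNorm p u (fun x => (step r (Pi.single (0 : Fin m) 1) x : ℝ≥0∞))
      ≤ weightMeasure u (Ioo 0 r) ^ (1 / p) := by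
  rw [← lorentzNorm_chi hp hu hr]
  refine lorentzNorm_mono hp fun x => ENNReal.coe_le_coe.2 ?_
  by_cases hx : ∃ j : Fin m, x ∈ Ioc ((j : ℝ) * r) (((j : ℝ) + 1) * r)
  · obtain ⟨j, hj⟩ := hx
    rw [step_eq hr _ j hj]
    rcases eq_or_ne j 0 with rfl | hj0
    · rw [Pi.single_eq_same, chi_of_mem]
      simpa using hj
    · rw [Pi.single_eq_of_ne hj0]
      exact zero_le
  · push Not at hx
    rw [step_eq_zero _ hx]
    exact zero_le

theorem lorentzNorm_step_harmonic_le (hp : 0 < p) (hu : IsWeight u) (n : ℕ) {r : ℝ} (hr : 0 < r) :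
    lorentzNorm p u (fun x => (step r (fun j : Fin (2 ^ n) => ((j : ℝ≥0) + 1)⁻¹) x : ℝ≥0∞))
      ≤ (∑ k ∈ Finset.range (n + 1), ((2 ^ k : ℝ≥0∞)⁻¹) ^ p
          * weightMeasure u (Ioo 0 (2 ^ (k + 1) * r))) ^ (1 / p) := by
  set φ : ℝ → ℝ≥0∞ := fun x => ∑ k ∈ Finset.range (n + 1), ((2 ^ k : ℝ≥0∞)⁻¹) ^ p
    * (chi (2 ^ (k + 1) * r) x : ℝ≥0∞) ^ p with hφ
  have h1 : ∫⁻ t, φ t ∂(weightMeasure u) = ∑ k ∈ Finset.range (n + 1), ((2 ^ k : ℝ≥0∞)⁻¹) ^ p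
      * weightMeasure u (Ioo 0 (2 ^ (k + 1) * r)) := by
    have hm : ∀ R : ℝ, Measurable fun x => (chi R x : ℝ≥0∞) ^ p := fun R =>
      (measurable_chi R).coe_nnreal_ennreal.pow_const p
    simp only [hφ]
    rw [lintegral_finsetSum _ fun k _ => (hm _).const_mul _]
    refine Finset.sum_congr rfl fun k _ => ?_
    rw [lintegral_const_mul _ (hm _), lintegral_chi_rpow hp]
  rw [← h1]
  refine lorentzNorm_le_of_le hp hu ?_ ?_ fun x => ?_
  · intro a ha b hb hab
    refine Finset.sum_le_sum fun k _ => mul_le_mul_right (ENNReal.rpow_le_rpow ?_ hp.le) _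
    exact antitoneOn_coe_chi _ ha hb hab
  · intro x hx
    refine Finset.sum_eq_zero fun k _ => ?_
    rw [chi_of_notMem fun h => hx.not_gt h.1]
    simp [hp]
  · by_cases hx : ∃ j : Fin (2 ^ n), x ∈ Ioc ((j : ℝ) * r) (((j : ℝ) + 1) * r)
    · obtain ⟨j, hj⟩ := hx
      rw [step_eq hr _ j hj]
      -- The value `1 / (j + 1)` is compared with the dyadic scale `2 ^ k ≤ j + 1 < 2 ^ (k + 1)`.
      set k := Nat.log 2 ((j : ℕ) + 1) with hk
      have hk1 : 2 ^ k ≤ (j : ℕ) + 1 := Nat.pow_log_le_self 2 (Nat.succ_ne_zero _)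
      have hk2 : (j : ℕ) + 1 < 2 ^ (k + 1) := Nat.lt_pow_succ_log_self one_lt_two _
      have hkn : k ≤ n := (Nat.pow_le_pow_iff_right one_lt_two).1 (hk1.trans j.2)
      refine le_trans ?_ (Finset.single_le_sum (fun _ _ => zero_le)
        (Finset.mem_range.2 (Nat.lt_succ_of_le hkn)))
      have hk2' : ((j : ℕ) : ℝ) + 1 ≤ 2 ^ (k + 1) := by exact_mod_cast hk2.le
      have h0 : (0 : ℝ) ≤ (j : ℝ) * r := by positivity
      rw [chi_of_mem ⟨h0.trans_lt hj.1, hj.2.trans (mul_le_mul_of_nonneg_right hk2' hr.le)⟩,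
        ENNReal.coe_one, ENNReal.one_rpow, mul_one]
      refine ENNReal.rpow_le_rpow ?_ hp.le
      rw [ENNReal.coe_inv (by positivity), ENNReal.inv_le_inv]
      exact_mod_cast hk1
    · push Not at hx
      rw [step_eq_zero _ hx, ENNReal.coe_zero, ENNReal.zero_rpow_of_pos hp]
      exact zero_le

theorem half_le_sum_inv (n : ℕ) :
    ((n : ℝ≥0) / 2) ≤ ∑ j : Fin (2 ^ n), ((j : ℝ≥0) + 1)⁻¹ := by
  rw [← NNReal.coe_le_coe]
  push_cast
  rw [Fin.sum_univ_eq_sum_range (fun j : ℕ => ((j : ℝ) + 1)⁻¹)]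
  have h1 := log_add_one_le_harmonic (2 ^ n)
  have h2 : ((harmonic (2 ^ n) : ℚ) : ℝ) = ∑ j ∈ Finset.range (2 ^ n), ((j : ℝ) + 1)⁻¹ := by
    rw [harmonic]
    push_cast
    rfl
  rw [h2] at h1
  refine le_trans ?_ h1
  push_cast
  have h3 : Real.log (2 ^ n) ≤ Real.log ((2 ^ n : ℕ) + 1) :=
    Real.log_le_log (by positivity) (by push_cast; linarith)
  rw [Real.log_pow] at h3
  push_cast at h1 h3
  have h4 := Real.log_two_gt_d9
  have h5 : (0 : ℝ) ≤ n := Nat.cast_nonneg n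
  nlinarith

/-- At a suitable scale `2 ^ n` the primitive of the weight grows strictly slower than the
`p`-th power. The averages of the step function with values `1 / (j + 1)` gain a factor of order
`n ^ p` over the `n + 1` dyadic scales of its `p`-th power. -/
theorem IsSumBounded.exists_decay (hp : 1 < p) (hu : IsWeight u) (h : IsSumBounded p u) :
    ∃ n : ℕ, 0 < n ∧ ∀ r : ℝ, 0 < r → 2 * weightMeasure u (Ioo 0 (2 ^ n * r))
      ≤ (2 ^ n : ℝ≥0∞) ^ p * weightMeasure u (Ioo 0 r) := by
  have hp0 : 0 < p := by linarith
  obtain ⟨K, hK⟩ := h.exists_step_le hp0 hu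
  have hgrowth : ∀ (k : ℕ) (r : ℝ), 0 < r → weightMeasure u (Ioo 0 (2 ^ k * r))
      ≤ (K * 2 ^ k) ^ p * weightMeasure u (Ioo 0 r) := by
    intro k r hr
    have h1 := (hK (2 ^ k) r hr (Pi.single 0 1)).trans (mul_le_mul_right (mul_le_mul_right
      (lorentzNorm_step_single_le hp0 hu hr) _) _)
    rw [Finset.sum_pi_single' , if_pos (Finset.mem_univ _), ← mul_assoc] at h1
    have h2 := rpow_one_div_mul_le hp0 h1
    push_cast at h2
    simpa using h2
  have hmain : ∀ (n : ℕ) (r : ℝ), 0 < r →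
      ((n : ℝ≥0∞) / 2) ^ p * weightMeasure u (Ioo 0 (2 ^ n * r))
        ≤ (K * 2 ^ n) ^ p * (((n : ℝ≥0∞) + 1) * ((2 * K) ^ p * weightMeasure u (Ioo 0 r))) := by
    intro n r hr
    have h1 := (hK (2 ^ n) r hr (fun j => ((j : ℝ≥0) + 1)⁻¹)).trans
      (mul_le_mul_right (mul_le_mul_right (lorentzNorm_step_harmonic_le hp0 hu n hr) _) _)
    rw [← mul_assoc] at h1
    have h2 := rpow_one_div_mul_le hp0 h1
    push_cast at h2
    have hsum : (n : ℝ≥0∞) / 2 ≤ ((∑ j : Fin (2 ^ n), ((j : ℝ≥0) + 1)⁻¹ : ℝ≥0) : ℝ≥0∞) := by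
      refine le_trans ?_ (ENNReal.coe_le_coe.2 (half_le_sum_inv n))
      rw [ENNReal.coe_div two_ne_zero]
      simp
    push_cast at hsum
    refine (mul_le_mul_left (ENNReal.rpow_le_rpow hsum hp0.le) _).trans (h2.trans ?_)
    refine mul_le_mul_right ?_ _
    calc _ ≤ ∑ k ∈ Finset.range (n + 1), (2 * (K : ℝ≥0∞)) ^ p * weightMeasure u (Ioo 0 r) := by
          refine Finset.sum_le_sum fun k _ => ?_
          refine (mul_le_mul_right (hgrowth (k + 1) r hr) _).trans ?_
          rw [← mul_assoc, ← ENNReal.mul_rpow_of_nonneg _ _ hp0.le]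
          refine mul_le_mul_left (ENNReal.rpow_le_rpow ?_ hp0.le) _
          have h2k : (2 ^ k : ℝ≥0∞)⁻¹ * 2 ^ k = 1 :=
            ENNReal.inv_mul_cancel (by simp) (by simp)
          calc (2 ^ k : ℝ≥0∞)⁻¹ * (K * 2 ^ (k + 1))
              = ((2 ^ k : ℝ≥0∞)⁻¹ * 2 ^ k) * (2 * K) := by ring
            _ ≤ 2 * K := by rw [h2k, one_mul]
      _ = _ := by
          rw [Finset.sum_const, Finset.card_range, nsmul_eq_mul]
          push_cast
          rfl
  -- The right-hand sides of `hmain` and of the goal share the factor `(2 ^ n) ^ p`; it remains to beat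
  -- `2 (n + 1) (4 K ^ 2) ^ p` by `n ^ p`, which is possible because `p > 1`.
  set D : ℝ≥0 := (4 * K ^ 2) ^ p with hD
  obtain ⟨n, hn0, hn⟩ : ∃ n : ℕ, 0 < n ∧ 4 * (D : ℝ) ≤ (n : ℝ) ^ (p - 1) := by
    have ht := (tendsto_rpow_atTop (show 0 < p - 1 by linarith)).comp
      (tendsto_natCast_atTop_atTop (R := ℝ))
    obtain ⟨n, h1, h2⟩ := ((ht.eventually_ge_atTop (4 * (D : ℝ))).and
      (Filter.eventually_gt_atTop 0)).exists
    exact ⟨n, h2, h1⟩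
  have hn1 : (1 : ℝ) ≤ n := by exact_mod_cast hn0
  have hDn : 2 * ((n : ℝ≥0) + 1) * D ≤ (n : ℝ≥0) ^ p := by
    rw [← NNReal.coe_le_coe]
    push_cast
    have e : (n : ℝ) ^ p = n * (n : ℝ) ^ (p - 1) := by
      rw [← Real.rpow_one_add' (by positivity) (by linarith)]
      ring_nf
    have hD0 : (0 : ℝ) ≤ D := D.2
    rw [e]
    calc 2 * ((n : ℝ) + 1) * D ≤ n * (4 * D) := by nlinarith
      _ ≤ _ := by gcongr
  refine ⟨n, hn0, fun r hr => ?_⟩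
  have hhalf0 : ((n : ℝ≥0∞) / 2) ^ p ≠ 0 := by
    simp [ENNReal.rpow_eq_zero_iff, hn0.ne', ENNReal.div_eq_zero_iff, hp0.not_gt]
  have hhalft : ((n : ℝ≥0∞) / 2) ^ p ≠ ∞ :=
    ENNReal.rpow_ne_top_of_nonneg hp0.le (ENNReal.div_ne_top (by simp) (by simp))
  rw [← ENNReal.mul_le_mul_iff_right hhalf0 hhalft]
  have hcoef : 2 * ((K * 2 ^ n) ^ p * (((n : ℝ≥0∞) + 1) * (2 * K) ^ p))
      ≤ ((n : ℝ≥0∞) / 2) ^ p * (2 ^ n : ℝ≥0∞) ^ p := by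
    have h4 : (4 : ℝ≥0∞) = 2 * 2 := by norm_num
    have e1 : ((K : ℝ≥0∞) * 2 ^ n) ^ p * (2 * K) ^ p
        = (2⁻¹ : ℝ≥0∞) ^ p * (2 ^ n : ℝ≥0∞) ^ p * (D : ℝ≥0∞) := by
      rw [hD, ENNReal.coe_rpow_of_nonneg _ hp0.le, ← ENNReal.mul_rpow_of_nonneg _ _ hp0.le,
        ← ENNReal.mul_rpow_of_nonneg _ _ hp0.le, ← ENNReal.mul_rpow_of_nonneg _ _ hp0.le]
      congr 1
      push_cast
      rw [h4]
      calc (K : ℝ≥0∞) * 2 ^ n * (2 * K) = 1 * (2 * (K * K * 2 ^ n)) := by ring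
        _ = (2⁻¹ * 2) * (2 * (K * K * 2 ^ n)) := by
            rw [ENNReal.inv_mul_cancel two_ne_zero ENNReal.ofNat_ne_top]
        _ = _ := by ring
    have e2 : ((n : ℝ≥0∞) / 2) ^ p = (n : ℝ≥0∞) ^ p * (2⁻¹ : ℝ≥0∞) ^ p := by
      rw [div_eq_mul_inv, ENNReal.mul_rpow_of_nonneg _ _ hp0.le]
    have e3 : 2 * ((n : ℝ≥0∞) + 1) * D ≤ (n : ℝ≥0∞) ^ p := by
      have := ENNReal.coe_le_coe.2 hDn
      rw [ENNReal.coe_rpow_of_nonneg _ hp0.le] at this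
      exact_mod_cast this
    calc 2 * ((K * 2 ^ n) ^ p * (((n : ℝ≥0∞) + 1) * (2 * K) ^ p))
        = 2 * ((n : ℝ≥0∞) + 1) * (((K : ℝ≥0∞) * 2 ^ n) ^ p * (2 * K) ^ p) := by ring
      _ = (2 * ((n : ℝ≥0∞) + 1) * D) * ((2⁻¹ : ℝ≥0∞) ^ p * (2 ^ n : ℝ≥0∞) ^ p) := by
          rw [e1]
          ring
      _ ≤ (n : ℝ≥0∞) ^ p * ((2⁻¹ : ℝ≥0∞) ^ p * (2 ^ n : ℝ≥0∞) ^ p) := by gcongr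
      _ = _ := by rw [e2, mul_assoc]
  calc ((n : ℝ≥0∞) / 2) ^ p * (2 * weightMeasure u (Ioo 0 (2 ^ n * r)))
      = 2 * (((n : ℝ≥0∞) / 2) ^ p * weightMeasure u (Ioo 0 (2 ^ n * r))) := by ring
    _ ≤ 2 * ((K * 2 ^ n) ^ p * (((n : ℝ≥0∞) + 1) * ((2 * K) ^ p * weightMeasure u (Ioo 0 r)))) :=
        mul_le_mul_right (hmain n r hr) _
    _ = 2 * ((K * 2 ^ n) ^ p * (((n : ℝ≥0∞) + 1) * (2 * K) ^ p)) * weightMeasure u (Ioo 0 r) := by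
        ring
    _ ≤ ((n : ℝ≥0∞) / 2) ^ p * (2 ^ n : ℝ≥0∞) ^ p * weightMeasure u (Ioo 0 r) :=
        mul_le_mul_left hcoef _
    _ = _ := by ring

theorem isBp_of_decay (hp : 0 < p) (hu : IsWeight u) {n : ℕ} (hn : 0 < n)
    (h : ∀ r : ℝ, 0 < r → 2 * weightMeasure u (Ioo 0 (2 ^ n * r))
      ≤ (2 ^ n : ℝ≥0∞) ^ p * weightMeasure u (Ioo 0 r)) : IsBp p u := by
  set Q : ℝ≥0∞ := (2 ^ n : ℝ≥0∞) ^ p with hQ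
  set q : ℝ := 2 ^ n with hq
  have hq1 : 1 < q := one_lt_pow₀ one_lt_two hn.ne'
  have hq0 : 0 < q := by positivity
  have hqQ : ENNReal.ofReal q ^ p = Q := by
    rw [hQ, hq, ENNReal.ofReal_pow (by norm_num)]
    norm_num
  have hQ0 : Q ≠ 0 := by simp [hQ, ENNReal.rpow_eq_zero_iff, hp.not_gt]
  have hQt : Q ≠ ∞ := ENNReal.rpow_ne_top_of_nonneg hp.le (by simp)
  have hiter : ∀ (j : ℕ) (r : ℝ), 0 < r → weightMeasure u (Ioo 0 (q ^ j * r))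
      ≤ (2⁻¹ : ℝ≥0∞) ^ j * Q ^ j * weightMeasure u (Ioo 0 r) := by
    intro j
    induction j with
    | zero => intro r _; simp
    | succ j ih =>
      intro r hr
      have h1 := ih (q * r) (by positivity)
      rw [← mul_assoc, ← pow_succ] at h1
      have h2 : weightMeasure u (Ioo 0 (q * r)) ≤ 2⁻¹ * (Q * weightMeasure u (Ioo 0 r)) := by
        rw [← ENNReal.div_eq_inv_mul, ENNReal.le_div_iff_mul_le (by simp) (by simp), mul_comm]
        exact h r hr
      refine h1.trans ((mul_le_mul_right h2 _).trans_eq ?_)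
      ring
  refine (isBp_iff hu).2 ⟨((2 ^ n : ℝ≥0) ^ p), ?_, fun r hr => hu.measure_Ioo_ne_top hr,
    fun r hr => ?_⟩
  · refine weightMeasure_ac u ?_
    rw [Measure.restrict_apply measurableSet_Iic, Iic_inter_Ioi, Ioc_self, measure_empty]
  have hcov : Ioi r ⊆ ⋃ j : ℕ, Ico (q ^ j * r) (q ^ (j + 1) * r) := by
    intro x hx
    have hx' : 1 < x / r := (one_lt_div hr).2 hx
    obtain ⟨j, hj1, hj2⟩ := exists_nat_pow_near hx'.le hq1
    exact mem_iUnion.2 ⟨j, (le_div_iff₀ hr).1 hj1, (div_lt_iff₀ hr).1 hj2⟩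
  have hterm : ∀ j : ℕ, ENNReal.ofReal r ^ p * ∫⁻ x in Ico (q ^ j * r) (q ^ (j + 1) * r),
      (ENNReal.ofReal x ^ p)⁻¹ ∂(weightMeasure u)
        ≤ (2⁻¹ : ℝ≥0∞) ^ (j + 1) * (Q * weightMeasure u (Ioo 0 r)) := by
    intro j
    have hj0 : 0 < q ^ j * r := by positivity
    have hr0 : ENNReal.ofReal r ^ p ≠ 0 := by simp [ENNReal.rpow_eq_zero_iff, hr]
    have hrt : ENNReal.ofReal r ^ p ≠ ∞ :=
      ENNReal.rpow_ne_top_of_nonneg hp.le ENNReal.ofReal_ne_top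
    have hQj : ENNReal.ofReal (q ^ j * r) ^ p = Q ^ j * ENNReal.ofReal r ^ p := by
      rw [ENNReal.ofReal_mul (by positivity), ENNReal.mul_rpow_of_nonneg _ _ hp.le, ← hqQ,
        ENNReal.ofReal_pow hq0.le, ← ENNReal.rpow_natCast, ← ENNReal.rpow_natCast,
        ← ENNReal.rpow_mul, ← ENNReal.rpow_mul, mul_comm p]
    calc _ ≤ ENNReal.ofReal r ^ p * ∫⁻ _ in Ico (q ^ j * r) (q ^ (j + 1) * r),
          (Q ^ j * ENNReal.ofReal r ^ p)⁻¹ ∂(weightMeasure u) := by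
          refine mul_le_mul_right (setLIntegral_mono' measurableSet_Ico fun x hx => ?_) _
          rw [← hQj, ENNReal.inv_le_inv]
          exact ENNReal.rpow_le_rpow (ENNReal.ofReal_le_ofReal hx.1) hp.le
      _ ≤ ENNReal.ofReal r ^ p * ((Q ^ j * ENNReal.ofReal r ^ p)⁻¹
            * weightMeasure u (Ioo 0 (q ^ (j + 1) * r))) := by
          rw [setLIntegral_const]
          gcongr
      _ ≤ ENNReal.ofReal r ^ p * ((Q ^ j * ENNReal.ofReal r ^ p)⁻¹
            * ((2⁻¹ : ℝ≥0∞) ^ (j + 1) * Q ^ (j + 1) * weightMeasure u (Ioo 0 r))) := by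
          gcongr
          exact hiter _ _ hr
      _ = _ := by
          rw [ENNReal.mul_inv (Or.inr hrt) (Or.inr hr0)]
          calc _ = (ENNReal.ofReal r ^ p * (ENNReal.ofReal r ^ p)⁻¹) * ((Q ^ j)⁻¹ * Q ^ j)
                * ((2⁻¹ : ℝ≥0∞) ^ (j + 1) * (Q * weightMeasure u (Ioo 0 r))) := by ring
            _ = _ := by
                rw [ENNReal.mul_inv_cancel hr0 hrt,
                  ENNReal.inv_mul_cancel (pow_ne_zero _ hQ0) (ENNReal.pow_ne_top hQt)]
                ring
  have hgeom : ∑' j : ℕ, (2⁻¹ : ℝ≥0∞) ^ (j + 1) = 1 := by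
    rw [ENNReal.tsum_geometric_add_one, ENNReal.one_sub_inv_two,
      ENNReal.mul_inv_cancel (by simp) (by simp)]
  calc _ ≤ ENNReal.ofReal r ^ p * ∑' j : ℕ, ∫⁻ x in Ico (q ^ j * r) (q ^ (j + 1) * r),
        (ENNReal.ofReal x ^ p)⁻¹ ∂(weightMeasure u) :=
        mul_le_mul_right ((lintegral_mono_set hcov).trans (lintegral_iUnion_le _ _)) _
    _ = ∑' j : ℕ, ENNReal.ofReal r ^ p * ∫⁻ x in Ico (q ^ j * r) (q ^ (j + 1) * r),
        (ENNReal.ofReal x ^ p)⁻¹ ∂(weightMeasure u) := ENNReal.tsum_mul_left.symm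
    _ ≤ ∑' j : ℕ, (2⁻¹ : ℝ≥0∞) ^ (j + 1) * (Q * weightMeasure u (Ioo 0 r)) :=
        ENNReal.tsum_le_tsum hterm
    _ = Q * weightMeasure u (Ioo 0 r) := by rw [ENNReal.tsum_mul_right, hgeom, one_mul]
    _ = _ := by
        rw [hQ, ENNReal.coe_rpow_of_nonneg _ hp.le]
        simp

theorem IsSumBounded.isBp (hp : 1 < p) (hu : IsWeight u) (h : IsSumBounded p u) : IsBp p u := by
  obtain ⟨n, hn, hdecay⟩ := h.exists_decay hp hu
  exact isBp_of_decay (by linarith) hu hn hdecay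

theorem isBp_of_isNormable_norm2 (hp : 1 < p) (hu : IsWeight u) (hv : IsWeight v)
    (hu0 : weightMeasure u ≠ 0) (hv0 : weightMeasure v ≠ 0) (h : IsNormable (norm2 p u v)) :
    IsBp p u ∧ IsBp p v := by
  have hp0 : 0 < p := by linarith
  obtain ⟨h1, h2⟩ := isSumBounded_of_isNormable hp0 hu hv hu0 hv0 (fun a b ha hb => by
    obtain ⟨M, hM⟩ := hb.bounded
    exact norm2_tensor hp0 hu hv ha.measurable hb.measurable hM) h
  exact ⟨h1.isBp hp hu, h2.isBp hp hv⟩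

theorem isBp_of_isNormable_mixedNorm (hp : 1 < p) (hu : IsWeight u) (hv : IsWeight v)
    (hu0 : weightMeasure u ≠ 0) (hv0 : weightMeasure v ≠ 0) (h : IsNormable (mixedNorm p p u v)) :
    IsBp p u ∧ IsBp p v := by
  have hp0 : 0 < p := by linarith
  obtain ⟨h1, h2⟩ := isSumBounded_of_isNormable hp0 hu hv hu0 hv0 (fun a b ha hb =>
    mixedNorm_tensor hp0 ha.measurable hb.measurable (hb.lorentzNorm_ne_top hp0 hv)) h
  exact ⟨h1.isBp hp hu, h2.isBp hp hv⟩

end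

end MixedLorentz

end

theorem theorem2p4 (p : ℝ) (hp : 1 < p) (u v : ℝ → ℝ) (hu : IsWeight u) (hv : IsWeight v)
    (hu0 : ¬ u =ᵐ[volume.restrict (Ioi 0)] 0) (hv0 : ¬ v =ᵐ[volume.restrict (Ioi 0)] 0) :
    [IsNormable (norm2 p u v),
      IsBp p u ∧ IsBp p v,
      IsNormable (mixedNorm p p u v),
      IsEquivalentNorm (norm2 p u v) (norm2Star p u v),
      BoundedOnDec p u v hardy2,
      BoundedOnDec p u v starStarYX,
      IsEquivalent (norm2 p u v) (norm2Two p u v)].TFAE := by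
  have hp0 : 0 < p := by linarith
  have hu1 := hu.weightMeasure_ne_zero hu0
  have hv1 := hv.weightMeasure_ne_zero hv0
  tfae_have 1 → 2 := isBp_of_isNormable_norm2 hp hu hv hu1 hv1
  tfae_have 2 → 4 := fun h => isEquivalentNorm_norm2Star hp hu hv hu1 hv1 h.1 h.2
  tfae_have 4 → 1 := fun h => ⟨_, h⟩
  tfae_have 2 → 3 := fun h => isNormable_mixedNorm hp hu hv hu1 hv1 h.1 h.2
  tfae_have 3 → 2 := isBp_of_isNormable_mixedNorm hp hu hv hu1 hv1
  tfae_have 2 → 5 := fun h => boundedOnDec_hardy2 hp hu hv h.1 h.2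
  tfae_have 5 → 2 := isBp_of_boundedOnDec_hardy2 hp0 hu hv hu1 hv1
  tfae_have 2 → 6 := fun h => boundedOnDec_starStarYX hp hu hv h.1 h.2
  tfae_have 6 → 2 := isBp_of_boundedOnDec_starStarYX hp0 hu hv hu1 hv1
  tfae_have 2 → 7 := fun h => isEquivalent_norm2Two hp hu hv h.1 h.2
  tfae_have 7 → 2 := isBp_of_isEquivalent_norm2Two hp0 hu hv hu1 hv1
  tfae_finish
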